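/- **Setting.** Write $B_\rho$ for the open disc of radius $\rho$ centred at $0$ in $\mathbb{R}^2$, $\chi_E$ for the characteristic function of $E$, and identify $L^1(B_R)$ with the functions of $L^1(\mathbb{R}^2)$ vanishing a.e. outside $B_R$. For an open set $U$ let $|Df|(U)\in[0,+\infty]$ be the total variation of $f$ on $U$, and let $$d_{st}(f,g)=\int_{B_{R'}}|f-g|+\big||Df|(B_{R'})-|Dg|(B_{R'})\big|$$ be the distance of strict convergence in $BV(B_{R'})$. *Masks.* Fix $r,L,R,\gamma>0$ and $R'>R$. A bounded open set $\Omega\subset\mathbb{R}^2$ is Lipschitz with constants $r$ and $L$ if for every $x\in\partial\Omega$ there are a rigid transformation $g$ of the plane and a function $f:\mathbb{R}\to\mathbb{R}$ with Lipschitz constant at most $L$ such that, for every $y\in B_r(x)$ and with $(y_1',y_2')=g(y)$, one has $y\in\Omega$ if and only if $y_2'<f(y_1')$. Let $\mathcal{A}$ be the class of these sets that are contained in $B_R$, let $A=\{u\in L^1(B_R): 0\le u\le 1\text{ a.e. in }B_R\}$, and let $$\mathcal{A}_\gamma=\{u\in A:\ \|u-\chi_D\|_{L^1(B_R)}\le\gamma\text{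 for some }D\in\mathcal{A}\},$$ with the topology of the $L^1$ norm. *Optics.* Let $0<s_0\le 1$ and let $\hat T\in C_c^\infty(\mathbb{R}^2)$ be real valued and radial with $\hat T=1$ on $B_{s_0}$. Put $T(x)=(2\pi)^{-2}\int_{\mathbb{R}^2}\hat T(\xi)e^{i\xi\cdot x}\,d\xi$. Let $0<s\le 1/s_0$, $0<\sigma\le s$ and $0<h<1$. Set $K(x)=(ss_0)^{-2}\,T(x/(ss_0))$ and $J(x)=2J_1(\sigma|x|/s)/(\sigma|x|/s)$, $J(0)=1$, where $J_1$ is the Bessel function of the first kind of order one. For $u\in A$ let $$I(u)(x)=\int_{\mathbb{R}^2}\int_{\mathbb{R}^2}u(\xi)K(x-\xi)J(\xi-\zeta)K(x-\zeta)u(\zeta)\,d\zeta\,d\xi .$$ Let $\phi\in C^\infty(\mathbb{R})$ be nondecreasing with $\phi=0$ on $(-\infty,-1/2]$ and $\phi=1$ on $[1/2,+\infty)$, and for $\eta>0$ let $\Phi_\eta(u)=\phi\big((I(u)-h)/\eta\big)$. *Functionals.* Let $1<p<+\infty$, $1/p+1/p'=1$, let $W:\mathbb{R}\to[0,+\infty)$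 be continuous with $W(t)=0$ if and only if $t\in\{0,1\}$, and let $c_p=\big(\int_0^1W(t)^{1/p'}dt\big)^{-1}$. For $\varepsilon>0$ let $$P_\varepsilon(u)=\frac{c_p}{p'\varepsilon}\int_{B_R}W(u)+\frac{c_p\,\varepsilon^{p-1}}{p}\int_{B_R}|\nabla u|^p\quad\text{if }u\in W^{1,p}_0(B_R),\qquad P_\varepsilon(u)=+\infty\quad\text{otherwise.}$$ Let $b>0$, let $\Omega_0\in\mathcal{A}$, and let $\eta:[0,+\infty)\to[0,+\infty)$ be continuous and strictly increasing with $\eta(0)=0$. For $\varepsilon>0$ and $u\in A$ let $$F_\varepsilon(u)=d_{st}\big(\Phi_{\eta(\varepsilon)}(u),\chi_{\Omega_0}\big)+b\,P_\varepsilon(u)\in[0,+\infty].$$ **Proposition (equicoercivity).** For every $\varepsilon_0>0$ there is a compact subset $\mathcal{K}$ of $\mathcal{A}_\gamma$ such that, for every $\varepsilon$ with $0<\varepsilon\le\varepsilon_0$, both of the following minima are attained and $$\min_{\mathcal{K}}F_\varepsilon=\min_{\mathcal{A}_\gamma}F_\varepsilon .$$ -/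

import Mathlib

open MeasureTheory Set Metric Filter Topology
open scoped ENNReal ContDiff

noncomputable section

namespace Photolithography

/-- The Euclidean plane. -/
abbrev Plane : Type := EuclideanSpace ℝ (Fin 2)

/-! ### Admissible masks -/

/-- `Ω` is a bounded open set that is Lipschitz with constants `r` and `L`: around each boundary
point `x`, inside the ball of radius `r` and after a rigid motion `g` of the plane, it is the
subgraph of a function with Lipschitz constant at most `L`. -/
def IsLipschitzDomain (r L : ℝ) (Ω : Set Plane) : Prop :=
  IsOpen Ω ∧ Bornology.IsBounded Ω ∧
    ∀ x ∈ frontier Ω, ∃ (g : Plane ≃ᵢ Plane) (f : ℝ → ℝ),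
      (∀ a b, |f a - f b| ≤ L * |a - b|) ∧
      ∀ y ∈ ball x r, y ∈ Ω ↔ (g y) 1 < f ((g y) 0)

/-- The class of Lipschitz sets with constants `r`, `L` contained in the ball of radius `R`. -/
def lipschitzClass (r L R : ℝ) : Set (Set Plane) :=
  {D | IsLipschitzDomain r L D ∧ D ⊆ ball 0 R}

/-- The characteristic function of `D`. -/
def chi (D : Set Plane) : Plane → ℝ := D.indicator fun _ => 1

/-- `L¹(ℝ²)` with its norm topology. -/
abbrev L1 : Type := Lp ℝ 1 (volume : Measure Plane)

/-- The functions of `L¹(B_R)` (extended by zero to the plane) with values in `[0, 1]` a.e. -/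
def phaseFields (R : ℝ) : Set L1 :=
  {u | (∀ᵐ x : Plane, x ∉ ball (0 : Plane) R → u x = 0) ∧
    ∀ᵐ x : Plane, x ∈ ball (0 : Plane) R → 0 ≤ u x ∧ u x ≤ 1}

/-- The phase fields at `L¹(B_R)`-distance at most `γ` from the characteristic function of
some admissible Lipschitz set. -/
def admissible (r L R γ : ℝ) : Set L1 :=
  {u | u ∈ phaseFields R ∧
    ∃ D ∈ lipschitzClass r L R, ∫ x in ball (0 : Plane) R, |u x - chi D x| ≤ γ}

/-! ### Image formation -/

/-- The Bessel function of the first kind of order one, by Bessel's integral. -/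
def besselJ1 (t : ℝ) : ℝ :=
  Real.pi⁻¹ * ∫ θ in (0 : ℝ)..Real.pi, Real.cos (θ - t * Real.sin θ)

/-- The mutual intensity `x ↦ 2 J₁(a|x|) / (a|x|)`, extended by continuity with value `1` at `0`. -/
def mutualIntensity (a : ℝ) (x : Plane) : ℝ :=
  if x = 0 then 1 else 2 * besselJ1 (a * ‖x‖) / (a * ‖x‖)

/-- The inverse Fourier transform `(2π)⁻² ∫ That(ξ) exp(i ξ·x) dξ`. For a radial real `That`, as
used below, this integral is real, and taking the real part does not change it. -/
def inverseFourier (That : Plane → ℝ) (x : Plane) : ℝ :=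
  (((2 * Real.pi) ^ 2 : ℂ)⁻¹ *
    ∫ ξ : Plane, (That ξ : ℂ) * Complex.exp (Complex.I * ((inner ℝ ξ x : ℝ) : ℂ))).re

/-- The rescaling `f_s(x) = s⁻² f(x / s)`. -/
def rescale (s : ℝ) (f : Plane → ℝ) (x : Plane) : ℝ := (s ^ 2)⁻¹ * f (s⁻¹ • x)

/-- Hopkins' light intensity of the mask `u`, for the point spread function `K` and the mutual
intensity `J`. -/
def hopkins (K J u : Plane → ℝ) (x : Plane) : ℝ :=
  ∫ ξ : Plane, ∫ ζ : Plane, u ξ * K (x - ξ) * J (ξ - ζ) * K (x - ζ) * u ζ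

/-- The light intensity `I_{s,σ}(u)`: the point spread function is `T_{s s₀}`, where `T` has
Fourier transform `That`, and the mutual intensity has parameter `kσNA = σ / s`. -/
def intensity (That : Plane → ℝ) (s₀ s σ : ℝ) (u : Plane → ℝ) : Plane → ℝ :=
  hopkins (rescale (s * s₀) (inverseFourier That)) (mutualIntensity (σ / s)) u

/-- `φ` is a smooth approximate Heaviside function. -/
def IsSmoothHeaviside (φ : ℝ → ℝ) : Prop :=
  ContDiff ℝ ∞ φ ∧ Monotone φ ∧ (∀ t, t ≤ -(1 / 2) → φ t = 0) ∧ ∀ t, 1 / 2 ≤ t → φ t = 1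

/-- The relaxed exposed pattern `Φ_η(u) = φ ((I_{s,σ}(u) - h) / η)`. -/
def exposure (φ : ℝ → ℝ) (h η : ℝ) (That : Plane → ℝ) (s₀ s σ : ℝ) (u : Plane → ℝ)
    (x : Plane) : ℝ :=
  φ ((intensity That s₀ s σ u x - h) / η)

/-! ### Total variation and strict convergence -/

/-- The divergence of a vector field in the plane. -/
def divergence (ψ : Plane → Plane) (x : Plane) : ℝ :=
  ∑ i : Fin 2, (fderiv ℝ ψ x (EuclideanSpace.single i 1)) i

/-- The total variation `|Df|(U) ∈ [0, ∞]` of a function `f` integrable on the open set `U`. -/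
def totalVariation (f : Plane → ℝ) (U : Set Plane) : ℝ≥0∞ :=
  ⨆ (ψ : Plane → Plane) (_ : ContDiff ℝ 1 ψ) (_ : HasCompactSupport ψ) (_ : tsupport ψ ⊆ U)
    (_ : ∀ x, ‖ψ x‖ ≤ 1), ENNReal.ofReal (∫ x in U, f x * divergence ψ x)

/-- The distance `∫_U |f - g| + | |Df|(U) - |Dg|(U) |` of strict convergence in `BV(U)`. The
absolute value of a difference of two elements of `[0, ∞]` is the sum of the two truncated
differences, one of which is zero. -/
def strictDist (U : Set Plane) (f g : Plane → ℝ) : ℝ≥0∞ :=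
  (∫⁻ x in U, ‖f x - g x‖ₑ) +
    ((totalVariation f U - totalVariation g U) + (totalVariation g U - totalVariation f U))

/-! ### The Modica-Mortola functional -/

/-- `u` belongs to `W₀^{1,p}(U)` (extended by zero to the plane) and has weak gradient `g`:
`(u, g)` is the limit in `Lᵖ` of pairs `(v, ∇v)` with `v` smooth and compactly supported in `U`.
Such a `g` is determined by `u` up to null sets. -/
def IsSobolevZero (p : ℝ) (U : Set Plane) (u : Plane → ℝ) (g : Plane → Plane) : Prop :=
  MemLp u (ENNReal.ofReal p) ∧ MemLp g (ENNReal.ofReal p) ∧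
    ∃ v : ℕ → Plane → ℝ,
      (∀ n, ContDiff ℝ ∞ (v n) ∧ HasCompactSupport (v n) ∧ tsupport (v n) ⊆ U) ∧
      Tendsto (fun n => eLpNorm (fun x => v n x - u x) (ENNReal.ofReal p) volume) atTop (𝓝 0) ∧
      Tendsto (fun n => eLpNorm (fun x => gradient (v n) x - g x) (ENNReal.ofReal p) volume)
        atTop (𝓝 0)

/-- `W` is a continuous nonnegative double-well potential with wells exactly at `0` and `1`. -/
def IsDoubleWell (W : ℝ → ℝ) : Prop :=
  Continuous W ∧ (∀ t, 0 ≤ W t) ∧ ∀ t, W t = 0 ↔ t = 0 ∨ t = 1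

/-- The exponent conjugate to `p`. -/
def conjExp (p : ℝ) : ℝ := p / (p - 1)

/-- The constant `c_p = (∫₀¹ W^{1/p'})⁻¹`. -/
def wellConst (p : ℝ) (W : ℝ → ℝ) : ℝ := (∫ t in (0 : ℝ)..1, W t ^ (1 / conjExp p))⁻¹

/-- The functional `P_ε(u)`, which is
`c_p / (p' ε) ∫_U W(u) + c_p ε^{p-1} / p ∫_U |∇u|^p` if `u ∈ W₀^{1,p}(U)` and `+∞` otherwise.
The infimum runs over the weak gradients of `u`: it is over the empty family if `u` is not in
`W₀^{1,p}(U)`, and all its members are equal otherwise. -/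
def modicaMortola (p : ℝ) (W : ℝ → ℝ) (U : Set Plane) (ε : ℝ) (u : Plane → ℝ) : ℝ≥0∞ :=
  ⨅ (g : Plane → Plane) (_ : IsSobolevZero p U u g),
    (ENNReal.ofReal (wellConst p W / (conjExp p * ε)) * ∫⁻ x in U, ENNReal.ofReal (W (u x))) +
      ENNReal.ofReal (wellConst p W * ε ^ (p - 1) / p) * ∫⁻ x in U, ‖g x‖ₑ ^ p

/-- The functional `F_ε(u) = d_st(Φ_{η(ε)}(u), χ_{Ω₀}) + b P_ε(u)`, where `d_st` is the strict
distance of `BV(B_{R'})` and `P_ε` is the Modica-Mortola functional of `B_R`. -/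
def designFunctional (R R' : ℝ) (That : Plane → ℝ) (s₀ s σ h : ℝ) (φ η : ℝ → ℝ)
    (Ω₀ : Set Plane) (b p : ℝ) (W : ℝ → ℝ) (ε : ℝ) (u : L1) : ℝ≥0∞ :=
  strictDist (ball 0 R') (exposure φ h (η ε) That s₀ s σ u) (chi Ω₀) +
    ENNReal.ofReal b * modicaMortola p W (ball 0 R) ε u

end Photolithography

end

noncomputable section

namespace Photolithography

/-! ### Total variation of differentiable functions -/

/-! The empty mask is a competitor whose cost does not see `ε`: its exposed pattern is constant and
its Modica-Mortola energy vanishes, so its cost is at most `C₀ = |B_{R'}| + |Dχ_{Ω₀}|(B_{R'})`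
(`designFunctional_zero_le`). If `C₀` is finite, a mask with `P_ε(u) > C₀ / b` cannot beat it. The
compact set is therefore the closure in `L¹` of the admissible masks with `P_ε(u) ≤ C₀ / b` for some
`ε > 0`; it depends neither on `ε` nor on `ε₀`. If `C₀ = ∞`, every mask costs `∞`, because exposed
patterns always have finite variation; no perimeter bound for Lipschitz domains is needed.

Compactness (`totallyBounded_modicaMortola_le`) is the Modica-Mortola trick. With `H` the primitive
of `W^{1/p'}`, Young's inequality bounds the gradient of `H ∘ u` in `L¹` by the energy, uniformly in
`ε`. So `H ∘ u` has a uniform Lipschitz modulus of translation in `L¹`, a Kolmogorov-Riesz argument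
on sliding averages applies, and injectivity of `H` on `[0, 1]` brings precompactness back to `u`.

The admissible class is closed (`isClosed_admissible`) because Lipschitz sets with fixed constants
are compact: along an ultrafilter the charts converge, the limit set belongs to the same class, and
the sets agree with it eventually on compacta away from its null boundary.

Minima exist since the functional is lower semicontinuous
(`lowerSemicontinuousOn_designFunctional`). The exposure maps `L¹` continuously into `C¹` with
uniform bounds, hence continuously for the strict distance. The potential term is handled by Fatou's
lemma. The Dirichlet term uses no weak topology: almost energy-minimising test functions
approximating `u` have Cauchy gradients by uniform convexity (`exists_isSobolevZero_of_approx`). -/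

lemma fderiv_coord {ψ : Plane → Plane} (hψ : Differentiable ℝ ψ) (i : Fin 2) (x v : Plane) :
    (fderiv ℝ ψ x v) i = fderiv ℝ (fun y => ψ y i) x v := by
  have h := ((EuclideanSpace.proj i : Plane →L[ℝ] ℝ).hasFDerivAt.comp x
    (hψ x).hasFDerivAt).fderiv
  have h2 : (fun y => ψ y i) = (EuclideanSpace.proj i : Plane →L[ℝ] ℝ) ∘ ψ := by
    ext; simp
  rw [h2, h]
  simp

lemma linearMap_apply_eq_sum (l : Plane →L[ℝ] ℝ) (v : Plane) :
    l v = ∑ i, l (EuclideanSpace.single i 1) * v i := by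
  have : v = ∑ i, v i • (EuclideanSpace.single i (1 : ℝ) : Plane) := by
    ext j
    fin_cases j <;> simp
  conv_lhs => rw [this]
  simp [mul_comm]

/-- Integration by parts coordinate by coordinate. Since `f` is only differentiable, its derivative
is merely measurable; the bound `M` is what makes its product with the compactly supported field
integrable. -/
lemma integral_mul_divergence {f : Plane → ℝ} (hf : Differentiable ℝ f) {M : ℝ}
    (hM : ∀ x, ‖fderiv ℝ f x‖ ≤ M) {ψ : Plane → Plane} (hψ : ContDiff ℝ 1 ψ)
    (hc : HasCompactSupport ψ) :
    ∫ x, f x * divergence ψ x = -∫ x, fderiv ℝ f x (ψ x) := by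
  have hψi : ∀ i : Fin 2, ContDiff ℝ 1 (fun x => ψ x i) := fun i =>
    (EuclideanSpace.proj i : Plane →L[ℝ] ℝ).contDiff.comp hψ
  have hci : ∀ i : Fin 2, HasCompactSupport (fun x => ψ x i) := fun i =>
    hc.comp_left (g := fun v : Plane => v i) rfl
  have hint1 : ∀ i : Fin 2, Integrable
      (fun x => f x * fderiv ℝ (fun y => ψ y i) x (EuclideanSpace.single i 1)) := fun i => by
    apply Continuous.integrable_of_hasCompactSupport
    · exact hf.continuous.mul (((hψi i).continuous_fderiv (by norm_num)).clm_apply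
        continuous_const)
    · exact ((hci i).fderiv_apply (𝕜 := ℝ) _).mul_left
  have hint2 : ∀ i : Fin 2, Integrable
      (fun x => fderiv ℝ f x (EuclideanSpace.single i 1) * ψ x i) := fun i => by
    have h1 : Integrable (fun x => ψ x i) :=
      (hψi i).continuous.integrable_of_hasCompactSupport (hci i)
    refine h1.bdd_mul (c := M) ?_ (.of_forall fun x => ?_)
    · exact (measurable_fderiv_apply_const ℝ f _).aestronglyMeasurable
    · refine (ContinuousLinearMap.le_opNorm _ _).trans ?_
      simpa using hM x
  simp only [divergence, fderiv_coord (hψ.differentiable (by norm_num)), Finset.mul_sum]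
  rw [integral_finsetSum _ fun i _ => hint1 i]
  simp only [linearMap_apply_eq_sum (fderiv ℝ f _) (ψ _)]
  rw [integral_finsetSum _ fun i _ => hint2 i, ← Finset.sum_neg_distrib]
  refine Finset.sum_congr rfl fun i _ => ?_
  refine integral_mul_fderiv_eq_neg_fderiv_mul_of_integrable (hint2 i) (hint1 i) ?_
    (fun x _ => hf x) (fun x _ => (hψi i).differentiable (by norm_num) x)
  exact (hf.continuous.mul (hψi i).continuous).integrable_of_hasCompactSupport (hci i).mul_left

lemma divergence_eq_zero {ψ : Plane → Plane} {x : Plane} (hx : x ∉ tsupport ψ) :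
    divergence ψ x = 0 := by
  have : fderiv ℝ ψ x = 0 := by
    by_contra h
    exact hx (support_fderiv_subset ℝ h)
  simp [divergence, this]

lemma continuous_divergence {ψ : Plane → Plane} (hψ : ContDiff ℝ 1 ψ) :
    Continuous (divergence ψ) := by
  unfold divergence
  have := hψ.continuous_fderiv (by norm_num)
  fun_prop

/-- The total variation is bounded along perturbations by the integral of the gradient. -/
lemma totalVariation_le_add {f g : Plane → ℝ} (hf : Differentiable ℝ f) (hg : Differentiable ℝ g)
    {M N : ℝ} (hM : ∀ x, ‖fderiv ℝ f x‖ ≤ M) (hN : ∀ x, ‖fderiv ℝ g x‖ ≤ N) (U : Set Plane) :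
    totalVariation f U ≤
      totalVariation g U + ∫⁻ x in U, ‖fderiv ℝ f x - fderiv ℝ g x‖ₑ := by
  refine iSup_le fun ψ => iSup_le fun hψ => iSup_le fun hc => iSup_le fun hU => iSup_le fun h1 => ?_
  have hd : ∀ x, x ∉ U → divergence ψ x = 0 := fun x hx => divergence_eq_zero fun h => hx (hU h)
  have hint : ∀ k : Plane → ℝ, Continuous k → Integrable (fun x => k x * divergence ψ x) :=
    fun k hk => by
      apply (hk.mul (continuous_divergence hψ)).integrable_of_hasCompactSupport
      exact HasCompactSupport.intro hc fun x hx => by simp [divergence_eq_zero hx]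
  have e : ∀ k : Plane → ℝ, ∫ x in U, k x * divergence ψ x = ∫ x, k x * divergence ψ x :=
    fun k => setIntegral_eq_integral_of_forall_compl_eq_zero fun x hx => by simp [hd x hx]
  have hfg : ∀ x, fderiv ℝ (fun y => f y - g y) x = fderiv ℝ f x - fderiv ℝ g x :=
    fun x => fderiv_fun_sub (hf x) (hg x)
  -- Integrating by parts only in the difference `f - g` leaves a competitor for the variation of
  -- `g` and a remainder controlled by the gradients, as `‖ψ‖ ≤ 1`.
  have hsplit : ∫ x in U, f x * divergence ψ x = (∫ x in U, g x * divergence ψ x) +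
      -∫ x, (fderiv ℝ f x - fderiv ℝ g x) (ψ x) := by
    have := integral_mul_divergence (f := fun y => f y - g y) (hf.sub hg) (M := M + N)
      (fun x => by rw [hfg]; exact (norm_sub_le _ _).trans (add_le_add (hM x) (hN x))) hψ hc
    simp only [hfg] at this
    rw [← this, e, e, ← integral_add (hint g hg.continuous)
      (hint (fun y => f y - g y) (hf.continuous.sub hg.continuous))]
    congr 1
    ext x
    ring
  rw [hsplit]
  refine ENNReal.ofReal_add_le.trans (add_le_add ?_ ?_)
  · exact le_iSup_of_le ψ <| le_iSup_of_le hψ <| le_iSup_of_le hc <| le_iSup_of_le hU <|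
      le_iSup_of_le h1 le_rfl
  · have : ∫ x, (fderiv ℝ f x - fderiv ℝ g x) (ψ x) =
        ∫ x in U, (fderiv ℝ f x - fderiv ℝ g x) (ψ x) := by
      refine (setIntegral_eq_integral_of_forall_compl_eq_zero fun x hx => ?_).symm
      rw [image_eq_zero_of_notMem_tsupport fun h => hx (hU h), map_zero]
    rw [this]
    refine (Real.ofReal_le_enorm _).trans ?_
    rw [enorm_neg]
    refine (enorm_integral_le_lintegral_enorm _).trans (lintegral_mono fun x => ?_)
    rw [enorm_le_iff_norm_le]
    refine (ContinuousLinearMap.le_opNorm _ _).trans ?_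
    exact mul_le_of_le_one_right (norm_nonneg _) (h1 x)

lemma totalVariation_const (c : ℝ) (U : Set Plane) : totalVariation (fun _ => c) U = 0 := by
  rw [← nonpos_iff_eq_zero]
  have h := totalVariation_le_add (f := fun _ : Plane => c) (g := fun _ => 0)
    (differentiable_const _) (differentiable_const _) (M := 0) (N := 0) (by simp) (by simp) U
  have h0 : totalVariation (fun _ => 0) U = 0 := by simp [totalVariation]
  refine h.trans (le_of_eq ?_)
  have h1 : ‖(0 : Plane →L[ℝ] ℝ)‖ₑ = 0 := by
    rw [← ofReal_norm, norm_zero, ENNReal.ofReal_zero]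
  simp only [fderiv_fun_const, Pi.zero_apply, sub_self, h1, lintegral_zero, h0, add_zero]

lemma totalVariation_ne_top {f : Plane → ℝ} (hf : Differentiable ℝ f) {M : ℝ}
    (hM : ∀ x, ‖fderiv ℝ f x‖ ≤ M) {U : Set Plane} (hU : volume U ≠ ⊤) :
    totalVariation f U ≠ ⊤ := by
  have h := totalVariation_le_add (g := fun _ => 0) hf (differentiable_const _) (N := 0) hM
    (by simp) U
  rw [totalVariation_const, zero_add] at h
  refine ne_top_of_le_ne_top ?_ h
  refine ne_top_of_le_ne_top (b := ∫⁻ x in U, ENNReal.ofReal M) ?_ (lintegral_mono fun x => ?_)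
  · simpa using ENNReal.mul_ne_top ENNReal.ofReal_ne_top hU
  · simp only [fderiv_fun_const, Pi.zero_apply, sub_zero]
    rw [← ofReal_norm]
    exact ENNReal.ofReal_le_ofReal (hM x)

lemma strictDist_triangle {U : Set Plane} {f g k : Plane → ℝ} (hf : AEMeasurable f)
    (hg : AEMeasurable g) :
    strictDist U f k ≤ strictDist U f g + strictDist U g k := by
  unfold strictDist
  have h1 : ∫⁻ x in U, ‖f x - k x‖ₑ ≤
      (∫⁻ x in U, ‖f x - g x‖ₑ) + ∫⁻ x in U, ‖g x - k x‖ₑ := by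
    rw [← lintegral_add_left' (f := fun x => ‖f x - g x‖ₑ) (hf.sub hg).enorm.restrict]
    refine lintegral_mono fun x => ?_
    rw [← sub_add_sub_cancel (f x) (g x) (k x)]
    exact enorm_add_le _ _
  have h2 := tsub_le_tsub_add_tsub (a := totalVariation f U) (b := totalVariation g U)
    (c := totalVariation k U)
  have h3 := tsub_le_tsub_add_tsub (a := totalVariation k U) (b := totalVariation g U)
    (c := totalVariation f U)
  refine (add_le_add h1 (add_le_add h2 h3)).trans (le_of_eq ?_)
  ring

lemma strictDist_le {f g : Plane → ℝ} (hf : Differentiable ℝ f) (hg : Differentiable ℝ g)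
    {M N : ℝ} (hM : ∀ x, ‖fderiv ℝ f x‖ ≤ M) (hN : ∀ x, ‖fderiv ℝ g x‖ ≤ N) (U : Set Plane) :
    strictDist U f g ≤ (∫⁻ x in U, ‖f x - g x‖ₑ) +
      2 * ∫⁻ x in U, ‖fderiv ℝ f x - fderiv ℝ g x‖ₑ := by
  unfold strictDist
  rw [two_mul]
  refine add_le_add le_rfl (add_le_add ?_ ?_)
  · exact tsub_le_iff_left.2 (totalVariation_le_add hf hg hM hN U)
  · have := totalVariation_le_add hg hf hN hM U
    simp only [enorm_sub_rev (fderiv ℝ g _)] at this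
    exact tsub_le_iff_left.2 this

/-! ### The mutual intensity -/

/-- Bessel's integral averages `cos (θ - t sin θ)` over `[0, π]`, and each integrand is 1-Lipschitz
in `t`. Together with the zero at the origin this bounds `2 J₁(t) / t` by `2`, which is all that is
needed of the mutual intensity besides measurability. -/
lemma abs_besselJ1_sub_le (s t : ℝ) : |besselJ1 s - besselJ1 t| ≤ |s - t| := by
  have hi : ∀ a : ℝ, IntervalIntegrable (fun θ => Real.cos (θ - a * Real.sin θ)) volume 0 Real.pi :=
    fun a => Continuous.intervalIntegrable (by fun_prop) _ _
  unfold besselJ1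
  rw [← mul_sub, ← intervalIntegral.integral_sub (hi s) (hi t), abs_mul,
    abs_of_pos (inv_pos.2 Real.pi_pos)]
  have := intervalIntegral.norm_integral_le_of_norm_le_const (a := 0) (b := Real.pi) (C := |s - t|)
    (f := fun θ => Real.cos (θ - s * Real.sin θ) - Real.cos (θ - t * Real.sin θ)) fun θ _ => by
      refine (Real.abs_cos_sub_cos_le _ _).trans ?_
      have : θ - s * Real.sin θ - (θ - t * Real.sin θ) = -((s - t) * Real.sin θ) := by ring
      rw [this, abs_neg, abs_mul]
      exact mul_le_of_le_one_right (abs_nonneg _) (Real.abs_sin_le_one θ)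
  rw [Real.norm_eq_abs, sub_zero, abs_of_pos Real.pi_pos] at this
  rw [inv_mul_le_iff₀ Real.pi_pos, mul_comm]
  exact this

lemma besselJ1_zero : besselJ1 0 = 0 := by simp [besselJ1]

lemma continuous_besselJ1 : Continuous besselJ1 :=
  (LipschitzWith.of_dist_le_mul (K := 1) fun s t => by
    simpa [Real.dist_eq] using abs_besselJ1_sub_le s t).continuous

lemma abs_mutualIntensity_le (a : ℝ) (x : Plane) : |mutualIntensity a x| ≤ 2 := by
  unfold mutualIntensity
  split_ifs
  · norm_num
  · have := abs_besselJ1_sub_le (a * ‖x‖) 0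
    rw [besselJ1_zero, sub_zero, sub_zero] at this
    rw [mul_div_assoc, abs_mul, abs_div, abs_two]
    exact mul_le_of_le_one_right (by norm_num) (div_le_one_of_le₀ this (abs_nonneg _))

lemma measurable_mutualIntensity (a : ℝ) : Measurable (mutualIntensity a) := by
  unfold mutualIntensity
  refine Measurable.ite (measurableSet_singleton 0) measurable_const ?_
  have := continuous_besselJ1.measurable
  fun_prop

/-! ### The point spread function -/

/-- Differentiable functions that are bounded together with their derivative. -/
def IsBddDiff (k : Plane → ℝ) (M : ℝ) : Prop :=
  Differentiable ℝ k ∧ (∀ x, |k x| ≤ M) ∧ ∀ x, ‖fderiv ℝ k x‖ ≤ M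

/-- Taking real parts under the integral gives a real integrand, ready for differentiation in `x`.
-/
lemma inverseFourier_eq_integral_cos {That : Plane → ℝ} (hT : Integrable That) (x : Plane) :
    inverseFourier That x =
      ((2 * Real.pi) ^ 2)⁻¹ * ∫ ξ, That ξ * Real.cos (inner ℝ ξ x) := by
  have hi : Integrable fun ξ : Plane =>
      (That ξ : ℂ) * Complex.exp (Complex.I * ((inner ℝ ξ x : ℝ) : ℂ)) := by
    refine hT.ofReal.mul_bdd (c := 1) ?_ (.of_forall fun ξ => ?_)
    · exact (Continuous.aestronglyMeasurable (by fun_prop))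
    · rw [mul_comm, Complex.norm_exp_ofReal_mul_I]
  have h1 : ((2 * Real.pi) ^ 2 : ℂ)⁻¹ = ((((2 * Real.pi) ^ 2)⁻¹ : ℝ) : ℂ) := by push_cast; rfl
  have h2 := integral_re hi
  unfold inverseFourier
  rw [h1, Complex.re_ofReal_mul]
  congr 1
  refine h2.symm.trans (integral_congr_ae (.of_forall fun ξ => ?_))
  have : Complex.I * ((inner ℝ ξ x : ℝ) : ℂ) = ((inner ℝ ξ x : ℝ) : ℂ) * Complex.I := mul_comm _ _
  simp only [this, RCLike.re_to_complex, Complex.re_ofReal_mul, Complex.exp_ofReal_mul_I_re]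

/-- The function and its derivative are dominated by the integrals of `|That|` and `|That| ‖ξ‖`,
finite by compact support. -/
lemma exists_isBddDiff_inverseFourier {That : Plane → ℝ} (hT : Continuous That)
    (hc : HasCompactSupport That) : ∃ M, IsBddDiff (inverseFourier That) M := by
  have hi : Integrable That := hT.integrable_of_hasCompactSupport hc
  have hi2 : Integrable fun ξ : Plane => |That ξ| * ‖ξ‖ := by
    refine Continuous.integrable_of_hasCompactSupport (by fun_prop) ?_
    exact (hc.comp_left (g := fun t : ℝ => |t|) (abs_zero)).mul_right
  set c : ℝ := ((2 * Real.pi) ^ 2)⁻¹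
  have hc0 : 0 ≤ c := by positivity
  have hF : ∀ x, HasFDerivAt (fun x => ∫ ξ, That ξ * Real.cos (inner ℝ ξ x))
      (∫ ξ, (That ξ * -Real.sin (inner ℝ ξ x)) • innerSL ℝ ξ) x := fun x => by
    refine hasFDerivAt_integral_of_dominated_of_fderiv_le (𝕜 := ℝ) (s := univ)
      (F' := fun x ξ => (That ξ * -Real.sin (inner ℝ ξ x)) • innerSL ℝ ξ)
      (bound := fun ξ : Plane => |That ξ| * ‖ξ‖) Filter.univ_mem ?_ ?_ ?_ ?_ hi2 ?_
    · exact .of_forall fun y => Continuous.aestronglyMeasurable (by fun_prop)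
    · refine hi.mul_bdd (c := 1) (Continuous.aestronglyMeasurable (by fun_prop)) ?_
      exact .of_forall fun ξ => Real.abs_cos_le_one _
    · refine Continuous.aestronglyMeasurable ?_
      have : Continuous fun ξ : Plane => innerSL ℝ ξ := (innerSL ℝ).continuous
      fun_prop
    · refine .of_forall fun ξ y _ => ?_
      rw [norm_smul, innerSL_apply_norm, norm_mul, norm_neg]
      refine mul_le_mul_of_nonneg_right ?_ (norm_nonneg _)
      exact mul_le_of_le_one_right (abs_nonneg _) (Real.abs_sin_le_one _)
    · refine .of_forall fun ξ y _ => ?_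
      have h1 : HasFDerivAt (fun y : Plane => inner ℝ ξ y) (innerSL ℝ ξ) y :=
        (innerSL ℝ ξ).hasFDerivAt
      simpa [smul_smul] using (h1.cos).const_mul (That ξ)
  have hfun : inverseFourier That = fun x => c * ∫ ξ, That ξ * Real.cos (inner ℝ ξ x) :=
    funext fun x => inverseFourier_eq_integral_cos hi x
  have hG : ∀ x, HasFDerivAt (inverseFourier That)
      (c • ∫ ξ, (That ξ * -Real.sin (inner ℝ ξ x)) • innerSL ℝ ξ) x := fun x => by
    rw [hfun]; exact (hF x).const_mul c
  refine ⟨max (c * ∫ ξ, |That ξ|) (c * ∫ ξ, |That ξ| * ‖ξ‖),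
    fun x => (hG x).differentiableAt, fun x => ?_, fun x => ?_⟩
  · refine le_trans ?_ (le_max_left _ _)
    rw [hfun, abs_mul, abs_of_nonneg hc0]
    refine mul_le_mul_of_nonneg_left ?_ hc0
    rw [← Real.norm_eq_abs]
    refine norm_integral_le_of_norm_le hi.abs (.of_forall fun ξ => ?_)
    rw [norm_mul]
    exact mul_le_of_le_one_right (abs_nonneg _) (Real.abs_cos_le_one _)
  · refine le_trans ?_ (le_max_right _ _)
    rw [(hG x).fderiv, norm_smul, Real.norm_of_nonneg hc0]
    refine mul_le_mul_of_nonneg_left ?_ hc0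
    refine norm_integral_le_of_norm_le hi2 (.of_forall fun ξ => ?_)
    rw [norm_smul, innerSL_apply_norm, norm_mul, norm_neg]
    refine mul_le_mul_of_nonneg_right ?_ (norm_nonneg _)
    exact mul_le_of_le_one_right (abs_nonneg _) (Real.abs_sin_le_one _)

lemma IsBddDiff.rescale {k : Plane → ℝ} {M : ℝ} (hk : IsBddDiff k M) (s : ℝ) :
    ∃ N, IsBddDiff (rescale s k) N := by
  obtain ⟨hd, hb, hb'⟩ := hk
  have hF : ∀ x, HasFDerivAt (Photolithography.rescale s k)
      ((s ^ 2)⁻¹ • (s⁻¹ • fderiv ℝ k (s⁻¹ • x))) x := fun x => by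
    have h1 := (hd (s⁻¹ • x)).hasFDerivAt.comp x
      ((s⁻¹ • ContinuousLinearMap.id ℝ Plane).hasFDerivAt (x := x))
    have h2 := h1.const_mul (s ^ 2)⁻¹
    exact h2.congr_fderiv (by ext v; simp)
  refine ⟨max ((s ^ 2)⁻¹ * M) ((s ^ 2)⁻¹ * (|s⁻¹| * M)), fun x => (hF x).differentiableAt,
    fun x => ?_, fun x => ?_⟩
  · refine le_trans ?_ (le_max_left _ _)
    rw [Photolithography.rescale, abs_mul, abs_of_nonneg (a := (s ^ 2)⁻¹) (by positivity)]
    exact mul_le_mul_of_nonneg_left (hb _) (by positivity)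
  · refine le_trans ?_ (le_max_right _ _)
    rw [(hF x).fderiv, norm_smul, norm_smul, Real.norm_of_nonneg (r := (s ^ 2)⁻¹) (by positivity)]
    gcongr
    · exact le_rfl
    · exact hb' _

/-! ### Hopkins' intensity -/

/-- The kernel of Hopkins' quadratic form. -/
def hopkinsKernel (K J : Plane → ℝ) (x : Plane) (z : Plane × Plane) : ℝ :=
  K (x - z.1) * J (z.1 - z.2) * K (x - z.2)

/-- The derivative of Hopkins' kernel in the first variable. -/
def hopkinsKernelDeriv (K J : Plane → ℝ) (x : Plane) (z : Plane × Plane) : Plane →L[ℝ] ℝ :=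
  J (z.1 - z.2) • (K (x - z.1) • fderiv ℝ K (x - z.2) + K (x - z.2) • fderiv ℝ K (x - z.1))

lemma hasFDerivAt_hopkinsKernel {K : Plane → ℝ} (hK : Differentiable ℝ K) (J : Plane → ℝ)
    (x : Plane) (z : Plane × Plane) :
    HasFDerivAt (fun y => hopkinsKernel K J y z) (hopkinsKernelDeriv K J x z) x := by
  have h : ∀ a : Plane, HasFDerivAt (fun y => K (y - a)) (fderiv ℝ K (x - a)) x := fun a => by
    exact ((hK (x - a)).hasFDerivAt.comp x ((hasFDerivAt_id x).sub_const a)).congr_fderiv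
      (by ext v; simp)
  have h1 := ((h z.1).mul_const (J (z.1 - z.2))).mul (h z.2)
  refine h1.congr_fderiv ?_
  ext v
  simp [hopkinsKernelDeriv]
  ring

lemma measurable_hopkinsKernel {K J : Plane → ℝ} (hK : Differentiable ℝ K) (hJ : Measurable J)
    (x : Plane) : Measurable (hopkinsKernel K J x) := by
  have := hK.continuous.measurable
  unfold hopkinsKernel
  fun_prop

lemma measurable_hopkinsKernelDeriv {K J : Plane → ℝ} (hK : Differentiable ℝ K)
    (hJ : Measurable J) (x : Plane) : Measurable (hopkinsKernelDeriv K J x) := by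
  have := hK.continuous.measurable
  have h2 := measurable_fderiv ℝ K
  unfold hopkinsKernelDeriv
  fun_prop

/-- The product is at most `2 M²`; the constant `4 M²` is taken so as to share it with the
derivative, whose product rule has two terms. -/
lemma abs_hopkinsKernel_le {K J : Plane → ℝ} {M : ℝ} (hK : IsBddDiff K M) (hJ : ∀ x, |J x| ≤ 2)
    (x : Plane) (z : Plane × Plane) : |hopkinsKernel K J x z| ≤ 4 * M ^ 2 := by
  have h0 : 0 ≤ M := (abs_nonneg _).trans (hK.2.1 0)
  rw [hopkinsKernel, abs_mul, abs_mul]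
  calc _ ≤ M * 2 * M := by
        gcongr
        exacts [hK.2.1 _, hJ _, hK.2.1 _]
    _ ≤ _ := by nlinarith

lemma norm_hopkinsKernelDeriv_le {K J : Plane → ℝ} {M : ℝ} (hK : IsBddDiff K M)
    (hJ : ∀ x, |J x| ≤ 2) (x : Plane) (z : Plane × Plane) :
    ‖hopkinsKernelDeriv K J x z‖ ≤ 4 * M ^ 2 := by
  have h0 : 0 ≤ M := (abs_nonneg _).trans (hK.2.1 0)
  rw [hopkinsKernelDeriv, norm_smul]
  calc _ ≤ 2 * (M * M + M * M) := by
        refine mul_le_mul (hJ _) ((norm_add_le _ _).trans ?_) (norm_nonneg _) (by norm_num)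
        rw [norm_smul, norm_smul]
        gcongr
        exacts [hK.2.1 _, hK.2.2 _, hK.2.1 _, hK.2.2 _]
    _ ≤ _ := by nlinarith

/-- Hopkins' intensity is differentiable, and it is locally Lipschitz in the mask together with
its derivative. -/
lemma exists_hopkins_bound {K J : Plane → ℝ} {M : ℝ} (hK : IsBddDiff K M) (hJm : Measurable J)
    (hJ : ∀ x, |J x| ≤ 2) : ∃ C, 0 ≤ C ∧ ∀ u : L1, Differentiable ℝ (hopkins K J u) ∧
      (∀ x, ‖fderiv ℝ (hopkins K J u) x‖ ≤ C * ‖u‖ ^ 2) ∧ ∀ v : L1,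
      (∀ x, |hopkins K J v x - hopkins K J u x| ≤ C * ((‖v‖ + ‖u‖) * ‖v - u‖)) ∧
      ∀ x, ‖fderiv ℝ (hopkins K J v) x - fderiv ℝ (hopkins K J u) x‖ ≤
        C * ((‖v‖ + ‖u‖) * ‖v - u‖) := by
  have hu : ∀ u : L1, Integrable (fun z : Plane × Plane => u z.1 * u z.2) := fun u =>
    (L1.integrable_coeFn u).mul_prod (L1.integrable_coeFn u)
  have hN : ∀ (U : Plane × Plane → ℝ), Integrable U → ∀ x,
      Integrable (fun z => U z * hopkinsKernel K J x z) := fun U hU x =>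
    hU.mul_bdd (measurable_hopkinsKernel hK.1 hJm x).aestronglyMeasurable
      (.of_forall fun z => abs_hopkinsKernel_le hK hJ x z)
  have hN' : ∀ (U : Plane × Plane → ℝ), Integrable U → ∀ x,
      Integrable (fun z => U z • hopkinsKernelDeriv K J x z) := fun U hU x => by
    refine hU.smul_bdd (C := 4 * M ^ 2)
      (measurable_hopkinsKernelDeriv hK.1 hJm x).aestronglyMeasurable
      (.of_forall fun z => norm_hopkinsKernelDeriv_le hK hJ x z)
  have heq : ∀ u : L1, hopkins K J u =
      fun x => ∫ z : Plane × Plane, (u z.1 * u z.2) * hopkinsKernel K J x z := fun u => by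
    ext x
    rw [Measure.volume_eq_prod, integral_prod _ (hN _ (hu u) x)]
    unfold hopkins hopkinsKernel
    congr! 4
    ring
  have hD : ∀ (u : L1) x, HasFDerivAt (hopkins K J u)
      (∫ z : Plane × Plane, (u z.1 * u z.2) • hopkinsKernelDeriv K J x z) x := fun u x => by
    rw [heq]
    refine hasFDerivAt_integral_of_dominated_of_fderiv_le (𝕜 := ℝ) (s := univ)
      (F' := fun x z => (u z.1 * u z.2) • hopkinsKernelDeriv K J x z)
      (bound := fun z : Plane × Plane => ‖u z.1 * u z.2‖ * (4 * M ^ 2)) Filter.univ_mem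
      (.of_forall fun y => (hN _ (hu u) y).1) (hN _ (hu u) x) (hN' _ (hu u) x).1
      (.of_forall fun z y _ => ?_) ((hu u).norm.mul_const _) (.of_forall fun z y _ => ?_)
    · rw [norm_smul]
      gcongr
      exact norm_hopkinsKernelDeriv_le hK hJ y z
    · exact (hasFDerivAt_hopkinsKernel hK.1 J y z).const_mul _
  have hnorm : ∀ u : L1, ∫ x, |u x| = ‖u‖ := fun u => (L1.norm_eq_integral_norm u).symm
  have hsub : ∀ u v : L1, ∫ x, |v x - u x| = ‖v - u‖ := fun u v => by
    rw [← hnorm]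
    refine integral_congr_ae ?_
    filter_upwards [Lp.coeFn_sub v u] with x hx
    rw [hx]; rfl
  -- The intensity is linear in the tensor square of the mask, so its dependence on the mask reduces
  -- to the splitting `v ⊗ v - u ⊗ u = v ⊗ (v - u) + (v - u) ⊗ u`.
  have hdiff : ∀ u v : L1, ∫ z : Plane × Plane, |v z.1 * v z.2 - u z.1 * u z.2| ≤
      (‖v‖ + ‖u‖) * ‖v - u‖ := fun u v => by
    have hi : Integrable (fun x => |v x - u x|) :=
      ((L1.integrable_coeFn v).sub (L1.integrable_coeFn u)).abs
    have h1 : Integrable (fun z : Plane × Plane => |v z.1| * |v z.2 - u z.2|) :=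
      (L1.integrable_coeFn v).abs.mul_prod hi
    have h2 : Integrable (fun z : Plane × Plane => |v z.1 - u z.1| * |u z.2|) :=
      hi.mul_prod (L1.integrable_coeFn u).abs
    calc _ ≤ ∫ z : Plane × Plane, (|v z.1| * |v z.2 - u z.2| + |v z.1 - u z.1| * |u z.2|) := by
          refine integral_mono ((hu v).sub (hu u)).abs (h1.add h2) fun z => ?_
          have : v z.1 * v z.2 - u z.1 * u z.2 =
            v z.1 * (v z.2 - u z.2) + (v z.1 - u z.1) * u z.2 := by ring
          simp only [this]
          rw [← abs_mul, ← abs_mul]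
          exact abs_add_le _ _
      _ = ‖v‖ * ‖v - u‖ + ‖v - u‖ * ‖u‖ := by
          rw [integral_add h1 h2, ← hnorm, ← hnorm u, ← hsub, Measure.volume_eq_prod,
            integral_prod_mul (fun x => |v x|) (fun x => |v x - u x|),
            integral_prod_mul (fun x => |v x - u x|) (fun x => |u x|)]
      _ = _ := by ring
  have hbd : ∀ (U : Plane × Plane → ℝ), Integrable U → ∀ x,
      |∫ z, U z * hopkinsKernel K J x z| ≤ 4 * M ^ 2 * ∫ z, |U z| := fun U hU x => by
    rw [mul_comm, ← integral_mul_const, ← Real.norm_eq_abs]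
    refine norm_integral_le_of_norm_le (hU.abs.mul_const _) (.of_forall fun z => ?_)
    rw [norm_mul]
    exact mul_le_mul_of_nonneg_left (abs_hopkinsKernel_le hK hJ x z) (abs_nonneg _)
  have hbd' : ∀ (U : Plane × Plane → ℝ), Integrable U → ∀ x,
      ‖∫ z, U z • hopkinsKernelDeriv K J x z‖ ≤ 4 * M ^ 2 * ∫ z, |U z| := fun U hU x => by
    rw [mul_comm, ← integral_mul_const]
    refine norm_integral_le_of_norm_le (hU.abs.mul_const _) (.of_forall fun z => ?_)
    rw [norm_smul]
    exact mul_le_mul_of_nonneg_left (norm_hopkinsKernelDeriv_le hK hJ x z) (abs_nonneg _)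
  refine ⟨4 * M ^ 2, by positivity, fun u => ⟨fun x => (hD u x).differentiableAt, fun x => ?_,
    fun v => ⟨fun x => ?_, fun x => ?_⟩⟩⟩
  · rw [(hD u x).fderiv]
    refine (hbd' _ (hu u) x).trans (le_of_eq ?_)
    simp only [abs_mul]
    rw [Measure.volume_eq_prod, integral_prod_mul (fun x => |u x|) (fun x => |u x|), hnorm, sq ‖u‖]
  · rw [heq, heq, ← integral_sub (hN _ (hu v) x) (hN _ (hu u) x)]
    simp only [← sub_mul]
    exact (hbd _ ((hu v).sub (hu u)) x).trans
      (mul_le_mul_of_nonneg_left (hdiff u v) (by positivity))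
  · rw [(hD u x).fderiv, (hD v x).fderiv, ← integral_sub (hN' _ (hu v) x) (hN' _ (hu u) x)]
    rw [integral_congr_ae (.of_forall fun z => (sub_smul (v z.1 * v z.2) (u z.1 * u z.2)
      (hopkinsKernelDeriv K J x z)).symm)]
    exact (hbd' _ ((hu v).sub (hu u)) x).trans
      (mul_le_mul_of_nonneg_left (hdiff u v) (by positivity))

/-! ### The exposed pattern -/

lemma IsSmoothHeaviside.mem_Icc {φ : ℝ → ℝ} (hφ : IsSmoothHeaviside φ) (t : ℝ) :
    φ t ∈ Icc (0 : ℝ) 1 := by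
  obtain ⟨-, hm, h0, h1⟩ := hφ
  constructor
  · rw [← h0 (min t (-(1 / 2))) (min_le_right _ _)]
    exact hm (min_le_left _ _)
  · rw [← h1 (max t (1 / 2)) (le_max_right _ _)]
    exact hm (le_max_left _ _)

lemma IsSmoothHeaviside.hasCompactSupport_deriv {φ : ℝ → ℝ} (hφ : IsSmoothHeaviside φ) :
    HasCompactSupport (deriv φ) := by
  obtain ⟨-, -, h0, h1⟩ := hφ
  refine HasCompactSupport.intro (isCompact_Icc (a := -(1 / 2 : ℝ)) (b := 1 / 2)) fun t ht => ?_
  rcases lt_or_ge t (-(1 / 2)) with h | h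
  · have : φ =ᶠ[𝓝 t] fun _ => 0 := by
      filter_upwards [Iio_mem_nhds h] with y hy using h0 y hy.le
    simp [this.deriv_eq]
  · have h' : 1 / 2 < t := by
      by_contra h2
      exact ht ⟨h, not_lt.1 h2⟩
    have : φ =ᶠ[𝓝 t] fun _ => 1 := by
      filter_upwards [Ioi_mem_nhds h'] with y hy using h1 y (le_of_lt hy)
    simp [this.deriv_eq]

/-- `φ` is constant off `[-1/2, 1/2]`, so `φ'` is a compactly supported `C¹` function, hence bounded
and Lipschitz. Lipschitz control of `φ'` is needed to compare gradients of two exposed patterns. -/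
lemma IsSmoothHeaviside.exists_bounds {φ : ℝ → ℝ} (hφ : IsSmoothHeaviside φ) :
    ∃ A : ℝ, 0 ≤ A ∧ (∀ s t, |φ s - φ t| ≤ A * |s - t|) ∧ (∀ t, |deriv φ t| ≤ A) ∧
      ∀ s t, |deriv φ s - deriv φ t| ≤ A * |s - t| := by
  have hc := hφ.hasCompactSupport_deriv
  have hd : ContDiff ℝ 1 (deriv φ) := by
    have h2 : ContDiff ℝ (1 + 1) φ := by exact_mod_cast contDiff_infty.1 hφ.1 2
    exact (contDiff_succ_iff_deriv.1 h2).2.2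
  obtain ⟨C, hC⟩ := hd.lipschitzWith_of_hasCompactSupport hc (by norm_num)
  obtain ⟨B, hB⟩ := hc.exists_bound_of_continuous hd.continuous
  have hB0 : 0 ≤ B := (norm_nonneg _).trans (hB 0)
  have hL : LipschitzWith ⟨B, hB0⟩ φ :=
    lipschitzWith_of_nnnorm_deriv_le (hφ.1.differentiable (by simp)) hB
  refine ⟨max B C, hB0.trans (le_max_left _ _), fun s t => ?_, fun t => ?_, fun s t => ?_⟩
  · exact (hL.dist_le_mul s t).trans (mul_le_mul_of_nonneg_right (le_max_left _ _) (abs_nonneg _))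
  · exact (hB t).trans (le_max_left _ _)
  · exact (hC.dist_le_mul s t).trans
      (mul_le_mul_of_nonneg_right (le_max_right _ _) (abs_nonneg _))

/-- The exposed pattern depends continuously on the mask, uniformly in `C¹`. -/
lemma exists_exposure_bound {φ : ℝ → ℝ} (hφ : IsSmoothHeaviside φ) {That : Plane → ℝ}
    (hT : Continuous That) (hc : HasCompactSupport That) (h η s₀ s σ : ℝ) :
    ∃ C, 0 ≤ C ∧ ∀ u : L1, Differentiable ℝ (exposure φ h η That s₀ s σ u) ∧
      (∀ x, ‖fderiv ℝ (exposure φ h η That s₀ s σ u) x‖ ≤ C * ‖u‖ ^ 2) ∧ ∀ v : L1,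
      (∀ x, |exposure φ h η That s₀ s σ v x - exposure φ h η That s₀ s σ u x| ≤
        C * ((‖v‖ + ‖u‖) * ‖v - u‖)) ∧
      ∀ x, ‖fderiv ℝ (exposure φ h η That s₀ s σ v) x -
          fderiv ℝ (exposure φ h η That s₀ s σ u) x‖ ≤
        C * ((‖v‖ + ‖u‖) * ‖v - u‖) * (1 + ‖v‖ ^ 2) := by
  obtain ⟨M, hM⟩ := exists_isBddDiff_inverseFourier hT hc
  obtain ⟨N, hN⟩ := hM.rescale (s * s₀)
  obtain ⟨B, hB0, hB⟩ := exists_hopkins_bound hN (measurable_mutualIntensity (σ / s))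
    (abs_mutualIntensity_le (σ / s))
  obtain ⟨A, hA0, hA1, hA2, hA3⟩ := hφ.exists_bounds
  change ∀ u : L1, Differentiable ℝ (intensity That s₀ s σ u) ∧
    (∀ x, ‖fderiv ℝ (intensity That s₀ s σ u) x‖ ≤ B * ‖u‖ ^ 2) ∧ ∀ v : L1,
    (∀ x, |intensity That s₀ s σ v x - intensity That s₀ s σ u x| ≤
      B * ((‖v‖ + ‖u‖) * ‖v - u‖)) ∧
    ∀ x, ‖fderiv ℝ (intensity That s₀ s σ v) x - fderiv ℝ (intensity That s₀ s σ u) x‖ ≤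
      B * ((‖v‖ + ‖u‖) * ‖v - u‖) at hB
  set I : L1 → Plane → ℝ := fun u => intensity That s₀ s σ u with hI
  set a : L1 → Plane → ℝ := fun u x => (I u x - h) / η with ha
  have hadiff : ∀ (u v : L1) x, |a v x - a u x| ≤ |η|⁻¹ * (B * ((‖v‖ + ‖u‖) * ‖v - u‖)) := by
    intro u v x
    have : a v x - a u x = η⁻¹ * (I v x - I u x) := by simp only [ha]; ring
    rw [this, abs_mul, abs_inv]
    exact mul_le_mul_of_nonneg_left (((hB u).2.2 v).1 x) (by positivity)
  have hF : ∀ (u : L1) x, HasFDerivAt (exposure φ h η That s₀ s σ u)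
      (deriv φ (a u x) • η⁻¹ • fderiv ℝ (I u) x) x := fun u x => by
    have h1 : HasFDerivAt (a u) (η⁻¹ • fderiv ℝ (I u) x) x := by
      simpa only [ha, div_eq_mul_inv] using
        (((hB u).1 x).hasFDerivAt.sub_const h).mul_const η⁻¹
    have h2 : HasDerivAt φ (deriv φ (a u x)) (a u x) :=
      ((hφ.1.differentiable (by simp)) _).hasDerivAt
    exact h2.comp_hasFDerivAt x h1
  set E : ℝ := |η|⁻¹ with hE
  have hE0 : 0 ≤ E := by positivity
  set C₁ := A * (E * B)
  set C₂ := A * (E * B) * (E * B)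
  have hC₁ : 0 ≤ C₁ := by positivity
  have hC₂ : 0 ≤ C₂ := by positivity
  refine ⟨C₁ + C₂, by positivity, fun u => ⟨fun x => (hF u x).differentiableAt, fun x => ?_,
    fun v => ⟨fun x => ?_, fun x => ?_⟩⟩⟩
  · rw [(hF u x).fderiv, norm_smul, norm_smul, norm_inv, Real.norm_eq_abs, Real.norm_eq_abs]
    calc _ ≤ A * (E * (B * ‖u‖ ^ 2)) := by
          gcongr
          exacts [hA2 _, (hB u).2.1 x]
      _ = C₁ * ‖u‖ ^ 2 := by ring
      _ ≤ _ := by gcongr; linarith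
  · calc _ ≤ A * |a v x - a u x| := hA1 _ _
      _ ≤ A * (E * (B * ((‖v‖ + ‖u‖) * ‖v - u‖))) := by gcongr; exact hadiff u v x
      _ = C₁ * ((‖v‖ + ‖u‖) * ‖v - u‖) := by ring
      _ ≤ _ := by gcongr; linarith
  · rw [(hF u x).fderiv, (hF v x).fderiv]
    -- The first term carries the full gradient of the intensity of `v`, which is the origin of the
    -- factor `1 + ‖v‖²`.
    have : deriv φ (a v x) • η⁻¹ • fderiv ℝ (I v) x - deriv φ (a u x) • η⁻¹ • fderiv ℝ (I u) x =
        (deriv φ (a v x) - deriv φ (a u x)) • η⁻¹ • fderiv ℝ (I v) x +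
        deriv φ (a u x) • η⁻¹ • (fderiv ℝ (I v) x - fderiv ℝ (I u) x) := by module
    rw [this]
    set δ := (‖v‖ + ‖u‖) * ‖v - u‖
    have hδ : 0 ≤ δ := by positivity
    calc _ ≤ A * (E * (B * δ)) * (E * (B * ‖v‖ ^ 2)) + A * (E * (B * δ)) := by
          refine (norm_add_le _ _).trans (add_le_add ?_ ?_)
          · rw [norm_smul, norm_smul, norm_inv, Real.norm_eq_abs, Real.norm_eq_abs]
            gcongr
            · refine (hA3 _ _).trans ?_
              gcongr
              exact hadiff u v x
            · exact (hB v).2.1 x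
          · rw [norm_smul, norm_smul, norm_inv, Real.norm_eq_abs, Real.norm_eq_abs]
            gcongr
            exacts [hA2 _, ((hB u).2.2 v).2 x]
      _ = C₂ * δ * ‖v‖ ^ 2 + C₁ * δ * 1 := by ring
      _ ≤ (C₁ + C₂) * δ * ‖v‖ ^ 2 + (C₁ + C₂) * δ * 1 := by gcongr <;> linarith
      _ = _ := by ring

lemma tendsto_strictDist_exposure {φ : ℝ → ℝ} (hφ : IsSmoothHeaviside φ) {That : Plane → ℝ}
    (hT : Continuous That) (hc : HasCompactSupport That) (h η s₀ s σ : ℝ) {U : Set Plane}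
    (hU : volume U ≠ ⊤) (u : L1) :
    Tendsto (fun v : L1 => strictDist U (exposure φ h η That s₀ s σ u)
      (exposure φ h η That s₀ s σ v)) (𝓝 u) (𝓝 0) := by
  obtain ⟨C, hC0, hC⟩ := exists_exposure_bound hφ hT hc h η s₀ s σ
  set Φ : L1 → Plane → ℝ := fun u => exposure φ h η That s₀ s σ u
  set err : L1 → ℝ := fun v => C * ((‖v‖ + ‖u‖) * ‖v - u‖) * (1 + ‖v‖ ^ 2)
  have herr : Tendsto err (𝓝 u) (𝓝 0) := by
    have : Continuous err := by fun_prop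
    convert this.tendsto u using 2
    simp [err]
  -- The factor `3` counts the `L¹` term once and the gradient term twice, as in `strictDist_le`.
  have hlim : Tendsto (fun v => 3 * (ENNReal.ofReal (err v) * volume U)) (𝓝 u) (𝓝 0) := by
    have h1 : Tendsto (fun v => ENNReal.ofReal (err v)) (𝓝 u) (𝓝 0) := by
      simpa using ENNReal.tendsto_ofReal herr
    have h2 := ENNReal.Tendsto.mul_const h1 (b := volume U) (Or.inr hU)
    have h3 := ENNReal.Tendsto.const_mul h2 (a := 3) (Or.inr (by norm_num))
    simpa using h3
  refine tendsto_of_tendsto_of_tendsto_of_le_of_le tendsto_const_nhds hlim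
    (fun _ => bot_le) fun v => ?_
  have hδ : 0 ≤ C * ((‖v‖ + ‖u‖) * ‖v - u‖) := by positivity
  have h1 : ∀ x, ‖Φ u x - Φ v x‖ₑ ≤ ENNReal.ofReal (err v) := fun x => by
    rw [← ofReal_norm, norm_sub_rev]
    refine ENNReal.ofReal_le_ofReal ((((hC u).2.2 v).1 x).trans ?_)
    exact le_mul_of_one_le_right hδ (by nlinarith [sq_nonneg ‖v‖])
  have h2 : ∀ x, ‖fderiv ℝ (Φ u) x - fderiv ℝ (Φ v) x‖ₑ ≤ ENNReal.ofReal (err v) := fun x => by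
    rw [← ofReal_norm, norm_sub_rev]
    exact ENNReal.ofReal_le_ofReal (((hC u).2.2 v).2 x)
  refine (strictDist_le (hC u).1 (hC v).1 (hC u).2.1 (hC v).2.1 U).trans ?_
  have e : ∫⁻ _ in U, ENNReal.ofReal (err v) = ENNReal.ofReal (err v) * volume U := by simp
  calc _ ≤ ENNReal.ofReal (err v) * volume U + 2 * (ENNReal.ofReal (err v) * volume U) := by
        rw [← e]
        gcongr with x x
        exacts [h1 x, h2 x]
    _ = _ := by ring

/-- Triangle inequality through the exposed pattern of a nearby mask. In this form nothing is
required of `g`, whose variation may be infinite. -/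
lemma lowerSemicontinuous_strictDist_exposure {φ : ℝ → ℝ} (hφ : IsSmoothHeaviside φ)
    {That : Plane → ℝ} (hT : Continuous That) (hc : HasCompactSupport That) (h η s₀ s σ : ℝ)
    {U : Set Plane} (hU : volume U ≠ ⊤) (g : Plane → ℝ) :
    LowerSemicontinuous (fun u : L1 => strictDist U (exposure φ h η That s₀ s σ u) g) := by
  obtain ⟨C, hC0, hC⟩ := exists_exposure_bound hφ hT hc h η s₀ s σ
  intro u c hcu
  have h1 := (tendsto_strictDist_exposure hφ hT hc h η s₀ s σ hU u).add_const c
  rw [zero_add] at h1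
  filter_upwards [h1.eventually_lt_const hcu] with v hv
  by_contra hlt
  refine absurd ((strictDist_triangle (k := g) ?_ ?_).trans
    (add_le_add le_rfl (not_lt.1 hlt))) (not_le.2 hv)
  · exact (hC u).1.continuous.aemeasurable
  · exact (hC v).1.continuous.aemeasurable

lemma totalVariation_exposure_ne_top {φ : ℝ → ℝ} (hφ : IsSmoothHeaviside φ) {That : Plane → ℝ}
    (hT : Continuous That) (hc : HasCompactSupport That) (h η s₀ s σ : ℝ) {U : Set Plane}
    (hU : volume U ≠ ⊤) (u : L1) :
    totalVariation (exposure φ h η That s₀ s σ u) U ≠ ⊤ := by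
  obtain ⟨C, -, hC⟩ := exists_exposure_bound hφ hT hc h η s₀ s σ
  exact totalVariation_ne_top (hC u).1 (hC u).2.1 hU

/-- The exposed pattern of the empty mask is constant. -/
lemma exposure_zero (φ : ℝ → ℝ) (h η : ℝ) (That : Plane → ℝ) (s₀ s σ : ℝ) :
    exposure φ h η That s₀ s σ (0 : L1) = fun _ => φ (-h / η) := by
  ext x
  simp [exposure, intensity, hopkins]

/-! ### Ultralimits of Lipschitz domains -/

/-- A rigid motion and a profile describing `Ω` near its boundary point `z`, normalised so that
`z` corresponds to the origin. -/
lemma IsLipschitzDomain.exists_chart {r L : ℝ} {Ω : Set Plane} (hr : 0 < r) (hL : 0 ≤ L)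
    (hΩ : IsLipschitzDomain r L Ω) {z : Plane} (hz : z ∈ frontier Ω) :
    ∃ (g : Plane ≃ᵢ Plane) (f : ℝ → ℝ), (∀ a b, |f a - f b| ≤ L * |a - b|) ∧ g z = 0 ∧ f 0 = 0 ∧
      ∀ y ∈ ball z r, y ∈ Ω ↔ 0 < f ((g y) 0) - (g y) 1 := by
  obtain ⟨ho, -, hch⟩ := hΩ
  obtain ⟨g, f, hf, hg⟩ := hch z hz
  have hfc : Continuous f := (LipschitzWith.of_dist_le_mul (K := ⟨L, hL⟩) hf).continuous
  -- The boundary point lies on the graph: strictly below, it would belong to the open set `Ω`;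
  -- strictly above, a neighbourhood of it would miss `Ω`.
  have hz0 : f ((g z) 0) = (g z) 1 := by
    have h1 : z ∉ Ω := (ho.frontier_eq ▸ hz).2
    refine le_antisymm (not_lt.1 fun h => h1 ((hg z (mem_ball_self hr)).2 h)) ?_
    by_contra hlt
    have hgc := g.continuous
    have hopen : IsOpen {y : Plane | f ((g y) 0) < (g y) 1} :=
      isOpen_lt (by fun_prop) (by fun_prop)
    have hn := inter_mem (hopen.mem_nhds (not_le.1 hlt)) (ball_mem_nhds z hr)
    obtain ⟨y, ⟨hy1, hy2⟩, hy3⟩ := mem_closure_iff_nhds.1 (frontier_subset_closure hz) _ hn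
    exact lt_asymm hy1 ((hg y hy2).1 hy3)
  refine ⟨g.trans (IsometryEquiv.addRight (-g z)), fun t => f (t + (g z) 0) - (g z) 1,
    fun a b => ?_, ?_, ?_, fun y hy => ?_⟩
  · have := hf (a + (g z) 0) (b + (g z) 0)
    rw [add_sub_add_right_eq_sub] at this
    rwa [sub_sub_sub_cancel_right]
  · simp
  · simp [hz0]
  · rw [hg y hy]
    simp

/-- The points near which almost all sets of the family are full. -/
def ultralimit {ι : Type*} (𝒰 : Ultrafilter ι) (D : ι → Set Plane) : Set Plane :=
  {x | ∃ ρ > 0, ∀ᶠ i in 𝒰, ball x ρ ⊆ D i}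

/-- The points near which almost all sets of the family have boundary points. -/
def boundaryUltralimit {ι : Type*} (𝒰 : Ultrafilter ι) (D : ι → Set Plane) : Set Plane :=
  {x | ∀ ρ > 0, ∀ᶠ i in 𝒰, (ball x ρ ∩ frontier (D i)).Nonempty}

section Ultralimit

variable {ι : Type*} {𝒰 : Ultrafilter ι} {D : ι → Set Plane}

lemma eventually_mem_of_mem_ultralimit {x : Plane} (hx : x ∈ ultralimit 𝒰 D) :
    ∀ᶠ i in 𝒰, x ∈ D i := by
  obtain ⟨ρ, hρ, h⟩ := hx
  filter_upwards [h] with i hi using hi (mem_ball_self hρ)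

lemma ball_subset_ultralimit {x : Plane} {ρ : ℝ} (h : ∀ᶠ i in 𝒰, ball x ρ ⊆ D i) :
    ball x ρ ⊆ ultralimit 𝒰 D := fun y hy => by
  refine ⟨ρ - dist y x, sub_pos.2 hy, ?_⟩
  filter_upwards [h] with i hi
  exact (ball_subset_ball' (by linarith)).trans hi

lemma isOpen_ultralimit : IsOpen (ultralimit 𝒰 D) :=
  Metric.isOpen_iff.2 fun _ ⟨ρ, hρ, h⟩ => ⟨ρ, hρ, ball_subset_ultralimit h⟩

/-- A ball is connected, so it cannot be split between the interior of `E` and the complement of its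
closure. -/
lemma ball_inter_frontier_nonempty {E : Set Plane} {x : Plane} {ρ : ℝ}
    (h1 : (ball x ρ ∩ E).Nonempty) (h2 : ¬ ball x ρ ⊆ E) : (ball x ρ ∩ frontier E).Nonempty := by
  by_contra hne
  rw [not_nonempty_iff_eq_empty, ← disjoint_iff_inter_eq_empty] at hne
  have hpre : IsPreconnected (ball x ρ) := (convex_ball x ρ).isPreconnected
  refine h2 fun y hy => ?_
  have hsub : ball x ρ ⊆ interior E ∪ (closure E)ᶜ := fun w hw => by
    by_cases hc : w ∈ closure E
    · left
      by_contra hi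
      exact disjoint_left.1 hne hw ⟨hc, hi⟩
    · exact Or.inr hc
  rcases hsub hy with h | h
  · exact interior_subset h
  · exfalso
    obtain ⟨a, ha, haE⟩ := h1
    have ha' : a ∈ interior E := by
      rcases hsub ha with h' | h'
      · exact h'
      · exact absurd (subset_closure haE) h'
    obtain ⟨w, -, hw1, hw2⟩ := hpre _ _ isOpen_interior isClosed_closure.isOpen_compl hsub
      ⟨a, ha, ha'⟩ ⟨y, hy, h⟩
    exact hw2 (subset_closure (interior_subset hw1))

/-- A ball around such a point contains a point of almost every `D i`, yet is contained in almost no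
`D i`. Passing from "not almost all" to "almost none" is where the ultrafilter is used. -/
lemma frontier_ultralimit_subset : frontier (ultralimit 𝒰 D) ⊆ boundaryUltralimit 𝒰 D := by
  intro x hx ρ hρ
  have hx1 : x ∉ ultralimit 𝒰 D := (isOpen_ultralimit.frontier_eq ▸ hx).2
  have h1 : ∀ᶠ i in 𝒰, ¬ ball x ρ ⊆ D i :=
    Ultrafilter.eventually_not.2 fun h => hx1 ⟨ρ, hρ, h⟩
  obtain ⟨y, hy1, hy2⟩ := mem_closure_iff_nhds.1 (frontier_subset_closure hx) _
    (ball_mem_nhds x hρ)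
  filter_upwards [h1, eventually_mem_of_mem_ultralimit hy2] with i hi1 hi2
  exact ball_inter_frontier_nonempty ⟨y, hy1, hi2⟩ hi1

/-- Some ball misses almost all boundaries, so it is inside or outside each such `D i`; the
ultrafilter selects one alternative for almost all indices. -/
lemma exists_ball_of_notMem_boundaryUltralimit {x : Plane} (hx : x ∉ boundaryUltralimit 𝒰 D) :
    ∃ ρ > 0, (∀ᶠ i in 𝒰, ball x ρ ⊆ D i) ∨ ∀ᶠ i in 𝒰, Disjoint (ball x ρ) (D i) := by
  simp only [boundaryUltralimit, mem_ofPred_eq, not_forall] at hx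
  obtain ⟨ρ, hρ, h⟩ := hx
  refine ⟨ρ, hρ, Ultrafilter.eventually_or.1 ?_⟩
  filter_upwards [Ultrafilter.eventually_not.2 h] with i hi
  by_contra hcon
  rw [not_or, not_disjoint_iff_nonempty_inter] at hcon
  exact hi (ball_inter_frontier_nonempty hcon.2 hcon.1)

/-- Bounded families converge along an ultrafilter, pointwise and simultaneously; this replaces
Arzelà-Ascoli and diagonal extractions. -/
lemma exists_tendsto_of_eventually_norm_le {E : Type*} [NormedAddCommGroup E] [ProperSpace E]
    {a : ι → E} {C : ℝ} (h : ∀ᶠ i in 𝒰, ‖a i‖ ≤ C) : ∃ l, Tendsto a 𝒰 (𝓝 l) := by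
  obtain ⟨l, -, hl⟩ := (isCompact_closedBall (0 : E) C).ultrafilter_le_nhds' (𝒰.map a)
    (show ∀ᶠ i in 𝒰, a i ∈ closedBall 0 C from h.mono fun i hi => mem_closedBall_zero_iff.2 hi)
  exact ⟨l, hl⟩

/-- Charts pass to the limit: near a limit of boundary points, the family is separated by the
graph of a limit profile. -/
lemma exists_limit_chart {r L : ℝ} (hr : 0 < r) (hL : 0 ≤ L)
    (hD : ∀ᶠ i in 𝒰, IsLipschitzDomain r L (D i)) {x : Plane} (hx : x ∈ boundaryUltralimit 𝒰 D) :
    ∃ (g : Plane ≃ᵢ Plane) (f : ℝ → ℝ), (∀ a b, |f a - f b| ≤ L * |a - b|) ∧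
      f ((g x) 0) = (g x) 1 ∧
      ∀ y ∈ ball x r,
        ((g y) 1 < f ((g y) 0) → y ∈ ultralimit 𝒰 D) ∧
        (f ((g y) 0) < (g y) 1 → ∃ ρ > 0, ∀ᶠ i in 𝒰, Disjoint (ball y ρ) (D i)) := by
  -- The chart of `D i` is taken at a boundary point nearest to `x`; these points converge to `x`
  -- along `𝒰`. Normalisation at the origin keeps motions and profiles pointwise bounded.
  have hex : ∀ᶠ i in 𝒰, ∃ c : Plane × (Plane ≃ᵢ Plane) × (ℝ → ℝ),
      dist x c.1 = infDist x (frontier (D i)) ∧ (∀ a b, |c.2.2 a - c.2.2 b| ≤ L * |a - b|) ∧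
      c.2.1 c.1 = 0 ∧ c.2.2 0 = 0 ∧
      ∀ y ∈ ball c.1 r, y ∈ D i ↔ 0 < c.2.2 ((c.2.1 y) 0) - (c.2.1 y) 1 := by
    filter_upwards [hD, hx 1 one_pos] with i hi hne
    obtain ⟨z, hz, hz'⟩ := isClosed_frontier.exists_infDist_eq_dist (hne.mono inter_subset_right) x
    obtain ⟨g, f, h1, h2, h3, h4⟩ := hi.exists_chart hr hL hz
    exact ⟨⟨z, g, f⟩, hz'.symm, h1, h2, h3, h4⟩
  obtain ⟨c, hc⟩ := hex.choice
  set z : ι → Plane := fun i => (c i).1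
  set G : ι → Plane ≃ᵢ Plane := fun i => (c i).2.1
  set F : ι → ℝ → ℝ := fun i => (c i).2.2
  have hz : Tendsto (fun i => dist x (z i)) 𝒰 (𝓝 0) := by
    rw [Metric.tendsto_nhds]
    intro ρ hρ
    filter_upwards [hc, hx ρ hρ] with i hi hne
    obtain ⟨w, hw, hw'⟩ := hne
    rw [dist_zero_right, Real.norm_of_nonneg dist_nonneg, hi.1]
    exact (infDist_le_dist_of_mem hw').trans_lt (mem_ball'.1 hw)
  have hG0 : ∀ᶠ i in 𝒰, ∀ y, ‖G i y‖ = dist y (z i) := by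
    filter_upwards [hc] with i hi y
    rw [← (G i).dist_eq, show G i (z i) = 0 from hi.2.2.1, dist_zero_right]
  have hGlim : ∀ y, ∃ l, Tendsto (fun i => G i y) 𝒰 (𝓝 l) := fun y => by
    refine exists_tendsto_of_eventually_norm_le (C := dist y x + 1) ?_
    filter_upwards [hG0, hz.eventually_lt_const one_pos] with i hi hi'
    rw [hi]
    exact (dist_triangle y x (z i)).trans (by linarith)
  choose g hg using hGlim
  have hFlim : ∀ t, ∃ l, Tendsto (fun i => F i t) 𝒰 (𝓝 l) := fun t => by
    refine exists_tendsto_of_eventually_norm_le (C := L * |t|) ?_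
    filter_upwards [hc] with i hi
    have := hi.2.1 t 0
    rw [hi.2.2.2.1, sub_zero, sub_zero] at this
    exact this
  choose f hf using hFlim
  have hiso : Isometry g := Isometry.of_dist_eq fun a b => by
    refine tendsto_nhds_unique ((hg a).dist (hg b)) ?_
    simp only [IsometryEquiv.dist_eq, tendsto_const_nhds]
  -- An isometry of the plane into itself is affine by strict convexity, hence onto by dimension.
  set ge : Plane ≃ᵢ Plane :=
    (hiso.affineIsometryOfStrictConvexSpace.toAffineIsometryEquiv rfl).toIsometryEquiv
  have hge : ∀ y, ge y = g y := fun y => by simp [ge]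
  have hfL : ∀ a b, |f a - f b| ≤ L * |a - b| := fun a b => by
    refine le_of_tendsto ((hf a).sub (hf b)).abs ?_
    filter_upwards [hc] with i hi using hi.2.1 a b
  have hgx : g x = 0 := by
    refine tendsto_nhds_unique (hg x) (tendsto_zero_iff_norm_tendsto_zero.2 ?_)
    refine hz.congr' ?_
    filter_upwards [hG0] with i hi using (hi x).symm
  have hf0 : f 0 = 0 := by
    refine tendsto_nhds_unique (hf 0) (tendsto_const_nhds.congr' ?_)
    filter_upwards [hc] with i hi using hi.2.2.2.1.symm
  -- The height of the limit graph above `y`, positive below the graph and negative above it.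
  set S : Plane → ℝ := fun y => f ((g y) 0) - (g y) 1 with hS
  have hcoord : ∀ y (j : Fin 2), Tendsto (fun i => (G i y) j) 𝒰 (𝓝 ((g y) j)) := fun y j =>
    ((EuclideanSpace.proj j : Plane →L[ℝ] ℝ).continuous.tendsto _).comp (hg y)
  have hSlim : ∀ y, Tendsto (fun i => F i ((G i y) 0) - (G i y) 1) 𝒰 (𝓝 (S y)) := fun y => by
    refine Tendsto.sub ?_ (hcoord y 1)
    have h1 : Tendsto (fun i => F i ((G i y) 0) - F i ((g y) 0)) 𝒰 (𝓝 0) := by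
      have h2 : Tendsto (fun i => L * |(G i y) 0 - (g y) 0|) 𝒰 (𝓝 0) := by
        simpa using (((hcoord y 0).sub_const ((g y) 0)).abs).const_mul L
      refine squeeze_zero_norm' ?_ h2
      filter_upwards [hc] with i hi using hi.2.1 _ _
    simpa using h1.add (hf ((g y) 0))
  have hnear : ∀ y ∈ ball x r, S y ≠ 0 → ∃ ρ > 0, ∀ᶠ i in 𝒰, ∀ w ∈ ball y ρ,
      (w ∈ D i ↔ 0 < S y) := by
    intro y hy hSy
    set κ := |S y|
    have hκ : 0 < κ := abs_pos.2 hSy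
    -- Moving by `ρ` changes the height by at most `(L + 1) ρ ≤ κ / 2`, leaving `κ / 2` for the
    -- convergence error. The second bound keeps the ball inside the chart domain once `z i` is
    -- within `ρ` of `x`.
    set ρ := min (κ / (2 * (L + 1))) ((r - dist y x) / 2)
    have hρ : 0 < ρ := by
      have : 0 < r - dist y x := sub_pos.2 hy
      positivity
    have hρ1 : (L + 1) * ρ ≤ κ / 2 := by
      calc _ ≤ (L + 1) * (κ / (2 * (L + 1))) := by gcongr; exact min_le_left _ _
        _ = κ / 2 := by field_simp
    have hρ2 : ρ ≤ (r - dist y x) / 2 := min_le_right _ _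
    have hclose : ∀ᶠ i in 𝒰, |(F i ((G i y) 0) - (G i y) 1) - S y| < κ / 2 := by
      have := (hSlim y).eventually (Metric.ball_mem_nhds _ (half_pos hκ))
      filter_upwards [this] with i hi using hi
    refine ⟨ρ, hρ, ?_⟩
    filter_upwards [hc, hclose, hz.eventually_lt_const hρ] with i hi hcl hzi w hw
    have hwr : w ∈ ball (z i) r := by
      have h1 := dist_triangle w y (z i)
      have h2 := dist_triangle y x (z i)
      have h3 := mem_ball.1 hw
      rw [mem_ball]
      linarith
    rw [hi.2.2.2.2 w hwr]
    have hd : dist (G i w) (G i y) < ρ := by rw [IsometryEquiv.dist_eq]; exact hw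
    have hd' : ∀ j : Fin 2, |(G i w) j - (G i y) j| ≤ ρ := fun j => by
      have := PiLp.norm_apply_le (G i w - G i y) j
      rw [← dist_eq_norm] at this
      exact this.trans hd.le
    have h1 : |F i ((G i w) 0) - F i ((G i y) 0)| ≤ L * ρ :=
      (hi.2.1 _ _).trans (mul_le_mul_of_nonneg_left (hd' 0) hL)
    have h2 := hd' 1
    change 0 < F i ((G i w) 0) - (G i w) 1 ↔ _
    rw [abs_le] at h1 h2
    rw [abs_lt] at hcl
    rcases lt_or_gt_of_ne hSy with hneg | hpos
    · have : κ = -S y := abs_of_neg hneg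
      constructor <;> intro <;> linarith
    · have : κ = S y := abs_of_pos hpos
      constructor <;> intro <;> linarith
  refine ⟨ge, f, hfL, by simp [hge, hgx, hf0], fun y hy => ⟨fun h => ?_, fun h => ?_⟩⟩
  · rw [hge] at h
    obtain ⟨ρ, hρ, hev⟩ := hnear y hy (sub_pos.2 h).ne'
    refine ⟨ρ, hρ, ?_⟩
    filter_upwards [hev] with i hi w hw using (hi w hw).2 (sub_pos.2 h)
  · rw [hge] at h
    obtain ⟨ρ, hρ, hev⟩ := hnear y hy (sub_neg.2 h).ne
    refine ⟨ρ, hρ, ?_⟩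
    filter_upwards [hev] with i hi
    exact disjoint_left.2 fun w hw hwD => lt_asymm ((hi w hw).1 hwD) (sub_neg.2 h)

lemma exists_vertical_shift (g : Plane ≃ᵢ Plane) (y : Plane) (t : ℝ) :
    ∃ w, dist w y = |t| ∧ (g w) 0 = (g y) 0 ∧ (g w) 1 = (g y) 1 + t := by
  refine ⟨g.symm (g y + EuclideanSpace.single 1 t), ?_, by simp, by simp⟩
  rw [← g.dist_eq, g.apply_symm_apply, dist_eq_norm, add_sub_cancel_left]
  simp

/-- Moving down from `x` in the limit chart enters the limit set, so `x` is in its closure; and `x`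
is not in this set, since a ball contained in `D i` has no boundary points of the open set `D i`.
Uniform charts are essential: without them the sets could shrink to nothing, or have slits that
close up in the limit. -/
lemma boundaryUltralimit_subset {r L : ℝ} (hr : 0 < r) (hL : 0 ≤ L)
    (hD : ∀ᶠ i in 𝒰, IsLipschitzDomain r L (D i)) :
    boundaryUltralimit 𝒰 D ⊆ frontier (ultralimit 𝒰 D) := by
  intro x hx
  obtain ⟨g, f, -, hgx, hch⟩ := exists_limit_chart hr hL hD hx
  rw [isOpen_ultralimit.frontier_eq]
  refine ⟨Metric.mem_closure_iff.2 fun δ hδ => ?_, fun ⟨ρ, hρ, h⟩ => ?_⟩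
  · set t := min (δ / 2) (r / 2)
    have ht : 0 < t := by positivity
    obtain ⟨w, hw1, hw2, hw3⟩ := exists_vertical_shift g x (-t)
    rw [abs_neg, abs_of_pos ht] at hw1
    have h1 : t ≤ δ / 2 := min_le_left _ _
    have h2 : t ≤ r / 2 := min_le_right _ _
    refine ⟨w, (hch w ?_).1 ?_, ?_⟩
    · rw [mem_ball]; linarith
    · rw [hw2, hw3, hgx]; linarith
    · rw [dist_comm]; linarith
  · obtain ⟨i, hi1, hi2, hi3⟩ := (h.and ((hx ρ hρ).and hD)).exists
    obtain ⟨w, hw1, hw2⟩ := hi2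
    rw [hi3.1.frontier_eq] at hw2
    exact hw2.2 (hi1 hw1)

lemma ultralimit_mem_lipschitzClass {r L R : ℝ} (hr : 0 < r) (hL : 0 ≤ L)
    (hD : ∀ᶠ i in 𝒰, D i ∈ lipschitzClass r L R) :
    ultralimit 𝒰 D ∈ lipschitzClass r L R := by
  have hsub : ultralimit 𝒰 D ⊆ ball 0 R := fun x hx => by
    obtain ⟨i, hi, hi'⟩ := ((eventually_mem_of_mem_ultralimit hx).and hD).exists
    exact hi'.2 hi
  have hD' : ∀ᶠ i in 𝒰, IsLipschitzDomain r L (D i) := hD.mono fun i hi => hi.1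
  refine ⟨⟨isOpen_ultralimit, isBounded_ball.subset hsub, fun x hx => ?_⟩, hsub⟩
  obtain ⟨g, f, hf, -, hch⟩ := exists_limit_chart hr hL hD' (frontier_ultralimit_subset hx)
  refine ⟨g, f, hf, fun y hy => ⟨fun hyD => ?_, (hch y hy).1⟩⟩
  -- Only points on the graph are in question. If one were in the limit set, a small upward shift
  -- would remain there by openness while lying strictly above the graph, where almost all `D i` are
  -- absent.
  by_contra hlt
  obtain ⟨ρ, hρ, hρs⟩ := Metric.isOpen_iff.1 (isOpen_ultralimit.inter isOpen_ball) y ⟨hyD, hy⟩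
  obtain ⟨w, hw1, hw2, hw3⟩ := exists_vertical_shift g y (ρ / 2)
  rw [abs_of_pos (half_pos hρ)] at hw1
  have hw : w ∈ ultralimit 𝒰 D ∩ ball x r := hρs (by rw [mem_ball]; linarith)
  obtain ⟨δ, hδ, hdis⟩ := (hch w hw.2).2 (by rw [hw2, hw3]; linarith)
  obtain ⟨i, hi1, hi2⟩ := (hdis.and (eventually_mem_of_mem_ultralimit hw.1)).exists
  exact disjoint_left.1 hi1 (mem_ball_self hδ) hi2

/-- Away from the boundary of the limit, the family is locally eventually equal to the limit. -/
lemma eventually_mem_iff_of_isCompact {r L : ℝ} (hr : 0 < r) (hL : 0 ≤ L)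
    (hD : ∀ᶠ i in 𝒰, IsLipschitzDomain r L (D i)) {M : Set Plane} (hM : IsCompact M)
    (hMf : Disjoint M (frontier (ultralimit 𝒰 D))) :
    ∀ᶠ i in 𝒰, ∀ y ∈ M, (y ∈ D i ↔ y ∈ ultralimit 𝒰 D) := by
  refine hM.induction_on (p := fun M => ∀ᶠ i in 𝒰, ∀ y ∈ M, (y ∈ D i ↔ y ∈ ultralimit 𝒰 D))
    (by simp) (fun s t hst h => ?_) (fun s t hs ht => ?_) fun x hx => ?_
  · filter_upwards [h] with i hi y hy using hi y (hst hy)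
  · filter_upwards [hs, ht] with i hi hi' y hy
    exact hy.elim (hi y) (hi' y)
  · have hxb : x ∉ boundaryUltralimit 𝒰 D := fun h =>
      disjoint_left.1 hMf hx (boundaryUltralimit_subset hr hL hD h)
    obtain ⟨ρ, hρ, h | h⟩ := exists_ball_of_notMem_boundaryUltralimit hxb
    · refine ⟨ball x ρ, mem_nhdsWithin_of_mem_nhds (ball_mem_nhds x hρ), ?_⟩
      filter_upwards [h] with i hi y hy
      exact iff_of_true (hi hy) (ball_subset_ultralimit h hy)
    · refine ⟨ball x ρ, mem_nhdsWithin_of_mem_nhds (ball_mem_nhds x hρ), ?_⟩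
      filter_upwards [h] with i hi y hy
      refine iff_of_false (fun hyD => disjoint_left.1 hi hy hyD) fun hyD => ?_
      obtain ⟨j, hj1, hj2⟩ := (h.and (eventually_mem_of_mem_ultralimit hyD)).exists
      exact disjoint_left.1 hj1 hy hj2

end Ultralimit

/-! ### The boundary of a Lipschitz domain is negligible -/

lemma volume_graph_eq_zero {f : ℝ → ℝ} (hf : Continuous f) :
    volume {w : Plane | w 1 = f (w 0)} = 0 := by
  have hmp := (volume_preserving_finTwoArrow ℝ).comp
    (EuclideanSpace.volume_preserving_symm_measurableEquiv_toLp (Fin 2))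
  have hm : MeasurableSet {q : ℝ × ℝ | q.2 = f q.1} :=
    (isClosed_eq continuous_snd (hf.comp continuous_fst)).measurableSet
  have h0 : volume {q : ℝ × ℝ | q.2 = f q.1} = 0 := by
    rw [Measure.volume_eq_prod, Measure.measure_prod_null hm]
    refine .of_forall fun t => ?_
    have : Prod.mk t ⁻¹' {q : ℝ × ℝ | q.2 = f q.1} = {f t} := by ext; simp
    simp [this]
  rw [← hmp.measure_preimage hm.nullMeasurableSet] at h0
  exact h0

/-- Near each of its points the boundary lies in a rigid image of the graph of a continuous
function, which is null by Fubini. -/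
lemma IsLipschitzDomain.volume_frontier {r L : ℝ} {Ω : Set Plane} (hr : 0 < r) (hL : 0 ≤ L)
    (hΩ : IsLipschitzDomain r L Ω) : volume (frontier Ω) = 0 := by
  refine measure_null_of_locally_null _ fun x hx => ?_
  obtain ⟨g, f, hf, -, -, hch⟩ := hΩ.exists_chart hr hL hx
  have hfc : Continuous f := (LipschitzWith.of_dist_le_mul (K := ⟨L, hL⟩) hf).continuous
  refine ⟨frontier Ω ∩ ball x r, inter_mem self_mem_nhdsWithin
    (mem_nhdsWithin_of_mem_nhds (ball_mem_nhds x hr)), ?_⟩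
  have hsub : frontier Ω ∩ ball x r ⊆ g.symm '' {w : Plane | w 1 = f (w 0)} := by
    rintro y ⟨hy, hyr⟩
    refine ⟨g y, ?_, g.symm_apply_apply y⟩
    rw [hΩ.1.frontier_eq] at hy
    refine le_antisymm ?_ (not_lt.1 fun h => hy.2 ((hch y hyr).2 (sub_pos.2 h)))
    by_contra hlt
    have hgc := g.continuous
    have hopen : IsOpen {y : Plane | f ((g y) 0) < (g y) 1} :=
      isOpen_lt (by fun_prop) (by fun_prop)
    obtain ⟨w, ⟨hw1, hw2⟩, hw3⟩ := mem_closure_iff_nhds.1 hy.1 _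
      (inter_mem (hopen.mem_nhds (not_le.1 hlt)) (isOpen_ball.mem_nhds hyr))
    exact lt_asymm hw1 (sub_pos.1 ((hch w hw2).1 hw3))
  refine measure_mono_null hsub ?_
  refine addHaar_image_eq_zero_of_differentiableOn_of_addHaar_eq_zero volume
    (Differentiable.differentiableOn ?_) (volume_graph_eq_zero hfc)
  -- Mazur-Ulam: the motion is affine, hence differentiable, so it preserves null sets.
  have : ⇑g.symm = fun y => g.symm.toRealLinearIsometryEquiv y + g.symm 0 := by
    ext1 y
    rw [IsometryEquiv.toRealLinearIsometryEquiv_apply, sub_add_cancel]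
  rw [this]
  exact g.symm.toRealLinearIsometryEquiv.differentiable.add_const _

/-! ### The admissible class is closed -/

lemma isClosed_phaseFields (R : ℝ) : IsClosed (phaseFields R) := by
  refine IsSeqClosed.isClosed fun v u hv hvu => ?_
  obtain ⟨ns, -, hns⟩ := (tendstoInMeasure_of_tendsto_Lp hvu).exists_seq_tendsto_ae
  have h1 : ∀ᵐ x : Plane, ∀ n, x ∉ ball (0 : Plane) R → v n x = 0 := ae_all_iff.2 fun n => (hv n).1
  have h2 : ∀ᵐ x : Plane, ∀ n, x ∈ ball (0 : Plane) R → 0 ≤ v n x ∧ v n x ≤ 1 :=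
    ae_all_iff.2 fun n => (hv n).2
  constructor
  · filter_upwards [hns, h1] with x hx hx1 hxR
    exact tendsto_nhds_unique hx (tendsto_const_nhds.congr fun n => (hx1 _ hxR).symm)
  · filter_upwards [hns, h2] with x hx hx1 hxR
    exact ⟨ge_of_tendsto' hx fun n => (hx1 _ hxR).1, le_of_tendsto' hx fun n => (hx1 _ hxR).2⟩

lemma integrableOn_chi {D : Set Plane} (hD : IsOpen D) (R : ℝ) :
    IntegrableOn (chi D) (ball 0 R) :=
  (integrableOn_const (measure_ball_lt_top.ne)).indicator hD.measurableSet

/-- Choose for each nearby `v` an admissible set `D v` and take the ultralimit `Ω`. On a compact set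
away from `∂Ω` the functions `χ_{D v}` eventually equal `χ_Ω`, so the bound `γ` passes to the limit
there; exhausting the complement of the null set `∂Ω` gives the whole bound. -/
lemma isClosed_admissible {r L : ℝ} (hr : 0 < r) (hL : 0 ≤ L) (R γ : ℝ) :
    IsClosed (admissible r L R γ) := by
  rw [isClosed_iff_ultrafilter]
  intro u 𝒰 h𝒰 hA
  have hphase : u ∈ phaseFields R :=
    isClosed_iff_ultrafilter.1 (isClosed_phaseFields R) u 𝒰 h𝒰
      (Filter.mem_of_superset hA fun v hv => hv.1)
  have hex : ∀ᶠ v : L1 in 𝒰, ∃ D ∈ lipschitzClass r L R,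
      ∫ x in ball (0 : Plane) R, |v x - chi D x| ≤ γ := Filter.mem_of_superset hA fun v hv => hv.2
  obtain ⟨D, hD⟩ := hex.choice
  have hDc : ∀ᶠ v : L1 in 𝒰, D v ∈ lipschitzClass r L R := hD.mono fun v hv => hv.1
  have hDl : ∀ᶠ v : L1 in 𝒰, IsLipschitzDomain r L (D v) := hDc.mono fun v hv => hv.1
  set Ω := ultralimit 𝒰 D
  have hΩ : Ω ∈ lipschitzClass r L R := ultralimit_mem_lipschitzClass hr hL hDc
  refine ⟨hphase, Ω, hΩ, ?_⟩
  set B : Set Plane := ball 0 R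
  have hint : ∀ (w : L1) (E : Set Plane), IsOpen E → IntegrableOn (fun x => |w x - chi E x|) B :=
    fun w E hE => ((L1.integrable_coeFn w).integrableOn.sub (integrableOn_chi hE R)).abs
  have hγ : 0 ≤ γ := by
    obtain ⟨v, hv⟩ := hD.exists
    exact (integral_nonneg fun x => abs_nonneg _).trans hv.2
  have hsub : Tendsto (fun v : L1 => ‖u - v‖) 𝒰 (𝓝 0) := by
    have : Tendsto (fun v : L1 => ‖u - v‖) (𝓝 u) (𝓝 0) := by
      have h : Continuous fun v : L1 => ‖u - v‖ := by fun_prop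
      simpa using h.tendsto u
    exact this.mono_left h𝒰
  have hcomp : ∀ M, IsCompact M → M ⊆ (frontier Ω)ᶜ →
      ∫⁻ x in M, ENNReal.ofReal |u x - chi Ω x| ∂(volume.restrict B) ≤ ENNReal.ofReal γ := by
    intro M hM hMf
    have hev := eventually_mem_iff_of_isCompact hr hL hDl hM (disjoint_left.2 fun x hx => hMf hx)
    rw [Measure.restrict_restrict hM.measurableSet, ← ofReal_integral_eq_lintegral_ofReal
      ((hint u Ω hΩ.1.1).mono_set inter_subset_right) (.of_forall fun x => abs_nonneg _)]
    refine ENNReal.ofReal_le_ofReal ?_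
    have hlim : Tendsto (fun v : L1 => ‖u - v‖ + γ) 𝒰 (𝓝 γ) := by
      simpa using hsub.add_const γ
    refine ge_of_tendsto hlim ?_
    filter_upwards [hev, hD] with v hv hvD
    have huv : Integrable fun x => |u x - v x| :=
      ((L1.integrable_coeFn u).sub (L1.integrable_coeFn v)).abs
    have hvi := hint v (D v) hvD.1.1.1
    calc ∫ x in M ∩ B, |u x - chi Ω x|
        ≤ ∫ x in M ∩ B, (|u x - v x| + |v x - chi (D v) x|) := by
          refine setIntegral_mono_on ((hint u Ω hΩ.1.1).mono_set inter_subset_right)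
            (huv.integrableOn.add (hvi.mono_set inter_subset_right))
            (hM.measurableSet.inter measurableSet_ball) fun x hx => ?_
          have : chi Ω x = chi (D v) x := by
            unfold chi
            by_cases h : x ∈ Ω
            · rw [indicator_of_mem h, indicator_of_mem ((hv x hx.1).2 h)]
            · rw [indicator_of_notMem h, indicator_of_notMem fun h' => h ((hv x hx.1).1 h')]
          rw [this]
          exact abs_sub_le _ _ _
      _ = (∫ x in M ∩ B, |u x - v x|) + ∫ x in M ∩ B, |v x - chi (D v) x| :=
          integral_add huv.integrableOn (hvi.mono_set inter_subset_right)
      _ ≤ ‖u - v‖ + γ := by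
          refine add_le_add ?_ ?_
          · refine (setIntegral_le_integral huv (.of_forall fun x => abs_nonneg _)).trans
              (le_of_eq ?_)
            rw [L1.norm_eq_integral_norm]
            refine integral_congr_ae ?_
            filter_upwards [Lp.coeFn_sub u v] with x hx
            rw [hx]; rfl
          · exact (setIntegral_mono_set hvi (.of_forall fun x => abs_nonneg _)
              (.of_forall inter_subset_right)).trans hvD.2
  -- Inner regularity of this finite measure on the open complement of `∂Ω` carries out the
  -- exhaustion by compact sets.
  set ν : Measure Plane := (volume.restrict B).withDensity fun x => ENNReal.ofReal |u x - chi Ω x|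
  have hfin : ∫⁻ x, ENNReal.ofReal |u x - chi Ω x| ∂(volume.restrict B) ≠ ⊤ := by
    rw [← ofReal_integral_eq_lintegral_ofReal (hint u Ω hΩ.1.1) (.of_forall fun x => abs_nonneg _)]
    exact ENNReal.ofReal_ne_top
  have : IsFiniteMeasure ν := isFiniteMeasure_withDensity hfin
  have hν : ν univ ≤ ENNReal.ofReal γ := by
    have h0 : ν (frontier Ω) = 0 := by
      refine (withDensity_absolutelyContinuous _ _) ?_
      exact Measure.restrict_le_self.absolutelyContinuous (hΩ.1.volume_frontier hr hL)
    have h1 : ν univ = ν (frontier Ω)ᶜ := by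
      rw [measure_compl isClosed_frontier.measurableSet (measure_ne_top _ _), h0, tsub_zero]
    rw [h1, isClosed_frontier.isOpen_compl.measure_eq_iSup_isCompact]
    refine iSup_le fun M => iSup_le fun hMs => iSup_le fun hM => ?_
    rw [withDensity_apply _ hM.measurableSet]
    exact hcomp M hM hMs
  rw [withDensity_apply _ MeasurableSet.univ, Measure.restrict_univ,
    ← ofReal_integral_eq_lintegral_ofReal (hint u Ω hΩ.1.1) (.of_forall fun x => abs_nonneg _)]
    at hν
  exact (ENNReal.ofReal_le_ofReal_iff hγ).1 hν

lemma zero_mem_admissible {r L R γ : ℝ} (hγ : 0 ≤ γ) : (0 : L1) ∈ admissible r L R γ := by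
  refine ⟨⟨?_, ?_⟩, ∅, ⟨⟨isOpen_empty, Bornology.isBounded_empty, by simp⟩, by simp⟩, ?_⟩
  · simp
  · simp
  · simpa [chi] using hγ

/-! ### Uniform convexity of the `p`-th power of the norm -/

section UniformConvexity

variable {E : Type*} [NormedAddCommGroup E] [NormedSpace ℝ E]

lemma norm_midpoint_rpow_le {p : ℝ} (hp : 1 < p) (a b : E) :
    ‖(1 / 2 : ℝ) • (a + b)‖ ^ p ≤ (‖a‖ ^ p + ‖b‖ ^ p) / 2 := by
  have h1 : ‖(1 / 2 : ℝ) • (a + b)‖ ≤ (1 / 2 : ℝ) • ‖a‖ + (1 / 2 : ℝ) • ‖b‖ := by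
    rw [norm_smul, Real.norm_of_nonneg (by norm_num), ← smul_add, smul_eq_mul]
    exact mul_le_mul_of_nonneg_left (norm_add_le a b) (by norm_num)
  have h2 := (convexOn_rpow hp.le).2 (norm_nonneg a) (norm_nonneg b)
    (by norm_num : (0 : ℝ) ≤ 1 / 2) (by norm_num : (0 : ℝ) ≤ 1 / 2) (by norm_num)
  refine (Real.rpow_le_rpow (norm_nonneg _) h1 (by linarith)).trans (h2.trans (le_of_eq ?_))
  simp only [smul_eq_mul]
  ring

/-- For equal norms the gain comes from strict convexity of the norm, otherwise from strict
convexity of `t ↦ t ^ p`. -/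
lemma norm_midpoint_rpow_lt [StrictConvexSpace ℝ E] {p : ℝ} (hp : 1 < p) {a b : E} (hab : a ≠ b) :
    ‖(1 / 2 : ℝ) • (a + b)‖ ^ p < (‖a‖ ^ p + ‖b‖ ^ p) / 2 := by
  by_cases hn : ‖a‖ = ‖b‖
  · have h := (norm_midpoint_lt_iff hn).2 hab
    have := Real.rpow_lt_rpow (norm_nonneg _) h (by linarith : (0 : ℝ) < p)
    rw [← hn]
    linarith
  · have h1 : ‖(1 / 2 : ℝ) • (a + b)‖ ≤ (1 / 2 : ℝ) • ‖a‖ + (1 / 2 : ℝ) • ‖b‖ := by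
      rw [norm_smul, Real.norm_of_nonneg (by norm_num), ← smul_add, smul_eq_mul]
      exact mul_le_mul_of_nonneg_left (norm_add_le a b) (by norm_num)
    have h2 := (strictConvexOn_rpow hp).2 (norm_nonneg a) (norm_nonneg b) hn
      (by norm_num : (0 : ℝ) < 1 / 2) (by norm_num : (0 : ℝ) < 1 / 2) (by norm_num)
    refine (Real.rpow_le_rpow (norm_nonneg _) h1 (by linarith)).trans_lt (h2.trans_eq ?_)
    simp only [smul_eq_mul]
    ring

/-- A substitute for Clarkson's inequalities, valid for every `p > 1`. Everything is homogeneous of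
degree `p`, so one may normalise `‖a‖ ^ p + ‖b‖ ^ p = 1`. On that compact set, where `‖a - b‖ ^ p ≥
δ`, the convexity defect has a positive minimum. -/
lemma exists_uniform_convexity_const [StrictConvexSpace ℝ E] [ProperSpace E] {p : ℝ} (hp : 1 < p)
    {δ : ℝ} (hδ : 0 < δ) :
    ∃ C : ℝ, 0 ≤ C ∧ ∀ a b : E, ‖a - b‖ ^ p ≤ δ * (‖a‖ ^ p + ‖b‖ ^ p) +
      C * ((‖a‖ ^ p + ‖b‖ ^ p) / 2 - ‖(1 / 2 : ℝ) • (a + b)‖ ^ p) := by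
  have hp0 : 0 < p := by linarith
  have hc : Continuous fun t : ℝ => t ^ p := Real.continuous_rpow_const hp0.le
  set S : Set (E × E) := {z | ‖z.1‖ ^ p + ‖z.2‖ ^ p = 1}
  have hcn : Continuous fun z : E × E => ‖z.1‖ ^ p + ‖z.2‖ ^ p :=
    (hc.comp continuous_fst.norm).add (hc.comp continuous_snd.norm)
  set d : E × E → ℝ := fun z => ‖z.1 - z.2‖ ^ p
  have hd : Continuous d := hc.comp (continuous_fst.sub continuous_snd).norm
  set m : E × E → ℝ := fun z => 1 / 2 - ‖(1 / 2 : ℝ) • (z.1 + z.2)‖ ^ p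
  have hm : Continuous m :=
    continuous_const.sub (hc.comp ((continuous_fst.add continuous_snd).const_smul _).norm)
  have hle1 : ∀ t s : ℝ, 0 ≤ t → 0 ≤ s → t ^ p + s ^ p = 1 → t ≤ 1 := fun t s ht hs h => by
    by_contra hlt
    have h1 := Real.one_lt_rpow (not_le.1 hlt) hp0
    have h2 := Real.rpow_nonneg hs p
    linarith
  have hS : IsCompact S := by
    refine Metric.isCompact_of_isClosed_isBounded (isClosed_eq hcn continuous_const) ?_
    refine (isBounded_closedBall (x := (0 : E × E)) (r := 1)).subset fun z hz => ?_
    rw [mem_closedBall_zero_iff, Prod.norm_def]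
    refine max_le (hle1 _ _ (norm_nonneg _) (norm_nonneg _) hz)
      (hle1 _ _ (norm_nonneg _) (norm_nonneg z.1) ?_)
    rw [add_comm]; exact hz
  obtain ⟨K, hK⟩ := hS.exists_bound_of_continuousOn hd.continuousOn
  have hunit : ∃ C : ℝ, 0 ≤ C ∧ ∀ z ∈ S, d z ≤ δ + C * m z := by
    have hm0 : ∀ z ∈ S, 0 ≤ m z := fun z hz => by
      have h1 := norm_midpoint_rpow_le hp z.1 z.2
      have h2 : ‖z.1‖ ^ p + ‖z.2‖ ^ p = 1 := hz
      rw [h2] at h1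
      exact sub_nonneg.2 h1
    have hS' : IsCompact (S ∩ {z | δ ≤ d z}) := hS.inter_right (isClosed_le continuous_const hd)
    rcases (S ∩ {z | δ ≤ d z}).eq_empty_or_nonempty with he | hne
    · refine ⟨0, le_rfl, fun z hz => ?_⟩
      rw [zero_mul, add_zero]
      by_contra h
      have : z ∈ S ∩ {z | δ ≤ d z} := ⟨hz, (not_le.1 h).le⟩
      rw [he] at this
      exact this
    · obtain ⟨z₀, hz₀, hmin⟩ := hS'.exists_isMinOn hne hm.continuousOn
      have hpos : 0 < m z₀ := by
        have hne' : z₀.1 ≠ z₀.2 := fun h => by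
          have h1 : δ ≤ ‖z₀.1 - z₀.2‖ ^ p := hz₀.2
          rw [h, sub_self, norm_zero, Real.zero_rpow hp0.ne'] at h1
          linarith
        have h1 := norm_midpoint_rpow_lt hp hne'
        have h2 : ‖z₀.1‖ ^ p + ‖z₀.2‖ ^ p = 1 := hz₀.1
        rw [h2] at h1
        exact sub_pos.2 h1
      have hK0 : 0 ≤ K := (norm_nonneg _).trans (hK z₀ hz₀.1)
      refine ⟨K / m z₀, by positivity, fun z hz => ?_⟩
      by_cases h : δ ≤ d z
      · have h1 : m z₀ ≤ m z := hmin ⟨hz, h⟩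
        have h2 : d z ≤ K := (le_abs_self _).trans (hK z hz)
        calc d z ≤ K / m z₀ * m z₀ := by rw [div_mul_cancel₀ _ hpos.ne']; exact h2
          _ ≤ K / m z₀ * m z := by gcongr
          _ ≤ _ := by linarith
      · have := mul_nonneg (div_nonneg hK0 hpos.le) (hm0 z hz)
        linarith
  obtain ⟨C, hC0, hC⟩ := hunit
  refine ⟨C, hC0, fun a b => ?_⟩
  set T := ‖a‖ ^ p + ‖b‖ ^ p
  have ha := Real.rpow_nonneg (norm_nonneg a) p
  have hb := Real.rpow_nonneg (norm_nonneg b) p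
  rcases (add_nonneg ha hb).eq_or_lt with h0 | hT
  · have ha0 : ‖a‖ ^ p = 0 := by linarith
    have hb0 : ‖b‖ ^ p = 0 := by linarith
    have ha1 : a = 0 := norm_eq_zero.1 ((Real.rpow_eq_zero (norm_nonneg _) hp0.ne').1 ha0)
    have hb1 : b = 0 := norm_eq_zero.1 ((Real.rpow_eq_zero (norm_nonneg _) hp0.ne').1 hb0)
    simp [T, ha1, hb1, Real.zero_rpow hp0.ne']
  · replace hT : 0 < T := hT
    -- The scaling factor with `s ^ p = 1 / T`, which brings `(a, b)` to the normalised set.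
    set s : ℝ := T ^ (-p⁻¹)
    have hs : 0 ≤ s := Real.rpow_nonneg hT.le _
    have hsp : s ^ p = T⁻¹ := by
      rw [← Real.rpow_mul hT.le, neg_mul, inv_mul_cancel₀ hp0.ne', Real.rpow_neg_one]
    have hsc : ∀ v : E, ‖s • v‖ ^ p = T⁻¹ * ‖v‖ ^ p := fun v => by
      rw [norm_smul, Real.norm_of_nonneg hs, Real.mul_rpow hs (norm_nonneg _), hsp]
    have hz : (s • a, s • b) ∈ S := by
      change ‖s • a‖ ^ p + ‖s • b‖ ^ p = 1
      rw [hsc, hsc, ← mul_add, inv_mul_cancel₀ hT.ne']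
    have h := hC _ hz
    simp only [d, m] at h
    rw [← smul_sub, ← smul_add, smul_comm, hsc, hsc] at h
    have h2 := mul_le_mul_of_nonneg_left h hT.le
    rw [mul_inv_cancel_left₀ hT.ne'] at h2
    have h3 : ∀ X : ℝ, T * (δ + C * (1 / 2 - T⁻¹ * X)) = δ * T + C * (T / 2 - T * T⁻¹ * X) :=
      fun X => by ring
    rwa [h3, mul_inv_cancel₀ hT.ne', one_mul] at h2

end UniformConvexity

/-! ### Weak limits in the Sobolev space -/

/-- Smooth functions with compact support in `U`. -/
def IsTestFunction (U : Set Plane) (w : Plane → ℝ) : Prop :=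
  ContDiff ℝ ∞ w ∧ HasCompactSupport w ∧ tsupport w ⊆ U

lemma IsTestFunction.continuous_gradient {U : Set Plane} {w : Plane → ℝ}
    (hw : IsTestFunction U w) : Continuous (gradient w) :=
  (InnerProductSpace.toDual ℝ Plane).symm.continuous.comp (hw.1.continuous_fderiv (by simp))

lemma IsTestFunction.gradient_eq_zero {U : Set Plane} {w : Plane → ℝ}
    (hw : IsTestFunction U w) {x : Plane} (hx : x ∉ U) : gradient w x = 0 := by
  have : fderiv ℝ w x = 0 := by
    by_contra h
    exact hx (hw.2.2 (support_fderiv_subset ℝ h))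
  simp [gradient, this]

lemma IsTestFunction.hasCompactSupport_gradient {U : Set Plane} {w : Plane → ℝ}
    (hw : IsTestFunction U w) : HasCompactSupport (gradient w) :=
  (hw.2.1.fderiv (𝕜 := ℝ)).comp_left (g := (InnerProductSpace.toDual ℝ Plane).symm) (map_zero _)

lemma IsTestFunction.memLp_gradient {U : Set Plane} {w : Plane → ℝ} (hw : IsTestFunction U w)
    (p : ℝ≥0∞) (μ : Measure Plane) [IsFiniteMeasureOnCompacts μ] : MemLp (gradient w) p μ :=
  hw.continuous_gradient.memLp_of_hasCompactSupport hw.hasCompactSupport_gradient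

lemma IsTestFunction.midpoint {U : Set Plane} {v w : Plane → ℝ} (hv : IsTestFunction U v)
    (hw : IsTestFunction U w) : IsTestFunction U (fun x => (1 / 2 : ℝ) * (v x + w x)) := by
  have h : tsupport (fun x => (1 / 2 : ℝ) * (v x + w x)) ⊆ tsupport v ∪ tsupport w :=
    (closure_mono fun x hx => by
      by_contra h
      simp only [mem_union, Function.mem_support, not_or, not_not] at h
      simp [h.1, h.2] at hx).trans (closure_union (s := Function.support v)).le
  refine ⟨contDiff_const.mul (hv.1.add hw.1), (hv.2.1.add hw.2.1).mul_left,
    h.trans (union_subset hv.2.2 hw.2.2)⟩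

lemma IsTestFunction.gradient_midpoint {U : Set Plane} {v w : Plane → ℝ}
    (hv : IsTestFunction U v) (hw : IsTestFunction U w) (x : Plane) :
    gradient (fun x => (1 / 2 : ℝ) * (v x + w x)) x =
      (1 / 2 : ℝ) • (gradient v x + gradient w x) := by
  have h1 := (hv.1.differentiable (by simp)) x
  have h2 := (hw.1.differentiable (by simp)) x
  have : fderiv ℝ (fun x => (1 / 2 : ℝ) * (v x + w x)) x =
      (1 / 2 : ℝ) • (fderiv ℝ v x + fderiv ℝ w x) :=
    ((h1.hasFDerivAt.add h2.hasFDerivAt).const_mul _).fderiv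
  rw [gradient, this, map_smul, map_add]
  rfl

/-- The Dirichlet `p`-energy. -/
def energy (p : ℝ) (w : Plane → ℝ) : ℝ := ∫ x, ‖gradient w x‖ ^ p

lemma energy_nonneg (p : ℝ) (w : Plane → ℝ) : 0 ≤ energy p w :=
  integral_nonneg fun _ => Real.rpow_nonneg (norm_nonneg _) _

lemma IsTestFunction.integrable_gradient_rpow {U : Set Plane} {w : Plane → ℝ}
    (hw : IsTestFunction U w) {p : ℝ} (hp : 0 < p) : Integrable (fun x => ‖gradient w x‖ ^ p) := by
  have := (hw.memLp_gradient (ENNReal.ofReal p) volume).integrable_norm_rpow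
    (by simpa using hp) ENNReal.ofReal_ne_top
  rwa [ENNReal.toReal_ofReal hp.le] at this

lemma eLpNorm_eq_rpow_integral {E : Type*} [NormedAddCommGroup E] {f : Plane → E} {p : ℝ}
    (hp : 0 < p) {μ : Measure Plane} (hf : MemLp f (ENNReal.ofReal p) μ) :
    eLpNorm f (ENNReal.ofReal p) μ = ENNReal.ofReal ((∫ x, ‖f x‖ ^ p ∂μ) ^ p⁻¹) := by
  rw [hf.eLpNorm_eq_integral_rpow_norm (by simpa using hp) ENNReal.ofReal_ne_top,
    ENNReal.toReal_ofReal hp.le]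

lemma lintegral_enorm_rpow_eq {E : Type*} [NormedAddCommGroup E] (f : Plane → E) {p : ℝ}
    (hp : 0 < p) (μ : Measure Plane) :
    ∫⁻ x, ‖f x‖ₑ ^ p ∂μ = eLpNorm f (ENNReal.ofReal p) μ ^ p := by
  rw [eLpNorm_eq_lintegral_rpow_enorm_toReal (by simpa using hp) ENNReal.ofReal_ne_top,
    ENNReal.toReal_ofReal hp.le, ← ENNReal.rpow_mul, one_div_mul_cancel hp.ne', ENNReal.rpow_one]

/-- A function that is approximated in `Lᵖ` by test functions of energy at most `m` lies in
`W₀^{1,p}` and has energy at most `m`. -/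
lemma exists_isSobolevZero_of_approx {p : ℝ} (hp : 1 < p) {U : Set Plane} {u : Plane → ℝ}
    (hu : MemLp u (ENNReal.ofReal p)) {m : ℝ}
    (h : ∀ δ : ℝ≥0∞, 0 < δ → ∃ w, IsTestFunction U w ∧
      eLpNorm (fun x => w x - u x) (ENNReal.ofReal p) volume ≤ δ ∧ energy p w ≤ m) :
    ∃ g, IsSobolevZero p U u g ∧ ∫⁻ x, ‖g x‖ₑ ^ p ≤ ENNReal.ofReal m := by
  have hp0 : 0 < p := by linarith
  have : Fact (1 ≤ ENNReal.ofReal p) := ⟨by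
    rw [← ENNReal.ofReal_one]; exact ENNReal.ofReal_le_ofReal hp.le⟩
  set q := ENNReal.ofReal p with hq
  set δ : ℕ → ℝ≥0∞ := fun n => ((n : ℝ≥0∞) + 1)⁻¹ with hδdef
  have hδ0 : ∀ n, 0 < δ n := fun n => ENNReal.inv_pos.2 (by finiteness)
  have hδanti : Antitone δ := fun a b hab => ENNReal.inv_le_inv.2 (by gcongr)
  have hδlim : Tendsto δ atTop (𝓝 0) := by
    have := (tendsto_add_atTop_iff_nat 1).2 ENNReal.tendsto_inv_nat_nhds_zero
    simpa [hδdef] using this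
  set 𝒟 : ℕ → Set (Plane → ℝ) := fun n =>
    {w | IsTestFunction U w ∧ eLpNorm (fun x => w x - u x) q volume ≤ δ n}
  have hanti : ∀ {a b}, a ≤ b → 𝒟 b ⊆ 𝒟 a := fun hab w hw => ⟨hw.1, hw.2.trans (hδanti hab)⟩
  have hbdd : ∀ n, BddBelow (energy p '' 𝒟 n) := fun n =>
    ⟨0, by rintro _ ⟨w, -, rfl⟩; exact energy_nonneg p w⟩
  have hne : ∀ n, (energy p '' 𝒟 n).Nonempty := fun n => by
    obtain ⟨w, hw1, hw2, -⟩ := h (δ n) (hδ0 n)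
    exact ⟨_, w, ⟨hw1, hw2⟩, rfl⟩
  -- The least energy among test functions within `δ n` of `u`: increasing in `n` and bounded by
  -- `m`, hence convergent.
  set d : ℕ → ℝ := fun n => sInf (energy p '' 𝒟 n)
  have hdm : ∀ n, d n ≤ m := fun n => by
    obtain ⟨w, hw1, hw2, hw3⟩ := h (δ n) (hδ0 n)
    exact (csInf_le (hbdd n) ⟨w, ⟨hw1, hw2⟩, rfl⟩).trans hw3
  have hd0 : ∀ n, 0 ≤ d n := fun n => le_csInf (hne n) (by
    rintro _ ⟨w, -, rfl⟩; exact energy_nonneg p w)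
  have hdmono : Monotone d := fun a b hab => csInf_le_csInf (hbdd a) (hne b)
    (image_mono (hanti hab))
  have hdlim := tendsto_atTop_ciSup hdmono ⟨m, by rintro _ ⟨n, rfl⟩; exact hdm n⟩
  set dl := ⨆ n, d n
  have hdle : ∀ n, d n ≤ dl := hdmono.ge_of_tendsto hdlim
  have hdlm : dl ≤ m := le_of_tendsto' hdlim hdm
  have hm0 : 0 ≤ m := (hd0 0).trans (hdm 0)
  set ρ : ℕ → ℝ := fun n => ((n : ℝ) + 1)⁻¹
  have hρ0 : ∀ n, 0 < ρ n := fun n => by positivity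
  have hρ1 : ∀ n, ρ n ≤ 1 := fun n => inv_le_one_of_one_le₀ (by linarith [n.cast_nonneg (α := ℝ)])
  have hρanti : Antitone ρ := fun a b hab => by
    simp only [ρ]
    gcongr
  have hρlim : Tendsto ρ atTop (𝓝 0) := by
    simpa [ρ, one_div] using tendsto_one_div_add_atTop_nhds_zero_nat (𝕜 := ℝ)
  have hw : ∀ n, ∃ w ∈ 𝒟 n, energy p w < d n + ρ n := fun n => by
    obtain ⟨_, ⟨w, hw, rfl⟩, hlt⟩ := exists_lt_of_csInf_lt (hne n)
      (lt_add_of_pos_right (d n) (hρ0 n))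
    exact ⟨w, hw, hlt⟩
  choose w hwD hwE using hw
  set G : ℕ → Lp Plane q (volume : Measure Plane) := fun n =>
    ((hwD n).1.memLp_gradient q volume).toLp
  have hGdist : ∀ n k, dist (G n) (G k) =
      (∫ x, ‖gradient (w n) x - gradient (w k) x‖ ^ p) ^ p⁻¹ := fun n k => by
    have hmem := ((hwD n).1.memLp_gradient q volume).sub ((hwD k).1.memLp_gradient q volume)
    have h0 : 0 ≤ ∫ x, ‖gradient (w n) x - gradient (w k) x‖ ^ p :=
      integral_nonneg fun x => Real.rpow_nonneg (norm_nonneg _) _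
    rw [dist_edist, Lp.edist_toLp_toLp, eLpNorm_eq_rpow_integral hp0 hmem,
      ENNReal.toReal_ofReal (Real.rpow_nonneg ?_ _)]
    · rfl
    · exact h0
  have hcauchy : CauchySeq G := by
    rw [Metric.cauchySeq_iff]
    intro ε hε
    have hεp : 0 < ε ^ p := Real.rpow_pos_of_pos hε p
    -- Both energies are at most `m + 1`, so the `κ` term of the uniform convexity estimate costs at
    -- most `ε ^ p / 2`.
    set κ := ε ^ p / (4 * (m + 1))
    have hκ : 0 < κ := by positivity
    obtain ⟨C, hC0, hC⟩ := exists_uniform_convexity_const (E := Plane) hp hκ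
    have hlim : Tendsto (fun N => C * (dl + ρ N - d N)) atTop (𝓝 0) := by
      have := ((hρlim.const_add dl).sub hdlim).const_mul C
      simpa using this
    obtain ⟨N, hN⟩ := (hlim.eventually_lt_const (half_pos hεp)).exists
    refine ⟨N, fun n hn k hk => ?_⟩
    rw [hGdist, Real.rpow_inv_lt_iff_of_pos
      (integral_nonneg fun x => Real.rpow_nonneg (norm_nonneg _) _) hε.le hp0]
    have hin := (hwD n).1.integrable_gradient_rpow hp0
    have hik := (hwD k).1.integrable_gradient_rpow hp0
    have hmid := (hwD n).1.midpoint (hwD k).1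
    have him := hmid.integrable_gradient_rpow hp0
    set mid : Plane → ℝ := fun x => (1 / 2 : ℝ) * (w n x + w k x)
    -- The midpoint competes at level `N`, so its energy is at least `d N`. As the two energies are
    -- at most `dl + ρ N`, the convexity defect is at most `dl + ρ N - d N`, which tends to zero.
    have hmidD : mid ∈ 𝒟 N := by
      refine ⟨hmid, ?_⟩
      have hn' := (hanti hn (hwD n)).2
      have hk' := (hanti hk (hwD k)).2
      have e : (fun x => mid x - u x) =
          (1 / 2 : ℝ) • ((fun x => w n x - u x) + fun x => w k x - u x) := by
        ext x
        simp only [mid, Pi.smul_apply, Pi.add_apply, smul_eq_mul]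
        ring
      have hae : ∀ j, AEStronglyMeasurable (fun x => w j x - u x) volume := fun j =>
        ((hwD j).1.1.continuous.aestronglyMeasurable).sub hu.1
      rw [e, eLpNorm_const_smul]
      calc _ ≤ ‖(1 / 2 : ℝ)‖ₑ * (δ N + δ N) := by
            gcongr
            exact (eLpNorm_add_le (hae n) (hae k) Fact.out).trans (add_le_add hn' hk')
        _ = δ N := by
            rw [← two_mul, ← mul_assoc, ← ofReal_norm, Real.norm_of_nonneg (by norm_num),
              ← ENNReal.ofReal_ofNat 2, ← ENNReal.ofReal_mul (by norm_num)]
            norm_num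
    have hdN : d N ≤ energy p mid := csInf_le (hbdd N) ⟨mid, hmidD, rfl⟩
    have hEn : energy p (w n) ≤ dl + ρ N :=
      (hwE n).le.trans (add_le_add (hdle n) (hρanti hn))
    have hEk : energy p (w k) ≤ dl + ρ N :=
      (hwE k).le.trans (add_le_add (hdle k) (hρanti hk))
    have key : ∫ x, ‖gradient (w n) x - gradient (w k) x‖ ^ p ≤
        κ * (energy p (w n) + energy p (w k)) +
          C * ((energy p (w n) + energy p (w k)) / 2 - energy p mid) := by
      have hs : Integrable fun x => ‖gradient (w n) x‖ ^ p + ‖gradient (w k) x‖ ^ p := hin.add hik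
      have hi1 := hs.const_mul κ
      have hi3 : Integrable fun x => (‖gradient (w n) x‖ ^ p + ‖gradient (w k) x‖ ^ p) / 2 -
          ‖gradient mid x‖ ^ p := (hs.div_const 2).sub him
      have hi2 := hi3.const_mul C
      calc _ ≤ ∫ x, (κ * (‖gradient (w n) x‖ ^ p + ‖gradient (w k) x‖ ^ p) +
            C * ((‖gradient (w n) x‖ ^ p + ‖gradient (w k) x‖ ^ p) / 2 -
              ‖gradient mid x‖ ^ p)) := by
            refine integral_mono_of_nonneg
              (.of_forall fun x => Real.rpow_nonneg (norm_nonneg _) _) (hi1.add hi2)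
              (.of_forall fun x => ?_)
            have := (hwD n).1.gradient_midpoint (hwD k).1 x
            simp only [mid, this]
            exact hC _ _
        _ = _ := by
            rw [integral_add hi1 hi2, integral_const_mul, integral_const_mul,
              integral_sub (hs.div_const 2) him, integral_div, integral_add hin hik]
            rfl
    have hb1 : κ * (energy p (w n) + energy p (w k)) ≤ ε ^ p / 2 := by
      calc _ ≤ κ * ((m + 1) + (m + 1)) := by
            have := hρ1 N
            gcongr <;> linarith
        _ = ε ^ p / 2 := by simp only [κ]; field_simp; norm_num
    have hb2 : C * ((energy p (w n) + energy p (w k)) / 2 - energy p mid) ≤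
        C * (dl + ρ N - d N) := by
      gcongr
      linarith
    linarith
  obtain ⟨g, hg⟩ := cauchySeq_tendsto_of_complete hcauchy
  have hGcoe : ∀ n, G n =ᵐ[volume] gradient (w n) := fun n => MemLp.coeFn_toLp _
  refine ⟨g, ⟨hu, Lp.memLp g, w, fun n => (hwD n).1, ?_, ?_⟩, ?_⟩
  · exact tendsto_of_tendsto_of_tendsto_of_le_of_le tendsto_const_nhds hδlim
      (fun _ => bot_le) fun n => (hwD n).2
  · have := (Lp.tendsto_Lp_iff_tendsto_eLpNorm' G g).1 hg
    refine this.congr fun n => eLpNorm_congr_ae ?_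
    filter_upwards [hGcoe n] with x hx
    rw [Pi.sub_apply, hx]
  · rw [lintegral_enorm_rpow_eq _ hp0]
    have hnorm : ∀ n, ‖G n‖ ^ p = energy p (w n) := fun n => by
      have h0 := energy_nonneg p (w n)
      rw [Lp.norm_toLp, eLpNorm_eq_rpow_integral hp0 ((hwD n).1.memLp_gradient q volume)]
      change (ENNReal.ofReal (energy p (w n) ^ p⁻¹)).toReal ^ p = _
      rw [ENNReal.toReal_ofReal (Real.rpow_nonneg h0 _)]
      exact Real.rpow_inv_rpow h0 hp0.ne'
    have hlim : Tendsto (fun n => ‖G n‖ ^ p) atTop (𝓝 (‖g‖ ^ p)) :=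
      ((Real.continuous_rpow_const hp0.le).tendsto _).comp hg.norm
    have hle : ‖g‖ ^ p ≤ m := by
      have h2 : Tendsto (fun n => m + ρ n) atTop (𝓝 m) := by simpa using hρlim.const_add m
      refine le_of_tendsto_of_tendsto' hlim h2 fun n => ?_
      rw [hnorm]
      linarith [hwE n, hdm n]
    rw [← ENNReal.ofReal_toReal (Lp.eLpNorm_ne_top g), ← Lp.norm_def,
      ENNReal.ofReal_rpow_of_nonneg (norm_nonneg _) hp0.le]
    exact ENNReal.ofReal_le_ofReal hle

/-! ### Lower semicontinuity of the Modica-Mortola functional -/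

/-- The strict inequality leaves room for the `Lᵖ` error of the gradients; since test functions live
in `U`, their energy on `U` is their whole energy. -/
lemma IsSobolevZero.exists_approx {p : ℝ} (hp : 1 < p) {U : Set Plane} {u : Plane → ℝ}
    {g : Plane → Plane} (h : IsSobolevZero p U u g) {m : ℝ} (hm : 0 ≤ m)
    (hg : ∫⁻ x in U, ‖g x‖ₑ ^ p < ENNReal.ofReal m) {δ : ℝ≥0∞} (hδ : 0 < δ) :
    ∃ w, IsTestFunction U w ∧ eLpNorm (fun x => w x - u x) (ENNReal.ofReal p) volume ≤ δ ∧
      energy p w ≤ m := by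
  have hp0 : 0 < p := by linarith
  have h1p : 1 ≤ ENNReal.ofReal p := by
    rw [← ENNReal.ofReal_one]; exact ENNReal.ofReal_le_ofReal hp.le
  obtain ⟨hu, hgm, v, hv, hvu, hvg⟩ := h
  rw [lintegral_enorm_rpow_eq _ hp0] at hg
  have hg' : eLpNorm g (ENNReal.ofReal p) (volume.restrict U) < ENNReal.ofReal m ^ p⁻¹ := by
    rwa [ENNReal.lt_rpow_inv_iff hp0]
  have h2 : Tendsto (fun n => eLpNorm g (ENNReal.ofReal p) (volume.restrict U) +
      eLpNorm (fun x => gradient (v n) x - g x) (ENNReal.ofReal p) volume) atTop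
      (𝓝 (eLpNorm g (ENNReal.ofReal p) (volume.restrict U))) := by
    simpa using hvg.const_add (eLpNorm g (ENNReal.ofReal p) (volume.restrict U))
  obtain ⟨n, hn1, hn2⟩ := ((h2.eventually_lt_const hg').and (hvu.eventually_le_const hδ)).exists
  have ht : IsTestFunction U (v n) := hv n
  refine ⟨v n, ht, hn2, ?_⟩
  have h3 : eLpNorm (gradient (v n)) (ENNReal.ofReal p) (volume.restrict U) <
      ENNReal.ofReal m ^ p⁻¹ := by
    refine lt_of_le_of_lt ?_ hn1
    have e : gradient (v n) = g + fun x => gradient (v n) x - g x := by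
      ext1 x
      simp
    have hdiff : AEStronglyMeasurable (fun x => gradient (v n) x - g x) volume :=
      ht.continuous_gradient.aestronglyMeasurable.sub hgm.1
    conv_lhs => rw [e]
    exact (eLpNorm_add_le hgm.1.restrict hdiff.restrict h1p).trans
      (add_le_add le_rfl (eLpNorm_restrict_le _ _ _ _))
  have h4 : energy p (v n) = ∫ x in U, ‖gradient (v n) x‖ ^ p :=
    (setIntegral_eq_integral_of_forall_compl_eq_zero fun x hx => by
      rw [ht.gradient_eq_zero hx, norm_zero, Real.zero_rpow hp0.ne']).symm
  have h0 : 0 ≤ energy p (v n) := energy_nonneg _ _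
  rw [eLpNorm_eq_rpow_integral hp0 (ht.memLp_gradient _ _), ← h4,
    ENNReal.ofReal_rpow_of_nonneg hm (by positivity)] at h3
  exact ((Real.rpow_lt_rpow_iff h0 hm (by positivity)).1
    (ENNReal.ofReal_lt_ofReal_iff_of_nonneg (Real.rpow_nonneg h0 _) |>.1 h3)).le

/-- The Dirichlet `p`-energy on `W₀^{1,p}(U)`, infinite elsewhere. -/
def dirichlet (p : ℝ) (U : Set Plane) (u : Plane → ℝ) : ℝ≥0∞ :=
  ⨅ (g : Plane → Plane) (_ : IsSobolevZero p U u g), ∫⁻ x in U, ‖g x‖ₑ ^ p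

/-- The gradient coefficient must be nonzero: off `W₀^{1,p}` the Dirichlet energy is `∞`, and `0 * ∞
= 0` would lose the constraint. -/
lemma modicaMortola_eq {p : ℝ} {W : ℝ → ℝ} {ε : ℝ} (hc : 0 < wellConst p W * ε ^ (p - 1) / p)
    (U : Set Plane) (u : Plane → ℝ) :
    modicaMortola p W U ε u =
      ENNReal.ofReal (wellConst p W / (conjExp p * ε)) * (∫⁻ x in U, ENNReal.ofReal (W (u x))) +
      ENNReal.ofReal (wellConst p W * ε ^ (p - 1) / p) * dirichlet p U u := by
  have h0 : ENNReal.ofReal (wellConst p W * ε ^ (p - 1) / p) ≠ 0 := by simpa using hc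
  simp only [modicaMortola, dirichlet, ENNReal.mul_iInf_of_ne h0 ENNReal.ofReal_ne_top,
    ENNReal.add_iInf]

lemma ae_mem_Icc_of_mem_phaseFields {R : ℝ} {u : L1} (hu : u ∈ phaseFields R) :
    ∀ᵐ x, u x ∈ Icc (0 : ℝ) 1 := by
  filter_upwards [hu.1, hu.2] with x h1 h2
  by_cases hx : x ∈ ball (0 : Plane) R
  · exact h2 hx
  · rw [h1 hx]; simp

lemma memLp_of_mem_phaseFields {R : ℝ} {u : L1} (hu : u ∈ phaseFields R) {p : ℝ} (hp : 1 ≤ p) :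
    MemLp u (ENNReal.ofReal p) := by
  have hp0 : 0 < p := by linarith
  refine ⟨Lp.aestronglyMeasurable u, (ENNReal.rpow_lt_top_iff_of_pos hp0).1 ?_⟩
  rw [← lintegral_enorm_rpow_eq _ hp0]
  have h1 : ∫⁻ x, ‖u x‖ₑ < ⊤ := (L1.integrable_coeFn u).2
  refine (lintegral_mono_ae ?_).trans_lt h1
  filter_upwards [ae_mem_Icc_of_mem_phaseFields hu] with x hx
  refine ENNReal.rpow_le_self_of_le_one ?_ hp
  rw [← ofReal_norm, ENNReal.ofReal_le_one, Real.norm_of_nonneg hx.1]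
  exact hx.2

/-- On functions with values in `[0, 1]`, `L¹` convergence implies `Lᵖ` convergence. -/
lemma eLpNorm_sub_le_of_mem_phaseFields {R : ℝ} {u v : L1} (hu : u ∈ phaseFields R)
    (hv : v ∈ phaseFields R) {p : ℝ} (hp : 1 ≤ p) :
    eLpNorm (fun x => v x - u x) (ENNReal.ofReal p) volume ≤
      (ENNReal.ofReal ‖v - u‖) ^ p⁻¹ := by
  have hp0 : 0 < p := by linarith
  rw [ENNReal.le_rpow_inv_iff hp0, ← lintegral_enorm_rpow_eq _ hp0]
  have h1 : ENNReal.ofReal ‖v - u‖ = ∫⁻ x, ‖v x - u x‖ₑ := by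
    rw [ofReal_norm, Lp.enorm_def, eLpNorm_one_eq_lintegral_enorm]
    refine lintegral_congr_ae ?_
    filter_upwards [Lp.coeFn_sub v u] with x hx
    rw [hx]; rfl
  rw [h1]
  refine lintegral_mono_ae ?_
  filter_upwards [ae_mem_Icc_of_mem_phaseFields hu, ae_mem_Icc_of_mem_phaseFields hv] with x hx hx'
  have : ‖v x - u x‖ₑ ≤ 1 := by
    rw [← ofReal_norm, ENNReal.ofReal_le_one, Real.norm_eq_abs, abs_le]
    constructor <;> linarith [hx.1, hx.2, hx'.1, hx'.2]
  exact ENNReal.rpow_le_self_of_le_one this hp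

/-- If phase fields of smaller energy accumulate at `u`, test functions approximating them
approximate `u` in `Lᵖ` with energy at most `m`, and `exists_isSobolevZero_of_approx` applies. The
constraint `[0, 1]` turns `L¹` closeness into `Lᵖ` closeness. -/
lemma lowerSemicontinuousOn_dirichlet {p : ℝ} (hp : 1 < p) (U : Set Plane) (R : ℝ) :
    LowerSemicontinuousOn (fun u : L1 => dirichlet p U u) (phaseFields R) := by
  intro u hu c hc
  have hp0 : 0 < p := by linarith
  have h1p : 1 ≤ ENNReal.ofReal p := by
    rw [← ENNReal.ofReal_one]; exact ENNReal.ofReal_le_ofReal hp.le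
  by_contra hev
  obtain ⟨m, hm0, hcm, hmu⟩ := ENNReal.lt_iff_exists_real_btwn.1 hc
  refine absurd hmu (not_lt.2 ?_)
  have happrox : ∀ δ : ℝ≥0∞, 0 < δ → ∃ w, IsTestFunction U w ∧
      eLpNorm (fun x => w x - u x) (ENNReal.ofReal p) volume ≤ δ ∧ energy p w ≤ m := by
    intro δ hδ
    have hlim : Tendsto (fun v : L1 => (ENNReal.ofReal ‖v - u‖) ^ p⁻¹) (𝓝 u) (𝓝 0) := by
      have h1 : Continuous fun v : L1 => (ENNReal.ofReal ‖v - u‖) ^ p⁻¹ :=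
        (ENNReal.continuous_rpow_const).comp
          (ENNReal.continuous_ofReal.comp (by fun_prop))
      convert h1.tendsto u using 2
      simp [hp0]
    have hsmall : ∀ᶠ v in 𝓝[phaseFields R] u, v ∈ phaseFields R ∧
        (ENNReal.ofReal ‖v - u‖) ^ p⁻¹ ≤ δ / 2 :=
      (eventually_mem_nhdsWithin).and
        ((hlim.eventually_le_const (ENNReal.half_pos hδ.ne')).filter_mono nhdsWithin_le_nhds)
    obtain ⟨v, hvc, hvA, hvδ⟩ :=
      ((Filter.not_eventually.1 hev).and_eventually hsmall).exists
    have hlt : dirichlet p U v < ENNReal.ofReal m := (not_lt.1 hvc).trans_lt hcm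
    simp only [dirichlet, iInf_lt_iff] at hlt
    obtain ⟨g, hg, hgm⟩ := hlt
    obtain ⟨w, hw1, hw2, hw3⟩ := hg.exists_approx hp hm0 hgm (ENNReal.half_pos hδ.ne')
    refine ⟨w, hw1, ?_, hw3⟩
    have e : (fun x => w x - u x) = (fun x => w x - v x) + fun x => v x - u x := by
      ext x; simp
    rw [e]
    refine (eLpNorm_add_le (hw1.1.continuous.aestronglyMeasurable.sub
      (Lp.aestronglyMeasurable v)) ((Lp.aestronglyMeasurable v).sub
      (Lp.aestronglyMeasurable u)) h1p).trans ?_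
    refine (add_le_add hw2 ((eLpNorm_sub_le_of_mem_phaseFields hu hvA hp.le).trans hvδ)).trans ?_
    rw [ENNReal.add_halves]
  obtain ⟨g, hg, hgm⟩ := exists_isSobolevZero_of_approx hp (memLp_of_mem_phaseFields hu hp.le)
    happrox
  exact (iInf₂_le g hg).trans ((setLIntegral_le_lintegral _ _).trans hgm)

lemma lowerSemicontinuous_lintegral_comp {W : ℝ → ℝ} (hW : Continuous W) (U : Set Plane) :
    LowerSemicontinuous (fun u : L1 => ∫⁻ x in U, ENNReal.ofReal (W (u x))) := by
  intro u c hc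
  by_contra hev
  obtain ⟨v, hvu, hvc⟩ := Filter.exists_seq_forall_of_frequently (Filter.not_eventually.1 hev)
  obtain ⟨ns, -, hns⟩ := (tendstoInMeasure_of_tendsto_Lp hvu).exists_seq_tendsto_ae
  refine absurd hc (not_lt.2 ?_)
  have hmeas : ∀ n, Measurable fun x => ENNReal.ofReal (W (v (ns n) x)) := fun n =>
    ENNReal.measurable_ofReal.comp (hW.measurable.comp (Lp.stronglyMeasurable _).measurable)
  calc ∫⁻ x in U, ENNReal.ofReal (W (u x))
      ≤ ∫⁻ x in U, liminf (fun n => ENNReal.ofReal (W (v (ns n) x))) atTop := by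
        refine lintegral_mono_ae (ae_restrict_of_ae ?_)
        filter_upwards [hns] with x hx
        have h1 : Tendsto (fun n => ENNReal.ofReal (W (v (ns n) x))) atTop
            (𝓝 (ENNReal.ofReal (W (u x)))) :=
          ENNReal.tendsto_ofReal ((hW.tendsto _).comp hx)
        exact h1.liminf_eq.ge
    _ ≤ liminf (fun n => ∫⁻ x in U, ENNReal.ofReal (W (v (ns n) x))) atTop :=
        lintegral_liminf_le hmeas
    _ ≤ c := liminf_le_of_frequently_le' (.of_forall fun n => not_lt.1 (hvc (ns n)))

lemma lowerSemicontinuousOn_modicaMortola {p : ℝ} (hp : 1 < p) {W : ℝ → ℝ} (hW : Continuous W)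
    {ε : ℝ} (hc : 0 < wellConst p W * ε ^ (p - 1) / p) (U : Set Plane) (R : ℝ) :
    LowerSemicontinuousOn (fun u : L1 => modicaMortola p W U ε u) (phaseFields R) := by
  have hmul : ∀ (a : ℝ) (F : L1 → ℝ≥0∞), LowerSemicontinuousOn F (phaseFields R) →
      LowerSemicontinuousOn (fun u => ENNReal.ofReal a * F u) (phaseFields R) := fun a F hF =>
    (ENNReal.continuous_const_mul ENNReal.ofReal_ne_top).comp_lowerSemicontinuousOn hF
      (fun s t hst => mul_le_mul_right hst _)
  simp only [modicaMortola_eq hc]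
  exact (hmul _ _ ((lowerSemicontinuous_lintegral_comp hW U).lowerSemicontinuousOn _)).add
    (hmul _ _ (lowerSemicontinuousOn_dirichlet hp U R))

/-! ### Translations and sliding averages -/

/-- The increment is the integral of the derivative along the segment; then Tonelli and translation
invariance. -/
lemma lintegral_translate_sub_le {f : Plane → ℝ} (hf : ContDiff ℝ 1 f) (τ : Plane) :
    ∫⁻ x, ‖f (x + τ) - f x‖ₑ ≤ ‖τ‖ₑ * ∫⁻ x, ‖fderiv ℝ f x‖ₑ := by
  have hc : Continuous (fderiv ℝ f) := hf.continuous_fderiv (by norm_num)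
  have hpt : ∀ x, ‖f (x + τ) - f x‖ₑ ≤
      ∫⁻ t in Ioc (0 : ℝ) 1, ‖τ‖ₑ * ‖fderiv ℝ f (x + t • τ)‖ₑ := fun x => by
    have hd : ∀ t ∈ uIcc (0 : ℝ) 1,
        HasDerivAt (fun t : ℝ => f (x + t • τ)) (fderiv ℝ f (x + t • τ) τ) t := fun t _ => by
      have h1 : HasDerivAt (fun t : ℝ => x + t • τ) τ t := by
        simpa using ((hasDerivAt_id t).smul_const τ).const_add x
      exact ((hf.differentiable (by norm_num)) _).hasFDerivAt.comp_hasDerivAt t h1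
    have h2 := intervalIntegral.integral_eq_sub_of_hasDerivAt hd
      (Continuous.intervalIntegrable (by fun_prop) _ _)
    simp only [one_smul, zero_smul, add_zero] at h2
    rw [← h2, intervalIntegral.integral_of_le zero_le_one]
    refine (enorm_integral_le_lintegral_enorm _).trans (lintegral_mono fun t => ?_)
    rw [mul_comm]
    exact ContinuousLinearMap.le_opENorm _ _
  calc _ ≤ ∫⁻ x, ∫⁻ t in Ioc (0 : ℝ) 1, ‖τ‖ₑ * ‖fderiv ℝ f (x + t • τ)‖ₑ := lintegral_mono hpt
    _ = ∫⁻ t in Ioc (0 : ℝ) 1, ∫⁻ x, ‖τ‖ₑ * ‖fderiv ℝ f (x + t • τ)‖ₑ := by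
        refine lintegral_lintegral_swap (Continuous.measurable ?_).aemeasurable
        refine (ENNReal.continuous_const_mul enorm_ne_top).comp (continuous_enorm.comp ?_)
        fun_prop
    _ = ∫⁻ t in Ioc (0 : ℝ) 1, ‖τ‖ₑ * ∫⁻ x, ‖fderiv ℝ f x‖ₑ := by
        refine lintegral_congr fun t => ?_
        rw [lintegral_const_mul' _ _ enorm_ne_top,
          lintegral_add_right_eq_self (fun x => ‖fderiv ℝ f x‖ₑ)]
    _ = _ := by simp

/-- The integral of `f` over the ball of radius `a` centred at `x`. -/
def ballIntegral (a : ℝ) (f : Plane → ℝ) (x : Plane) : ℝ := ∫ τ in ball (0 : Plane) a, f (x + τ)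

lemma abs_ballIntegral_le {f : Plane → ℝ} (hf : Integrable f) (a : ℝ) (x : Plane) :
    |ballIntegral a f x| ≤ ∫ y, |f y| := by
  rw [ballIntegral, ← Real.norm_eq_abs]
  refine (norm_integral_le_integral_norm _).trans ?_
  refine (setIntegral_le_integral (hf.comp_add_left x).norm
    (.of_forall fun _ => norm_nonneg _)).trans ?_
  exact (integral_add_left_eq_self (fun y => ‖f y‖) x).le

/-- Moving the centre is translating the function. The averages are thus equi-Lipschitz, so
controlling them on a finite net suffices. -/
lemma abs_ballIntegral_sub_le {f : Plane → ℝ} (hf : Integrable f) {B : ℝ} (hB : 0 ≤ B)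
    (hft : ∀ τ : Plane, ∫⁻ x, ‖f (x + τ) - f x‖ₑ ≤ ENNReal.ofReal (B * ‖τ‖)) (a : ℝ)
    (x z : Plane) : |ballIntegral a f x - ballIntegral a f z| ≤ B * dist x z := by
  have hi : ∀ y, Integrable (fun τ => f (y + τ)) (volume.restrict (ball (0 : Plane) a)) := fun y =>
    (hf.comp_add_left y).restrict
  rw [ballIntegral, ballIntegral, ← integral_sub (hi x) (hi z), ← Real.norm_eq_abs,
    ← ENNReal.ofReal_le_ofReal_iff (by positivity), ofReal_norm]
  refine (enorm_integral_le_lintegral_enorm _).trans ((setLIntegral_le_lintegral _ _).trans ?_)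
  rw [dist_eq_norm]
  refine le_trans (le_of_eq ?_) (hft (x - z))
  rw [← lintegral_add_left_eq_self (fun y => ‖f (y + (x - z)) - f y‖ₑ) z]
  refine lintegral_congr fun τ => ?_
  congr 3
  abel

lemma lintegral_ball_translate_le {f : Plane → ℝ} (hf : Measurable f) {B : ℝ} (hB : 0 ≤ B)
    (hft : ∀ τ : Plane, ∫⁻ x, ‖f (x + τ) - f x‖ₑ ≤ ENNReal.ofReal (B * ‖τ‖)) (a : ℝ)
    (s : Set Plane) :
    ∫⁻ x in s, ∫⁻ τ in ball (0 : Plane) a, ‖f (x + τ) - f x‖ₑ ≤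
      volume (ball (0 : Plane) a) * ENNReal.ofReal (B * a) := by
  rw [lintegral_lintegral_swap (Measurable.aemeasurable (by
    have : Measurable fun z : Plane × Plane => f (z.1 + z.2) - f z.1 := by fun_prop
    exact this.enorm))]
  calc _ ≤ ∫⁻ τ in ball (0 : Plane) a, ENNReal.ofReal (B * a) := by
        refine setLIntegral_mono' measurableSet_ball fun τ hτ => ?_
        refine (setLIntegral_le_lintegral _ _).trans ((hft τ).trans ?_)
        gcongr
        exact (mem_ball_zero_iff.1 hτ).le
    _ = _ := by rw [setLIntegral_const, mul_comm]

/-- Functions with close averages and a common modulus of translation are close in `L¹`. -/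
lemma lintegral_sub_le_of_ballIntegral {f f' : Plane → ℝ} (hf : Measurable f)
    (hf' : Measurable f') (hi : Integrable f) (hi' : Integrable f') {B : ℝ} (hB : 0 ≤ B)
    (hft : ∀ τ : Plane, ∫⁻ x, ‖f (x + τ) - f x‖ₑ ≤ ENNReal.ofReal (B * ‖τ‖))
    (hft' : ∀ τ : Plane, ∫⁻ x, ‖f' (x + τ) - f' x‖ₑ ≤ ENNReal.ofReal (B * ‖τ‖)) (a l : ℝ)
    {s : Set Plane} (hs : MeasurableSet s)
    (hA : ∀ x ∈ s, |ballIntegral a f x - ballIntegral a f' x| ≤ l) :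
    volume (ball (0 : Plane) a) * ∫⁻ x in s, ‖f x - f' x‖ₑ ≤
      2 * (volume (ball (0 : Plane) a) * ENNReal.ofReal (B * a)) +
        ENNReal.ofReal l * volume s := by
  have hm : ∀ g : Plane → ℝ, Measurable g →
      Measurable fun x => ∫⁻ τ in ball (0 : Plane) a, ‖g (x + τ) - g x‖ₑ := fun g hg => by
    refine Measurable.lintegral_prod_right' (f := fun z : Plane × Plane => ‖g (z.1 + z.2) - g z.1‖ₑ)
      ?_
    have : Measurable fun z : Plane × Plane => g (z.1 + z.2) - g z.1 := by fun_prop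
    exact this.enorm
  have hfin : volume (ball (0 : Plane) a) ≠ ⊤ := measure_ball_lt_top.ne
  have hpt : ∀ x ∈ s, volume (ball (0 : Plane) a) * ‖f x - f' x‖ₑ ≤
      ((∫⁻ τ in ball (0 : Plane) a, ‖f (x + τ) - f x‖ₑ) + ENNReal.ofReal l) +
        ∫⁻ τ in ball (0 : Plane) a, ‖f' (x + τ) - f' x‖ₑ := by
    intro x hx
    have hc : ∀ c : ℝ, Integrable (fun _ : Plane => c) (volume.restrict (ball (0 : Plane) a)) :=
      fun c => integrableOn_const hfin
    have h1 := (hi.comp_add_left x).restrict (s := ball (0 : Plane) a)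
    have h1' := (hi'.comp_add_left x).restrict (s := ball (0 : Plane) a)
    have e1 : ∫ τ in ball (0 : Plane) a, (f (x + τ) - f x) =
        ballIntegral a f x - volume.real (ball (0 : Plane) a) * f x := by
      rw [integral_sub h1 (hc _), setIntegral_const, smul_eq_mul, ballIntegral]
    have e1' : ∫ τ in ball (0 : Plane) a, (f' (x + τ) - f' x) =
        ballIntegral a f' x - volume.real (ball (0 : Plane) a) * f' x := by
      rw [integral_sub h1' (hc _), setIntegral_const, smul_eq_mul, ballIntegral]
    -- Each function is compared with its own average, and then the two averages with each other.
    have e2 : volume.real (ball (0 : Plane) a) * (f x - f' x) =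
        (-(∫ τ in ball (0 : Plane) a, (f (x + τ) - f x)) +
          (ballIntegral a f x - ballIntegral a f' x)) +
          ∫ τ in ball (0 : Plane) a, (f' (x + τ) - f' x) := by
      rw [e1, e1']; ring
    have e3 : volume (ball (0 : Plane) a) * ‖f x - f' x‖ₑ =
        ‖volume.real (ball (0 : Plane) a) * (f x - f' x)‖ₑ := by
      rw [enorm_mul, Real.enorm_of_nonneg measureReal_nonneg, ofReal_measureReal hfin]
    rw [e3, e2]
    refine (enorm_add_le _ _).trans (add_le_add ((enorm_add_le _ _).trans (add_le_add ?_ ?_)) ?_)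
    · rw [enorm_neg]
      exact enorm_integral_le_lintegral_enorm _
    · rw [← ofReal_norm]
      exact ENNReal.ofReal_le_ofReal (hA x hx)
    · exact enorm_integral_le_lintegral_enorm _
  rw [← lintegral_const_mul' _ _ hfin]
  refine (setLIntegral_mono' hs hpt).trans ?_
  rw [lintegral_add_right _ (hm f' hf'), lintegral_add_right _ measurable_const, setLIntegral_const,
    two_mul]
  have k1 := lintegral_ball_translate_le hf hB hft a s
  have k2 := lintegral_ball_translate_le hf' hB hft' a s
  calc _ ≤ (volume (ball (0 : Plane) a) * ENNReal.ofReal (B * a) + ENNReal.ofReal l * volume s) +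
        volume (ball (0 : Plane) a) * ENNReal.ofReal (B * a) := by gcongr
    _ = _ := by ring

/-- On the compact set of pairs at distance at least `κ`, injectivity keeps `|H a - H b|` away from
zero, while `|a - b| ≤ 1`. This is uniform continuity of the inverse in an affine form that can be
integrated. -/
lemma exists_inverse_modulus {H : ℝ → ℝ} (hH : ContinuousOn H (Icc 0 1))
    (hinj : InjOn H (Icc 0 1)) {κ : ℝ} (hκ : 0 < κ) :
    ∃ M : ℝ, 0 ≤ M ∧ ∀ a ∈ Icc (0 : ℝ) 1, ∀ b ∈ Icc (0 : ℝ) 1,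
      |a - b| ≤ κ + M * |H a - H b| := by
  set S : Set (ℝ × ℝ) := (Icc (0 : ℝ) 1 ×ˢ Icc (0 : ℝ) 1) ∩ {z | κ ≤ |z.1 - z.2|}
  have hS : IsCompact S := (isCompact_Icc.prod isCompact_Icc).inter_right
    (isClosed_le continuous_const (by fun_prop))
  have hc : ContinuousOn (fun z : ℝ × ℝ => |H z.1 - H z.2|) S :=
    ((hH.comp continuousOn_fst fun z hz => hz.1.1).sub
      (hH.comp continuousOn_snd fun z hz => hz.1.2)).abs
  rcases S.eq_empty_or_nonempty with he | hne
  · refine ⟨0, le_rfl, fun a ha b hb => ?_⟩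
    by_contra h
    have : (a, b) ∈ S := ⟨⟨ha, hb⟩, by
      simp only [mem_ofPred_eq]
      linarith⟩
    rw [he] at this
    exact this
  · obtain ⟨z, hz, hmin⟩ := hS.exists_isMinOn hne hc
    have hpos : 0 < |H z.1 - H z.2| := by
      rw [abs_pos, sub_ne_zero]
      intro h
      have h1 := hinj hz.1.1 hz.1.2 h
      have h2 : κ ≤ |z.1 - z.2| := hz.2
      rw [h1, sub_self, abs_zero] at h2
      linarith
    refine ⟨|H z.1 - H z.2|⁻¹, by positivity, fun a ha b hb => ?_⟩
    by_cases h : κ ≤ |a - b|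
    · have h1 : |H z.1 - H z.2| ≤ |H a - H b| := hmin (show (a, b) ∈ S from ⟨⟨ha, hb⟩, h⟩)
      have h2 : 1 ≤ |H z.1 - H z.2|⁻¹ * |H a - H b| := by
        rw [inv_mul_eq_div, one_le_div hpos]; exact h1
      have h3 : |a - b| ≤ 1 := by
        rw [abs_le]; constructor <;> linarith [ha.1, ha.2, hb.1, hb.2]
      linarith
    · have := mul_nonneg (inv_nonneg.2 hpos.le) (abs_nonneg (H a - H b))
      linarith

/-- A set of phase fields is totally bounded in `L¹` if its image under a strictly monotone
function has a common Lipschitz modulus of translation. -/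
lemma totallyBounded_of_translate_le {R : ℝ} {S : Set L1} (hS : S ⊆ phaseFields R) {H : ℝ → ℝ}
    {A : ℝ} (hA : 0 ≤ A) (hH : ∀ s t, |H s - H t| ≤ A * |s - t|) (hH0 : H 0 = 0)
    (hinj : InjOn H (Icc 0 1)) {B : ℝ} (hB : 0 ≤ B)
    (hSt : ∀ u ∈ S, ∀ τ : Plane, ∫⁻ x, ‖H (u (x + τ)) - H (u x)‖ₑ ≤ ENNReal.ofReal (B * ‖τ‖)) :
    TotallyBounded S := by
  have hHc : Continuous H := (LipschitzWith.of_dist_le_mul (K := ⟨A, hA⟩) hH).continuous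
  rw [totallyBounded_iff_ultrafilter]
  intro 𝒰 h𝒰
  rw [Metric.cauchy_iff]
  refine ⟨𝒰.neBot, fun ε hε => ?_⟩
  have hSmem : S ∈ 𝒰 := Filter.le_principal_iff.1 h𝒰
  set Q : Set Plane := ball 0 R
  have hQfin : volume Q ≠ ⊤ := measure_ball_lt_top.ne
  set q : ℝ := volume.real Q
  have hq0 : 0 ≤ q := measureReal_nonneg
  -- Error budget: the inverse modulus costs `ε / 4` over the ball, the radius `a` of averaging `ε /
  -- 8`, the discrepancy `l` of averages `ε / 4`, in total less than `ε`. The net size `ρ` makes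
  -- averages vary by at most `l / 4` within a cell.
  obtain ⟨M, hM0, hM⟩ := exists_inverse_modulus hHc.continuousOn hinj
    (κ := ε / (4 * (q + 1))) (by positivity)
  set a : ℝ := ε / (16 * ((M + 1) * (B + 1)))
  have ha : 0 < a := by positivity
  set V : ℝ := volume.real (ball (0 : Plane) a)
  have hVfin : volume (ball (0 : Plane) a) ≠ ⊤ := measure_ball_lt_top.ne
  have hV : 0 < V := ENNReal.toReal_pos (measure_ball_pos _ _ ha).ne' hVfin
  set l : ℝ := ε * V / (4 * ((M + 1) * (q + 1)))
  have hl : 0 < l := by positivity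
  set ρ : ℝ := l / (4 * (B + 1))
  have hρ : 0 < ρ := by positivity
  have hmeas : ∀ u : L1, Measurable fun x => H (u x) := fun u =>
    hHc.measurable.comp (Lp.stronglyMeasurable u).measurable
  have hbd : ∀ (u : L1) x, |H (u x)| ≤ A * |u x| := fun u x => by
    simpa [hH0] using hH (u x) 0
  have hint : ∀ u : L1, Integrable fun x => H (u x) := fun u =>
    ((L1.integrable_coeFn u).abs.const_mul A).mono' (hmeas u).aestronglyMeasurable
      (.of_forall fun x => hbd u x)
  have hnormS : ∀ u ∈ S, ∫ x, |u x| ≤ q := fun u hu => by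
    have h1 : ∫ x, |u x| = ∫ x in Q, |u x| := by
      rw [← integral_indicator measurableSet_ball]
      refine integral_congr_ae ?_
      filter_upwards [(hS hu).1] with x hx
      by_cases hxQ : x ∈ Q
      · rw [indicator_of_mem hxQ]
      · rw [indicator_of_notMem hxQ, hx hxQ, abs_zero]
    rw [h1]
    calc _ ≤ ∫ x in Q, (1 : ℝ) := by
          refine integral_mono_ae (L1.integrable_coeFn u).abs.restrict (integrableOn_const hQfin)
            (ae_restrict_of_ae ?_)
          filter_upwards [ae_mem_Icc_of_mem_phaseFields (hS hu)] with x hx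
          rw [abs_of_nonneg hx.1]
          exact hx.2
      _ = q := by rw [setIntegral_const, smul_eq_mul, mul_one]
  have hlim : ∀ z, ∃ c, Tendsto (fun u : L1 => ballIntegral a (fun x => H (u x)) z) 𝒰 (𝓝 c) :=
    fun z => by
      refine exists_tendsto_of_eventually_norm_le (C := A * q) ?_
      filter_upwards [hSmem] with u hu
      refine (abs_ballIntegral_le (hint u) a z).trans ?_
      refine (integral_mono (hint u).abs ((L1.integrable_coeFn u).abs.const_mul A)
        (hbd u)).trans ?_
      rw [integral_const_mul]
      exact mul_le_mul_of_nonneg_left (hnormS u hu) hA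
  choose c hc using hlim
  obtain ⟨t, -, htf, ht⟩ := (isCompact_closedBall (0 : Plane) R).finite_cover_balls hρ
  have hev : ∀ᶠ u : L1 in 𝒰, ∀ z ∈ t,
      |ballIntegral a (fun x => H (u x)) z - c z| < l / 4 := by
    rw [Filter.eventually_all_finite htf]
    intro z _
    exact (hc z).eventually (Metric.ball_mem_nhds _ (by positivity))
  refine ⟨_, Filter.inter_mem hSmem hev, ?_⟩
  rintro u ⟨hu, hut⟩ v ⟨hv, hvt⟩
  have havg : ∀ x ∈ Q, |ballIntegral a (fun x => H (u x)) x -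
      ballIntegral a (fun x => H (v x)) x| ≤ l := by
    intro x hx
    obtain ⟨z, hz, hxz⟩ := mem_iUnion₂.1 (ht (ball_subset_closedBall hx))
    have h1 := abs_ballIntegral_sub_le (hint u) hB (hSt u hu) a x z
    have h2 := abs_ballIntegral_sub_le (hint v) hB (hSt v hv) a x z
    have h3 : B * dist x z ≤ l / 4 := by
      calc _ ≤ (B + 1) * ρ := by
            have := (mem_ball.1 hxz).le
            gcongr
            linarith
        _ = l / 4 := by simp only [ρ]; field_simp
    have h4 : |ballIntegral a (fun x => H (u x)) z - c z| < l / 4 := hut z hz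
    have h5 : |ballIntegral a (fun x => H (v x)) z - c z| < l / 4 := hvt z hz
    rw [abs_le] at h1 h2 ⊢
    rw [abs_lt] at h4 h5
    constructor <;> linarith
  have hHuv := lintegral_sub_le_of_ballIntegral (hmeas u) (hmeas v) (hint u) (hint v) hB
    (hSt u hu) (hSt v hv) a l (measurableSet_ball (x := (0 : Plane)) (ε := R)) havg
  have hHi : Integrable (fun x => H (u x) - H (v x)) := (hint u).sub (hint v)
  have hreal : V * ∫ x in Q, |H (u x) - H (v x)| ≤ 2 * (V * (B * a)) + l * q := by
    have h1 : ∫⁻ x in Q, ‖H (u x) - H (v x)‖ₑ =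
        ENNReal.ofReal (∫ x in Q, |H (u x) - H (v x)|) :=
      (ofReal_integral_norm_eq_lintegral_enorm hHi.restrict).symm
    have h0 : 0 ≤ ∫ x in Q, |H (u x) - H (v x)| := integral_nonneg fun _ => abs_nonneg _
    change volume (ball (0 : Plane) a) * ∫⁻ x in Q, ‖H (u x) - H (v x)‖ₑ ≤ _ at hHuv
    rw [h1, ← ofReal_measureReal hVfin, ← ofReal_measureReal hQfin,
      ← ENNReal.ofReal_mul hV.le, ← ENNReal.ofReal_mul hV.le, ← ENNReal.ofReal_mul hl.le,
      two_mul, ← ENNReal.ofReal_add (by positivity) (by positivity),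
      ← ENNReal.ofReal_add (by positivity) (by positivity),
      ENNReal.ofReal_le_ofReal_iff (by positivity), ← two_mul] at hHuv
    exact hHuv
  have hHle : (M + 1) * ∫ x in Q, |H (u x) - H (v x)| ≤ 3 * ε / 8 := by
    have h1 : (M + 1) * (2 * (V * (B * a)) + l * q) ≤ V * (3 * ε / 8) := by
      have h2 : (M + 1) * (2 * (V * (B * a))) ≤ V * (ε / 8) := by
        calc _ ≤ (M + 1) * (2 * (V * ((B + 1) * a))) := by gcongr; linarith
          _ = V * (ε / 8) := by simp only [a]; field_simp; norm_num
      have h3 : (M + 1) * (l * q) ≤ V * (ε / 4) := by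
        calc _ ≤ (M + 1) * (l * (q + 1)) := by gcongr; linarith
          _ = V * (ε / 4) := by simp only [l]; field_simp
      linarith
    have h4 := mul_le_mul_of_nonneg_left hreal (by linarith : 0 ≤ M + 1)
    nlinarith
  have hdist : dist u v = ∫ x in Q, |u x - v x| := by
    rw [dist_eq_norm, L1.norm_eq_integral_norm, ← integral_indicator measurableSet_ball]
    refine integral_congr_ae ?_
    filter_upwards [Lp.coeFn_sub u v, (hS hu).1, (hS hv).1] with x hx hx1 hx2
    by_cases hxQ : x ∈ Q
    · rw [indicator_of_mem hxQ, hx]; rfl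
    · rw [indicator_of_notMem hxQ, hx, Pi.sub_apply, hx1 hxQ, hx2 hxQ, sub_zero, norm_zero]
  rw [hdist]
  have hfinal : ∫ x in Q, |u x - v x| ≤
      ∫ x in Q, (ε / (4 * (q + 1)) + M * |H (u x) - H (v x)|) := by
    refine integral_mono_ae ((L1.integrable_coeFn u).sub (L1.integrable_coeFn v)).abs.restrict
      ((integrableOn_const hQfin).add (hHi.abs.const_mul M).restrict) (ae_restrict_of_ae ?_)
    filter_upwards [ae_mem_Icc_of_mem_phaseFields (hS hu), ae_mem_Icc_of_mem_phaseFields (hS hv)] with x hx hx'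
    exact hM _ hx _ hx'
  have hconst : Integrable (fun _ : Plane => ε / (4 * (q + 1))) (volume.restrict Q) :=
    integrableOn_const hQfin
  refine hfinal.trans_lt ?_
  rw [integral_add hconst (hHi.abs.const_mul M).restrict, setIntegral_const,
    integral_const_mul, smul_eq_mul]
  have h1 : q * (ε / (4 * (q + 1))) ≤ ε / 4 := by
    calc _ ≤ (q + 1) * (ε / (4 * (q + 1))) := by gcongr; linarith
      _ = ε / 4 := by field_simp
  have h0 : 0 ≤ ∫ x in Q, |H (u x) - H (v x)| := integral_nonneg fun _ => abs_nonneg _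
  change q * (ε / (4 * (q + 1))) + _ < _
  nlinarith

/-! ### The Modica-Mortola trick -/

/-- The integrand `W^{1/p'}` of the Modica-Mortola primitive, set to zero outside `[0, 1]`. -/
def wellRoot (p : ℝ) (W : ℝ → ℝ) (t : ℝ) : ℝ := W (max 0 (min 1 t)) ^ (1 / conjExp p)

/-- The Modica-Mortola primitive `∫₀ᵗ W^{1/p'}`. -/
def wellPrimitive (p : ℝ) (W : ℝ → ℝ) (t : ℝ) : ℝ := ∫ s in (0 : ℝ)..t, wellRoot p W s

lemma clamp_eq_self {t : ℝ} (ht : t ∈ Icc (0 : ℝ) 1) : max 0 (min 1 t) = t := by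
  rw [min_eq_right ht.2, max_eq_right ht.1]

lemma clamp_mem (t : ℝ) : max 0 (min 1 t) ∈ Icc (0 : ℝ) 1 :=
  ⟨le_max_left _ _, max_le zero_le_one (min_le_left _ _)⟩

lemma conjExp_pos {p : ℝ} (hp : 1 < p) : 0 < conjExp p :=
  div_pos (by linarith) (by linarith)

lemma holderConjugate_conjExp {p : ℝ} (hp : 1 < p) : (conjExp p).HolderConjugate p :=
  (Real.HolderConjugate.conjExponent hp).symm

section Well

variable {p : ℝ} {W : ℝ → ℝ}

lemma continuous_wellRoot (hp : 1 < p) (hW : IsDoubleWell W) : Continuous (wellRoot p W) :=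
  (hW.1.comp (by fun_prop)).rpow_const fun _ => Or.inr (one_div_pos.2 (conjExp_pos hp)).le

lemma wellRoot_nonneg (hW : IsDoubleWell W) (t : ℝ) : 0 ≤ wellRoot p W t :=
  Real.rpow_nonneg (hW.2.1 _) _

lemma wellRoot_pos (hW : IsDoubleWell W) {t : ℝ} (ht : t ∈ Ioo (0 : ℝ) 1) :
    0 < wellRoot p W t := by
  unfold wellRoot
  rw [clamp_eq_self (Ioo_subset_Icc_self ht)]
  refine Real.rpow_pos_of_pos ((hW.2.1 t).lt_of_ne fun h => ?_) _
  rcases (hW.2.2 t).1 h.symm with h | h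
  · exact ht.1.ne' h
  · exact ht.2.ne h

lemma wellConst_pos (hp : 1 < p) (hW : IsDoubleWell W) : 0 < wellConst p W := by
  refine inv_pos.2 ?_
  have h1 : ∫ t in (0 : ℝ)..1, W t ^ (1 / conjExp p) = ∫ t in (0 : ℝ)..1, wellRoot p W t := by
    refine intervalIntegral.integral_congr fun t ht => ?_
    rw [uIcc_of_le zero_le_one] at ht
    simp only [wellRoot, clamp_eq_self ht]
  rw [h1]
  exact intervalIntegral.intervalIntegral_pos_of_pos_on
    ((continuous_wellRoot hp hW).intervalIntegrable _ _) (fun t ht => wellRoot_pos hW ht)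
    zero_lt_one

lemma exists_wellRoot_le (hp : 1 < p) (hW : IsDoubleWell W) :
    ∃ A, 0 ≤ A ∧ ∀ t, wellRoot p W t ≤ A := by
  obtain ⟨A, hA⟩ := (isCompact_Icc (a := (0 : ℝ)) (b := 1)).exists_bound_of_continuousOn
    (continuous_wellRoot hp hW).continuousOn
  refine ⟨A, (norm_nonneg _).trans (hA 0 (by simp)), fun t => ?_⟩
  have : wellRoot p W t = wellRoot p W (max 0 (min 1 t)) := by
    simp only [wellRoot, clamp_eq_self (clamp_mem t)]
  rw [this]
  exact (le_abs_self _).trans (hA _ (clamp_mem t))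

lemma hasDerivAt_wellPrimitive (hp : 1 < p) (hW : IsDoubleWell W) (t : ℝ) :
    HasDerivAt (wellPrimitive p W) (wellRoot p W t) t :=
  ((continuous_wellRoot hp hW).integral_hasStrictDerivAt 0 t).hasDerivAt

lemma contDiff_wellPrimitive (hp : 1 < p) (hW : IsDoubleWell W) :
    ContDiff ℝ 1 (wellPrimitive p W) := by
  rw [contDiff_one_iff_deriv]
  refine ⟨fun t => (hasDerivAt_wellPrimitive hp hW t).differentiableAt, ?_⟩
  rw [funext fun t => (hasDerivAt_wellPrimitive hp hW t).deriv]
  exact continuous_wellRoot hp hW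

lemma injOn_wellPrimitive (hp : 1 < p) (hW : IsDoubleWell W) :
    InjOn (wellPrimitive p W) (Icc 0 1) := by
  refine (strictMonoOn_of_deriv_pos (convex_Icc 0 1)
    (contDiff_wellPrimitive hp hW).continuous.continuousOn fun t ht => ?_).injOn
  rw [(hasDerivAt_wellPrimitive hp hW t).deriv]
  rw [interior_Icc] at ht
  exact wellRoot_pos hW ht

lemma abs_wellPrimitive_sub_le (hp : 1 < p) (hW : IsDoubleWell W) {A : ℝ}
    (hA : ∀ t, wellRoot p W t ≤ A) (s t : ℝ) :
    |wellPrimitive p W s - wellPrimitive p W t| ≤ A * |s - t| := by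
  have hi : ∀ a b, IntervalIntegrable (wellRoot p W) volume a b := fun a b =>
    (continuous_wellRoot hp hW).intervalIntegrable a b
  unfold wellPrimitive
  rw [intervalIntegral.integral_interval_sub_left (hi _ _) (hi _ _)]
  refine intervalIntegral.norm_integral_le_of_norm_le_const (f := wellRoot p W) fun x _ => ?_
  rw [Real.norm_of_nonneg (wellRoot_nonneg hW x)]
  exact hA x

/-- Young's inequality for the Modica-Mortola integrand. -/
lemma wellRoot_mul_le (hp : 1 < p) (hW : IsDoubleWell W) {ε : ℝ} (hε : 0 < ε) (t : ℝ) {a : ℝ}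
    (ha : 0 ≤ a) :
    wellRoot p W t * a ≤
      W (max 0 (min 1 t)) / (conjExp p * ε) + ε ^ (p - 1) / p * a ^ p := by
  set q := conjExp p
  have hq : 0 < q := conjExp_pos hp
  have hp0 : 0 < p := by linarith
  have hpq : p / q = p - 1 := by
    simp only [q, conjExp]
    field_simp
  -- The weight in Young's inequality: `e ^ q = ε` and `e ^ p = ε ^ (p - 1)`, matching the two
  -- coefficients of the energy.
  set e := ε ^ (1 / q)
  have he : 0 < e := Real.rpow_pos_of_pos hε _
  have h := Real.young_inequality_of_nonneg (a := e⁻¹ * wellRoot p W t) (b := e * a)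
    (mul_nonneg (inv_nonneg.2 he.le) (wellRoot_nonneg hW t)) (by positivity)
    (holderConjugate_conjExp hp)
  have h1 : e⁻¹ * wellRoot p W t * (e * a) = wellRoot p W t * a := by field_simp
  have h2 : (e⁻¹ * wellRoot p W t) ^ q = ε⁻¹ * W (max 0 (min 1 t)) := by
    rw [Real.mul_rpow (inv_nonneg.2 he.le) (wellRoot_nonneg hW t), Real.inv_rpow he.le, wellRoot,
      ← Real.rpow_mul hε.le, ← Real.rpow_mul (hW.2.1 _), one_div_mul_cancel hq.ne', Real.rpow_one,
      Real.rpow_one]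
  have h3 : (e * a) ^ p = ε ^ (p - 1) * a ^ p := by
    rw [Real.mul_rpow he.le ha, ← Real.rpow_mul hε.le, one_div_mul_eq_div, hpq]
  change e⁻¹ * wellRoot p W t * (e * a) ≤ (e⁻¹ * wellRoot p W t) ^ q / q + _ at h
  rw [h1, h2, h3] at h
  refine h.trans (le_of_eq ?_)
  field_simp

/-- The chain rule gives `|∇(H ∘ v)| = W^{1/p'}(v) |∇v|` with the truncated integrand, and Young's
inequality applies pointwise. Test functions may leave `[0, 1]`, hence the clamped argument of `W`.
-/
lemma IsTestFunction.lintegral_fderiv_wellPrimitive_le (hp : 1 < p) (hW : IsDoubleWell W)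
    {ε : ℝ} (hε : 0 < ε) {U : Set Plane} {v : Plane → ℝ} (hv : IsTestFunction U v) :
    ENNReal.ofReal (wellConst p W) *
        ∫⁻ x, ‖fderiv ℝ (fun y => wellPrimitive p W (v y)) x‖ₑ ≤
      ENNReal.ofReal (wellConst p W / (conjExp p * ε)) *
          (∫⁻ x in U, ENNReal.ofReal (W (max 0 (min 1 (v x))))) +
        ENNReal.ofReal (wellConst p W * ε ^ (p - 1) / p) * ENNReal.ofReal (energy p v) := by
  have hp0 : 0 < p := by linarith
  have hc := wellConst_pos hp hW
  have hq := conjExp_pos hp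
  have hgn : ∀ x, ‖gradient v x‖ = ‖fderiv ℝ v x‖ := fun x =>
    (InnerProductSpace.toDual ℝ Plane).symm.norm_map _
  have hfd : ∀ x, fderiv ℝ (fun y => wellPrimitive p W (v y)) x =
      wellRoot p W (v x) • fderiv ℝ v x := fun x =>
    ((hasDerivAt_wellPrimitive hp hW (v x)).comp_hasFDerivAt x
      ((hv.1.differentiable (by simp)) x).hasFDerivAt).fderiv
  have hsupp : Function.support (fun x => ENNReal.ofReal (wellConst p W) *
      ‖fderiv ℝ (fun y => wellPrimitive p W (v y)) x‖ₑ) ⊆ U := fun x hx => by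
    by_contra hxU
    refine hx ?_
    have h0 : ‖fderiv ℝ v x‖ = 0 := by rw [← hgn, hv.gradient_eq_zero hxU, norm_zero]
    simp only
    rw [hfd, ← ofReal_norm, norm_smul, h0]
    simp
  have hen : ENNReal.ofReal (energy p v) = ∫⁻ x, ENNReal.ofReal (‖gradient v x‖ ^ p) :=
    ofReal_integral_eq_lintegral_ofReal (hv.integrable_gradient_rpow hp0)
      (.of_forall fun x => Real.rpow_nonneg (norm_nonneg _) _)
  have hm : Measurable fun x => ENNReal.ofReal (W (max 0 (min 1 (v x)))) :=
    (ENNReal.continuous_ofReal.comp (hW.1.comp (by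
      have := hv.1.continuous
      fun_prop))).measurable
  rw [← lintegral_const_mul' _ _ ENNReal.ofReal_ne_top, ← setLIntegral_eq_of_support_subset hsupp,
    hen]
  calc _ ≤ ∫⁻ x in U, (ENNReal.ofReal (wellConst p W / (conjExp p * ε)) *
          ENNReal.ofReal (W (max 0 (min 1 (v x)))) +
          ENNReal.ofReal (wellConst p W * ε ^ (p - 1) / p) *
          ENNReal.ofReal (‖gradient v x‖ ^ p)) := by
        refine lintegral_mono fun x => ?_
        rw [hfd, ← ofReal_norm, norm_smul, Real.norm_of_nonneg (wellRoot_nonneg hW _), ← hgn,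
          ← ENNReal.ofReal_mul hc.le, ← ENNReal.ofReal_mul (by positivity),
          ← ENNReal.ofReal_mul (by positivity),
          ← ENNReal.ofReal_add (mul_nonneg (by positivity) (hW.2.1 _)) (by positivity)]
        refine ENNReal.ofReal_le_ofReal ?_
        have := mul_le_mul_of_nonneg_left
          (wellRoot_mul_le hp hW hε (v x) (norm_nonneg (gradient v x))) hc.le
        refine this.trans (le_of_eq ?_)
        ring
    _ = ENNReal.ofReal (wellConst p W / (conjExp p * ε)) *
          (∫⁻ x in U, ENNReal.ofReal (W (max 0 (min 1 (v x))))) +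
          ENNReal.ofReal (wellConst p W * ε ^ (p - 1) / p) *
          ∫⁻ x in U, ENNReal.ofReal (‖gradient v x‖ ^ p) := by
        rw [lintegral_add_left (hm.const_mul _), lintegral_const_mul' _ _ ENNReal.ofReal_ne_top,
          lintegral_const_mul' _ _ ENNReal.ofReal_ne_top]
    _ ≤ _ := by
        gcongr
        exact Measure.restrict_le_self

/-- The Modica-Mortola energy controls the translations of the primitive. -/
lemma lintegral_translate_wellPrimitive_le (hp : 1 < p) (hW : IsDoubleWell W) {ε : ℝ}
    (hε : 0 < ε) {R : ℝ} {u : L1} (hu : u ∈ phaseFields R) {M : ℝ} (hM : 0 ≤ M)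
    (huM : modicaMortola p W (ball 0 R) ε u ≤ ENNReal.ofReal M) (τ : Plane) :
    ∫⁻ x, ‖wellPrimitive p W (u (x + τ)) - wellPrimitive p W (u x)‖ₑ ≤
      ENNReal.ofReal ((M + 1) / wellConst p W * ‖τ‖) := by
  have hp0 : 0 < p := by linarith
  have hc := wellConst_pos hp hW
  have hq := conjExp_pos hp
  set U : Set Plane := ball 0 R
  set α := ENNReal.ofReal (wellConst p W / (conjExp p * ε))
  set β := ENNReal.ofReal (wellConst p W * ε ^ (p - 1) / p)
  -- The extra `1` gives the strict inequality needed to pick an actual weak gradient, and then a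
  -- real bound `m` strictly above its energy.
  set N := ENNReal.ofReal (M + 1)
  have hMN : ENNReal.ofReal M < N := (ENNReal.ofReal_lt_ofReal_iff (by linarith)).2 (by linarith)
  have hlt := huM.trans_lt hMN
  simp only [modicaMortola, iInf_lt_iff] at hlt
  obtain ⟨g, hg, hgN⟩ := hlt
  have hβ : β ≠ 0 := by
    have : 0 < wellConst p W * ε ^ (p - 1) / p := by positivity
    simpa [β] using this
  have hgtop : ∫⁻ x in U, ‖g x‖ₑ ^ p ≠ ⊤ := fun h => by
    rw [h, ENNReal.mul_top hβ, add_top] at hgN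
    exact not_top_lt hgN
  obtain ⟨m, hm0, hgm, hmN⟩ : ∃ m : ℝ, 0 ≤ m ∧ ∫⁻ x in U, ‖g x‖ₑ ^ p < ENNReal.ofReal m ∧
      α * (∫⁻ x in U, ENNReal.ofReal (W (u x))) + β * ENNReal.ofReal m ≤ N := by
    have hcont : Continuous fun y : ℝ≥0∞ =>
        α * (∫⁻ x in U, ENNReal.ofReal (W (u x))) + β * y :=
      continuous_const.add (ENNReal.continuous_const_mul ENNReal.ofReal_ne_top)
    have hev := (hcont.tendsto _).eventually_lt_const hgN
    have : (𝓝[>] (∫⁻ x in U, ‖g x‖ₑ ^ p)).NeBot :=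
      nhdsGT_neBot_of_exists_gt ⟨⊤, lt_top_iff_ne_top.2 hgtop⟩
    obtain ⟨y, hy, hy'⟩ := ((hev.filter_mono nhdsWithin_le_nhds).and
      (self_mem_nhdsWithin (s := Ioi (∫⁻ x in U, ‖g x‖ₑ ^ p)))).exists
    obtain ⟨m, hm0, hm1, hm2⟩ := ENNReal.lt_iff_exists_real_btwn.1 hy'
    exact ⟨m, hm0, hm1, le_trans (by gcongr) hy.le⟩
  have hδ0 : ∀ n : ℕ, (0 : ℝ≥0∞) < ((n : ℝ≥0∞) + 1)⁻¹ := fun n => ENNReal.inv_pos.2 (by finiteness)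
  have hδlim : Tendsto (fun n : ℕ => ((n : ℝ≥0∞) + 1)⁻¹) atTop (𝓝 0) := by
    have := (tendsto_add_atTop_iff_nat 1).2 ENNReal.tendsto_inv_nat_nhds_zero
    simpa using this
  choose w hwt hwu hwE using fun n => hg.exists_approx hp hm0 hgm (hδ0 n)
  have hwlim : Tendsto (fun n => eLpNorm (w n - ⇑u) (ENNReal.ofReal p) volume) atTop (𝓝 0) :=
    tendsto_of_tendsto_of_tendsto_of_le_of_le tendsto_const_nhds hδlim (fun _ => bot_le) hwu
  obtain ⟨ns, -, hns⟩ := (tendstoInMeasure_of_tendsto_eLpNorm (by simpa using hp0)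
    (fun n => (hwt n).1.continuous.aestronglyMeasurable) (Lp.aestronglyMeasurable u)
    hwlim).exists_seq_tendsto_ae
  set P := wellPrimitive p W
  have hP : ContDiff ℝ 1 P := contDiff_wellPrimitive hp hW
  have hPw : ∀ n, ContDiff ℝ 1 fun x => P (w n x) := fun n =>
    hP.comp ((hwt n).1.of_le (by simp))
  have hfatou : ∫⁻ x, ‖P (u (x + τ)) - P (u x)‖ₑ ≤
      liminf (fun n => ∫⁻ x, ‖P (w (ns n) (x + τ)) - P (w (ns n) x)‖ₑ) atTop := by
    refine le_trans (lintegral_mono_ae ?_) (lintegral_liminf_le fun n => ?_)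
    · have hns' := (measurePreserving_add_right volume τ).quasiMeasurePreserving.ae hns
      filter_upwards [hns, hns'] with x hx hx'
      have h1 := (hP.continuous.tendsto _).comp hx
      have h2 := (hP.continuous.tendsto _).comp hx'
      exact ((h2.sub h1).enorm).liminf_eq.ge
    · have h1 := (hPw (ns n)).continuous
      have h2 : Continuous fun x => P (w (ns n) (x + τ)) - P (w (ns n) x) :=
        (h1.comp (continuous_id.add continuous_const)).sub h1
      exact h2.enorm.measurable
  have hWc : Continuous fun t : ℝ => W (max 0 (min 1 t)) := hW.1.comp (by fun_prop)
  have hbound : ∀ n, ∫⁻ x, ‖P (w n (x + τ)) - P (w n x)‖ₑ ≤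
      (ENNReal.ofReal (wellConst p W))⁻¹ * (‖τ‖ₑ * (α * (∫⁻ x in U,
        ENNReal.ofReal (W (max 0 (min 1 (w n x))))) + β * ENNReal.ofReal m)) := fun n => by
    have h1 := lintegral_translate_sub_le (hPw n) τ
    have h2 := (hwt n).lintegral_fderiv_wellPrimitive_le hp hW hε
    have hc0 : ENNReal.ofReal (wellConst p W) ≠ 0 := by simpa using hc
    rw [mul_comm, ← ENNReal.le_div_iff_mul_le (Or.inl hc0) (Or.inl ENNReal.ofReal_ne_top)] at h2
    refine h1.trans ?_
    rw [mul_left_comm, ← ENNReal.div_eq_inv_mul]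
    refine mul_le_mul_right (h2.trans ?_) _
    refine ENNReal.div_le_div_right (add_le_add le_rfl ?_) _
    gcongr
    exact hwE n
  -- Clamping makes the potential bounded without any growth assumption on `W`, and it disappears in
  -- the limit because `u` takes values in `[0, 1]`.
  have hdct : Tendsto (fun n => ∫⁻ x in U, ENNReal.ofReal (W (max 0 (min 1 (w (ns n) x))))) atTop
      (𝓝 (∫⁻ x in U, ENNReal.ofReal (W (u x)))) := by
    obtain ⟨A, hA⟩ := (isCompact_Icc (a := (0 : ℝ)) (b := 1)).exists_bound_of_continuousOn
      hW.1.continuousOn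
    have h1 := tendsto_lintegral_of_dominated_convergence (μ := volume.restrict U)
      (F := fun n x => ENNReal.ofReal (W (max 0 (min 1 (w (ns n) x)))))
      (f := fun x => ENNReal.ofReal (W (u x))) (fun _ => ENNReal.ofReal A)
      (fun n => (ENNReal.continuous_ofReal.comp
        (hWc.comp (hwt (ns n)).1.continuous)).measurable)
      (fun n => .of_forall fun x => ENNReal.ofReal_le_ofReal
        ((le_abs_self _).trans (hA _ (clamp_mem _))))
      (by
        rw [setLIntegral_const]
        exact ENNReal.mul_ne_top ENNReal.ofReal_ne_top measure_ball_lt_top.ne)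
      (ae_restrict_of_ae (by
        filter_upwards [hns, ae_mem_Icc_of_mem_phaseFields hu] with x hx hx'
        have h2 := ENNReal.tendsto_ofReal ((hWc.tendsto _).comp hx)
        rw [clamp_eq_self hx'] at h2
        exact h2))
    exact h1
  have hlim : Tendsto (fun n => (ENNReal.ofReal (wellConst p W))⁻¹ * (‖τ‖ₑ * (α * (∫⁻ x in U,
        ENNReal.ofReal (W (max 0 (min 1 (w (ns n) x))))) + β * ENNReal.ofReal m))) atTop
      (𝓝 ((ENNReal.ofReal (wellConst p W))⁻¹ * (‖τ‖ₑ * (α * (∫⁻ x in U,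
        ENNReal.ofReal (W (u x))) + β * ENNReal.ofReal m)))) := by
    have hc0 : (ENNReal.ofReal (wellConst p W))⁻¹ ≠ ⊤ := by simpa using hc
    refine ENNReal.Tendsto.const_mul (ENNReal.Tendsto.const_mul (Tendsto.add_const _
      (ENNReal.Tendsto.const_mul hdct (Or.inr ENNReal.ofReal_ne_top)))
      (Or.inr enorm_ne_top)) (Or.inr hc0)
  calc _ ≤ _ := hfatou
    _ ≤ _ := liminf_le_liminf (.of_forall fun n => hbound (ns n))
    _ = _ := hlim.liminf_eq
    _ ≤ (ENNReal.ofReal (wellConst p W))⁻¹ * (‖τ‖ₑ * N) := by gcongr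
    _ = _ := by
        rw [← ofReal_norm, ← ENNReal.ofReal_inv_of_pos hc,
          ← ENNReal.ofReal_mul (norm_nonneg _), ← ENNReal.ofReal_mul (inv_nonneg.2 hc.le)]
        congr 1
        field_simp

/-- Sublevel sets of the Modica-Mortola energies, for all `ε` together, are totally bounded. -/
lemma totallyBounded_modicaMortola_le (hp : 1 < p) (hW : IsDoubleWell W) (R : ℝ) {M : ℝ}
    (hM : 0 ≤ M) :
    TotallyBounded {u : L1 | u ∈ phaseFields R ∧
      ∃ ε : ℝ, 0 < ε ∧ modicaMortola p W (ball 0 R) ε u ≤ ENNReal.ofReal M} := by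
  obtain ⟨A, hA0, hA⟩ := exists_wellRoot_le hp hW
  refine totallyBounded_of_translate_le (R := R) (fun u hu => hu.1) hA0
    (abs_wellPrimitive_sub_le hp hW hA) (by simp [wellPrimitive]) (injOn_wellPrimitive hp hW)
    (B := (M + 1) / wellConst p W) (div_nonneg (by linarith) (wellConst_pos hp hW).le) ?_
  rintro u ⟨hu, ε, hε, huM⟩ τ
  exact lintegral_translate_wellPrimitive_le hp hW hε hu hM huM τ

end Well

/-! ### Equicoercivity -/

lemma modicaMortola_zero {p : ℝ} (hp : 1 < p) {W : ℝ → ℝ} (hW : IsDoubleWell W) (U : Set Plane)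
    (ε : ℝ) : modicaMortola p W U ε (0 : L1) = 0 := by
  have hp0 : 0 < p := by linarith
  have hS : IsSobolevZero p U (0 : L1) (fun _ => 0) := by
    refine ⟨?_, MemLp.zero', fun _ _ => 0, fun n => ⟨contDiff_const, ?_, ?_⟩, ?_, ?_⟩
    -- The parameters are arbitrary: only integrability of the zero class is extracted.
    · exact memLp_of_mem_phaseFields (zero_mem_admissible (r := 1) (L := 1) (R := 1) le_rfl).1 hp.le
    · exact HasCompactSupport.zero
    · simp [tsupport]
    · simp
    · simp [gradient]
  have hW0 : W 0 = 0 := (hW.2.2 0).2 (Or.inl rfl)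
  rw [← nonpos_iff_eq_zero]
  refine (iInf₂_le _ hS).trans (le_of_eq ?_)
  simp [hW0, hp0]

lemma chi_mem_Icc (D : Set Plane) (x : Plane) : chi D x ∈ Icc (0 : ℝ) 1 := by
  unfold chi
  by_cases h : x ∈ D
  · rw [indicator_of_mem h]; simp
  · rw [indicator_of_notMem h]; simp

/-- The empty mask has energy bounded independently of `ε`. -/
lemma designFunctional_zero_le {R R' : ℝ} {That : Plane → ℝ} {s₀ s σ h : ℝ} {φ η : ℝ → ℝ}
    (hφ : IsSmoothHeaviside φ) {Ω₀ : Set Plane} {b p : ℝ} (hp : 1 < p) {W : ℝ → ℝ}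
    (hW : IsDoubleWell W) (ε : ℝ) :
    designFunctional R R' That s₀ s σ h φ η Ω₀ b p W ε 0 ≤
      volume (ball (0 : Plane) R') + totalVariation (chi Ω₀) (ball 0 R') := by
  unfold designFunctional
  rw [modicaMortola_zero hp hW, mul_zero, add_zero, exposure_zero, strictDist,
    totalVariation_const, zero_tsub, zero_add, tsub_zero]
  refine add_le_add ?_ le_rfl
  calc _ ≤ ∫⁻ _ in ball (0 : Plane) R', 1 := by
        refine lintegral_mono fun x => ?_
        have h1 := hφ.mem_Icc (-h / η ε)
        have h2 := chi_mem_Icc Ω₀ x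
        rw [← ofReal_norm, ENNReal.ofReal_le_one, Real.norm_eq_abs, abs_le]
        constructor <;> linarith [h1.1, h1.2, h2.1, h2.2]
    _ = _ := by simp

lemma lowerSemicontinuousOn_designFunctional {R R' : ℝ} {That : Plane → ℝ}
    (hT : Continuous That) (hTs : HasCompactSupport That) {s₀ s σ h : ℝ} {φ η : ℝ → ℝ}
    (hφ : IsSmoothHeaviside φ) {Ω₀ : Set Plane} {b p : ℝ} (hp : 1 < p) {W : ℝ → ℝ}
    (hW : IsDoubleWell W) {ε : ℝ} (hε : 0 < ε) :
    LowerSemicontinuousOn (designFunctional R R' That s₀ s σ h φ η Ω₀ b p W ε)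
      (phaseFields R) := by
  have hc : 0 < wellConst p W * ε ^ (p - 1) / p := by
    have := wellConst_pos hp hW
    have hp0 : 0 < p := by linarith
    positivity
  refine LowerSemicontinuousOn.add
    ((lowerSemicontinuous_strictDist_exposure hφ hT hTs h (η ε) s₀ s σ
      measure_ball_lt_top.ne (chi Ω₀)).lowerSemicontinuousOn _) ?_
  exact (ENNReal.continuous_const_mul ENNReal.ofReal_ne_top).comp_lowerSemicontinuousOn
    (lowerSemicontinuousOn_modicaMortola hp hW.1 hc _ _) (fun s t hst => mul_le_mul_right hst _)

end Photolithography

end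

theorem proposition5p4
    -- the class of admissible masks
    (r L R γ : ℝ) (hr : 0 < r) (hL : 0 < L) (hR : 0 < R) (hγ : 0 < γ)
    -- the larger ball in which the image is compared with the target
    (R' : ℝ) (hR' : R < R')
    -- the Fourier transform of the point spread function
    (That : Photolithography.Plane → ℝ) (hThat : ContDiff ℝ ∞ That)
    (hTsupp : HasCompactSupport That) (hTrad : ∀ ξ ζ, ‖ξ‖ = ‖ζ‖ → That ξ = That ζ)
    (s₀ : ℝ) (hs₀ : 0 < s₀) (hs₀1 : s₀ ≤ 1) (hT1 : ∀ ξ ∈ ball 0 s₀, That ξ = 1)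
    -- the optical parameters and the exposure threshold
    (s σ h : ℝ) (hs : 0 < s) (hs1 : s ≤ 1 / s₀) (hσ : 0 < σ) (hσs : σ ≤ s)
    (hh : 0 < h) (hh1 : h < 1)
    -- the smoothed threshold
    (φ : ℝ → ℝ) (hφ : Photolithography.IsSmoothHeaviside φ)
    (η : ℝ → ℝ) (hη : ContinuousOn η (Ici 0)) (hηmono : StrictMonoOn η (Ici 0)) (hη0 : η 0 = 0)
    -- the desired circuit
    (Ω₀ : Set Photolithography.Plane) (hΩ₀ : Ω₀ ∈ Photolithography.lipschitzClass r L R)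
    -- the perimeter penalization
    (b : ℝ) (hb : 0 < b) (p : ℝ) (hp : 1 < p)
    (W : ℝ → ℝ) (hW : Photolithography.IsDoubleWell W)
    (ε₀ : ℝ) (hε₀ : 0 < ε₀) :
    ∃ 𝒦 : Set Photolithography.L1,
      𝒦 ⊆ Photolithography.admissible r L R γ ∧ IsCompact 𝒦 ∧
      ∀ ε : ℝ, 0 < ε → ε ≤ ε₀ →
        ∃ m : ℝ≥0∞,
          IsLeast (Photolithography.designFunctional R R' That s₀ s σ h φ η Ω₀ b p W ε '' 𝒦) m ∧
          IsLeast (Photolithography.designFunctional R R' That s₀ s σ h φ η Ω₀ b p W ε ''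
            Photolithography.admissible r L R γ) m := by
  open Photolithography in
  have hTc : Continuous That := hThat.continuous
  set F := designFunctional R R' That s₀ s σ h φ η Ω₀ b p W
  set C₀ : ℝ≥0∞ := volume (ball (0 : Plane) R') + totalVariation (chi Ω₀) (ball 0 R')
  -- If `C₀ = ∞` this is `0` by convention, which is harmless: every admissible mask then has
  -- infinite cost.
  set M : ℝ := C₀.toReal / b
  have hM : 0 ≤ M := by positivity
  -- The union over all `ε > 0` makes one set serve every `ε`. Limit points need no energy bound,
  -- only admissibility.
  set S : Set L1 := {u | u ∈ admissible r L R γ ∧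
    ∃ ε : ℝ, 0 < ε ∧ modicaMortola p W (ball 0 R) ε u ≤ ENNReal.ofReal M}
  have hclosed := isClosed_admissible hr hL.le R γ
  have hsub : closure S ⊆ admissible r L R γ := closure_minimal (fun u hu => hu.1) hclosed
  have hcomp : IsCompact (closure S) := by
    refine isCompact_iff_totallyBounded_isComplete.2
      ⟨TotallyBounded.closure ?_, isClosed_closure.isComplete⟩
    refine TotallyBounded.subset ?_ (totallyBounded_modicaMortola_le hp hW R hM)
    exact fun u hu => ⟨hu.1.1, hu.2⟩
  have h0S : (0 : L1) ∈ closure S := subset_closure ⟨zero_mem_admissible hγ.le, 1, one_pos, by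
    rw [modicaMortola_zero hp hW]
    exact bot_le⟩
  refine ⟨closure S, hsub, hcomp, fun ε hε _ => ?_⟩
  obtain ⟨a, ha, hmin⟩ := LowerSemicontinuousOn.exists_isMinOn ⟨0, h0S⟩ hcomp
    ((lowerSemicontinuousOn_designFunctional (R' := R') (s₀ := s₀) (s := s) (σ := σ) (h := h)
      (η := η) (Ω₀ := Ω₀) (b := b) hTc hTsupp hφ hp hW hε).mono fun u hu => (hsub hu).1)
  have hmin' : ∀ u ∈ closure S, F ε a ≤ F ε u := fun u hu => hmin hu
  refine ⟨F ε a, ⟨⟨a, ha, rfl⟩, ?_⟩, ⟨a, hsub ha, rfl⟩, ?_⟩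
  · rintro _ ⟨u, hu, rfl⟩
    exact hmin' u hu
  · rintro _ ⟨u, hu, rfl⟩
    by_cases huS : modicaMortola p W (ball 0 R) ε u ≤ ENNReal.ofReal M
    · exact hmin' u (subset_closure ⟨hu, ε, hε, huS⟩)
    · refine (hmin' 0 h0S).trans ((designFunctional_zero_le hφ hp hW ε).trans ?_)
      -- A target of infinite perimeter would make the functional identically infinite.
      by_cases hfin : totalVariation (chi Ω₀) (ball 0 R') = ⊤
      · have hΦ := totalVariation_exposure_ne_top hφ hTc hTsupp h (η ε) s₀ s σ
          (U := ball 0 R') measure_ball_lt_top.ne u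
        have : F ε u = ⊤ := by
          simp only [F, designFunctional, strictDist, hfin, ENNReal.top_sub hΦ, add_top, top_add]
        rw [this]
        exact le_top
      · have hC₀ : C₀ ≠ ⊤ := ENNReal.add_ne_top.2 ⟨measure_ball_lt_top.ne, hfin⟩
        calc C₀ = ENNReal.ofReal b * ENNReal.ofReal M := by
              rw [← ENNReal.ofReal_mul hb.le, mul_div_cancel₀ _ hb.ne', ENNReal.ofReal_toReal hC₀]
          _ ≤ ENNReal.ofReal b * modicaMortola p W (ball 0 R) ε u := by
              gcongr
              exact (not_le.1 huS).le
          _ ≤ _ := le_add_self
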